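/- **Setting.** Let $\Lambda_n=[-n,n]^2\cap\mathbb Z^2$ with its nearest-neighbour edges, and let $\beta\ge 0$. *XY model.* Let $\langle\cdot\rangle_{n,\beta}$ be the expectation on $(\mathbb S^1)^{\Lambda_n}$ with density proportional to $\exp\sum_{\{x,y\}}\frac\beta2(\sigma_x\bar\sigma_y+\bar\sigma_x\sigma_y)$ with respect to Haar measure (sum over the edges of $\Lambda_n$; $\langle\sigma_x\bar\sigma_y\rangle_{n,\beta}$ is real). Set $\langle\sigma_x\bar\sigma_y\rangle_{\mathbb Z^2,\beta}=\lim_{n\to\infty}\langle\sigma_x\bar\sigma_y\rangle_{n,\beta}$ and $$m_{XY}(\beta)=\lim_{k\to\infty}-\tfrac1k\log\langle\sigma_{(0,0)}\bar\sigma_{(k,0)}\rangle_{\mathbb Z^2,\beta}\in[0,\infty],\qquad -\log 0=\infty .$$ *Height function.* A current is a function $\mathbf n$ from the directed edges of $\Lambda_n$ to $\mathbb Z_{\ge0}$; it is sourceless ($\partial\mathbf n=0$) if $\sum_{y\sim x}(\mathbf n_{xy}-\mathbf n_{yx})=0$ for every $x$. Give a sourceless current the probability proportional to $\prod_{xy}(\beta/2)^{\mathbf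 n_{xy}}/\mathbf n_{xy}!$. Let $F_a$ be the face of $\mathbb Z^2$ with lower-left corner $a$. The height function $h$ of $\mathbf n$ is zero on the faces $F_a$ with $a\notin[-n,n)^2$, and across a directed edge $xy$ the value of $h$ on the right minus its value on the left is $\mathbf n_{xy}-\mathbf n_{yx}$. Set $\operatorname{Cov}_{n,\beta}[a;b]=\mathbb E[h(F_a)h(F_b)]$, $\operatorname{SigCov}_{n,\beta}[a;b]=\mathbb E[\operatorname{sign}h(F_a)\operatorname{sign}h(F_b)]$, let $\operatorname{Cov}_{\infty,\beta}[a;b]\in[0,\infty]$ be the limit (equivalently, upper limit) of $\operatorname{Cov}_{n,\beta}[a;b]$ as $n\to\infty$, and set $$m_{\mathrm{Height}}(\beta)=\liminf_{k\to\infty}-\tfrac1k\log\bigl(\operatorname{Cov}_{\infty,\beta}[(0,0);(0,k)]\wedge1\bigr)\in[0,\infty].$$ *Cycles.* Let $\mathbb P_{n,\beta/2}$ be the law of a Poisson point process $\Pi$ of unit intensity (counting times Lebesgue measure) on $\{\text{directed edges of }\Lambda_n\}\times[0,\beta/2]$, conditioned on the current that counts its points on each directed edge being sourceless. Its points are directed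 edges with (almost surely distinct) times. A cycle is a non-empty connected set of such edges with in-degree and out-degree one at each of its vertices. Let $M(\Pi)$ contain, for each vertex with an outgoing edge in $\Pi$, the outgoing edge with maximal time; let $C^1(\Pi)$ be the set of cycles contained in $M(\Pi)$, $C^{k+1}(\Pi)=C^k(\Pi)\cup C^1(\Pi\setminus\bigcup C^k(\Pi))$, and $C(\Pi)=\bigcup_k C^k(\Pi)$. A cycle surrounds a face if its winding number around that face is non-zero. **Lemma.** Let $\beta\ge0$. The limits that define $\langle\sigma_x\bar\sigma_y\rangle_{\mathbb Z^2,\beta}$ and $m_{XY}(\beta)$ exist, and $$m_{XY}(\beta)\le\tfrac12\,m_{\mathrm{Height}}(\beta).$$ Moreover, for all $n\ge0$ and $a,b\in\mathbb Z^2$, $$\operatorname{SigCov}_{n,\beta}[a;b]\le\mathbb P_{n,\beta/2}\bigl[\exists\eta\in C(\Pi):\ \eta\text{ surrounds }F_a\text{ and }F_b\bigr],$$ and for all $n,m\ge0$, writing $Q_-=\{(0,k):k\le0\}$ and $Q_+^m=\{(0,k):k\ge m\}$, $$\mathbb P_{n,\beta/2}\bigl[\exists\eta\in C(\Pi):\ \eta\text{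 surrounds }F_{(0,0)}\text{ and }F_{(0,m)}\bigr]\le2\sum_{x\in Q_-\cap\Lambda_n}\ \sum_{y\in Q_+^m\cap\Lambda_n}\langle\sigma_x\bar\sigma_y\rangle_{n,\beta}^2 ,$$ and the same probability is at most $2\sum_{x\in Q_-,\,y\in Q_+^m}\langle\sigma_x\bar\sigma_y\rangle_{\mathbb Z^2,\beta}^2$ (possibly infinite). -/

import Mathlib

open MeasureTheory ProbabilityTheory Filter Topology
open scoped ENNReal Nat

noncomputable section

namespace XYHeight

/-! ### The box and its nearest-neighbour graph -/

/-- The vertex set `Λ_n = [-n, n]² ∩ ℤ²`. -/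
def box (n : ℕ) : Finset (ℤ × ℤ) :=
  Finset.Icc (-(n : ℤ), -(n : ℤ)) ((n : ℤ), (n : ℤ))

/-- The graph on `Λ_n` whose edges join the vertices at Euclidean distance one. -/
def boxGraph (n : ℕ) : SimpleGraph (box n) where
  Adj x y := (y.1.1 - x.1.1) ^ 2 + (y.1.2 - x.1.2) ^ 2 = 1
  symm := ⟨fun x y h => by
    rw [← h]; ring⟩
  loopless := ⟨fun x h => by simp at h⟩

instance (n : ℕ) : DecidableRel (boxGraph n).Adj := fun x y =>
  inferInstanceAs (Decidable ((y.1.1 - x.1.1) ^ 2 + (y.1.2 - x.1.2) ^ 2 = 1))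

/-- The directed edges of `Λ_n`; `d.fst` is the origin of `d`, `d.snd` its end,
and `d.symm` its reversal. -/
abbrev DirEdge (n : ℕ) : Type := (boxGraph n).Dart

/-! ### The XY model -/

/-- The spin configuration with angles `θ` (in units of a full turn). -/
def spins {n : ℕ} (θ : box n → UnitAddCircle) (x : box n) : ℂ :=
  (AddCircle.toCircle (θ x) : ℂ)

/-- The exponent `∑_{{x,y}} (β/2) (σ_x σ̄_y + σ̄_x σ_y)`, written as a sum over directed edges:
the two orientations of `{x, y}` give the two terms. -/
def xyExponent (n : ℕ) (β : ℝ) (σ : box n → ℂ) : ℂ :=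
  ∑ d : DirEdge n, (β / 2 : ℂ) * (σ d.fst * (starRingEnd ℂ) (σ d.snd))

/-- The Haar probability measure on `(𝕊¹)^{Λ_n}`, in terms of angles. -/
def xyHaar (n : ℕ) : Measure (box n → UnitAddCircle) :=
  Measure.pi fun _ => AddCircle.haarAddCircle

/-- The partition function `Z_{n,β}` of the XY model. -/
def xyPartition (n : ℕ) (β : ℝ) : ℂ :=
  ∫ θ, Complex.exp (xyExponent n β (spins θ)) ∂(xyHaar n)

/-- The expectation `⟨f⟩_{n,β}` in the XY model in `Λ_n` at inverse temperature `β`. -/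
def xyExpect (n : ℕ) (β : ℝ) (f : (box n → ℂ) → ℂ) : ℂ :=
  (∫ θ, f (spins θ) * Complex.exp (xyExponent n β (spins θ)) ∂(xyHaar n)) / xyPartition n β

open Classical in
/-- The two-point function `⟨σ_x σ̄_y⟩_{n,β}` for `x, y ∈ Λ_n` (a real number), and `0` if `x` or
`y` is not in `Λ_n`. -/
def twoPoint (n : ℕ) (β : ℝ) (x y : ℤ × ℤ) : ℝ :=
  if h : x ∈ box n ∧ y ∈ box n then
    (xyExpect n β fun σ => σ ⟨x, h.1⟩ * (starRingEnd ℂ) (σ ⟨y, h.2⟩)).re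
  else 0

/-- The full-plane two-point function `⟨σ_x σ̄_y⟩_{ℤ²,β}`. -/
def twoPointInf (β : ℝ) (x y : ℤ × ℤ) : ℝ :=
  limUnder atTop fun n : ℕ => twoPoint n β x y

/-- The sequence `-(1/k) log ⟨σ_{(0,0)} σ̄_{(k,0)}⟩_{ℤ²,β}` with values in `[-∞, ∞]`
(and `-log 0 = ∞`). -/
def xyDecayRate (β : ℝ) (k : ℕ) : EReal :=
  -ENNReal.log (ENNReal.ofReal (twoPointInf β (0, 0) ((k : ℤ), 0))) / ((k : ℝ) : EReal)

/-- The mass of the XY model. -/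
def massXY (β : ℝ) : EReal :=
  limUnder atTop (xyDecayRate β)

/-! ### Currents and the height function -/

/-- Currents: the functions from directed edges to non-negative integers. -/
abbrev Current (n : ℕ) : Type := DirEdge n → ℕ

/-- The source function `∂𝐧`, that is, `x ↦ ∑_{y ∼ x} (𝐧_{xy} - 𝐧_{yx})`. -/
def source {n : ℕ} (c : Current n) (x : box n) : ℤ :=
  ∑ d : DirEdge n with d.fst = x, ((c d : ℤ) - c d.symm)

/-- The current has no sources. -/
def Sourceless {n : ℕ} (c : Current n) : Prop := ∀ x, source c x = 0

/-- The measure `M_{n,T}` on currents: the weight of `𝐧` is `∏_{xy} T^{𝐧_{xy}} / 𝐧_{xy}!`. -/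
def currentMeasure (n : ℕ) (T : ℝ) : Measure (Current n) :=
  Measure.sum fun c : Current n =>
    ENNReal.ofReal (∏ d, T ^ c d / (c d)!) • Measure.dirac c

/-- The probability measure `M_{n,T}[ · | ∂𝐧 = 0]` on currents. -/
def currentLaw (n : ℕ) (T : ℝ) : Measure (Current n) :=
  ProbabilityTheory.cond (currentMeasure n T) {c | Sourceless c}

/-- The net flow `𝐧_{xy} - 𝐧_{yx}`, which is `0` if `xy` is not a directed edge of `Λ_n`. -/
def flow {n : ℕ} (c : Current n) (x y : ℤ × ℤ) : ℤ :=
  ∑ d : DirEdge n with d.fst.1 = x ∧ d.snd.1 = y, ((c d : ℤ) - c d.symm)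

/-- `h` is a height function of the current `c`. The face `F_a` is indexed by its lower-left corner
`a`; it is a bounded face of `Λ_n` if and only if `a ∈ [-n, n)²`, and all other faces of `ℤ²`
belong to the outer face, where `h` vanishes. Across an edge `xy`, the value of `h` on the right
minus the value on the left is `𝐧_{xy} - 𝐧_{yx}`: the vertical edge from `a` to `a + (0,1)` has
`F_a` on its right and `F_{a - (1,0)}` on its left, and the horizontal edge from `a` to `a + (1,0)`
has `F_{a - (0,1)}` on its right and `F_a` on its left. -/
structure IsHeight {n : ℕ} (c : Current n) (h : ℤ × ℤ → ℤ) : Prop where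
  outside : ∀ i j : ℤ, ¬ ((-(n : ℤ) ≤ i ∧ i < n) ∧ (-(n : ℤ) ≤ j ∧ j < n)) → h (i, j) = 0
  vertical : ∀ i j : ℤ, h (i, j) - h (i - 1, j) = flow c (i, j) (i, j + 1)
  horizontal : ∀ i j : ℤ, h (i, j - 1) - h (i, j) = flow c (i, j) (i + 1, j)

/-- The height function of a sourceless current (its winding number around the faces), obtained by
summing the net flow across the horizontal dual path that enters from the left. -/
def height {n : ℕ} (c : Current n) (a : ℤ × ℤ) : ℤ :=
  ∑ i ∈ Finset.Icc (-(n : ℤ)) a.1, flow c (i, a.2) (i, a.2 + 1)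

theorem mem_box {n : ℕ} {x : ℤ × ℤ} :
    x ∈ box n ↔ (-(n : ℤ) ≤ x.1 ∧ x.1 ≤ n) ∧ (-(n : ℤ) ≤ x.2 ∧ x.2 ≤ n) := by
  simp only [box, Finset.mem_Icc, Prod.le_def]
  tauto

theorem flow_eq_zero {n : ℕ} (c : Current n) {x y : ℤ × ℤ} (h : ¬ (x ∈ box n ∧ y ∈ box n)) :
    flow c x y = 0 := by
  unfold flow
  rw [Finset.filter_false_of_mem, Finset.sum_empty]
  rintro d - ⟨h1, h2⟩
  exact h ⟨h1 ▸ d.fst.2, h2 ▸ d.snd.2⟩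

theorem flow_swap {n : ℕ} (c : Current n) (x y : ℤ × ℤ) : flow c y x = -flow c x y := by
  unfold flow
  rw [← Finset.sum_neg_distrib]
  refine Finset.sum_nbij' (fun d => d.symm) (fun d => d.symm) ?_ ?_ ?_ ?_ ?_
  · intro d hd
    simpa [and_comm] using hd
  · intro d hd
    simpa [and_comm] using hd
  · intro d _; simp
  · intro d _; simp
  · intro d _; simp

/-- Kirchhoff's law for the net flow of a sourceless current. -/
theorem flow_kirchhoff {n : ℕ} {c : Current n} (hc : Sourceless c) (i j : ℤ) :
    flow c (i, j) (i + 1, j) + flow c (i, j) (i - 1, j) + flow c (i, j) (i, j + 1)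
      + flow c (i, j) (i, j - 1) = 0 := by
  by_cases hx : (i, j) ∈ box n
  · have h0 := hc ⟨(i, j), hx⟩
    rw [← h0]
    unfold source flow
    simp only [Finset.sum_filter, ← Finset.sum_add_distrib]
    refine Finset.sum_congr rfl fun d _ => ?_
    obtain ⟨⟨⟨⟨x1, x2⟩, hx'⟩, ⟨⟨y1, y2⟩, hy⟩⟩, hd⟩ := d
    have hd' : (y1 - x1) ^ 2 + (y2 - x2) ^ 2 = 1 := hd
    simp only [Prod.mk.injEq, Subtype.mk.injEq]
    by_cases hi : x1 = i ∧ x2 = j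
    · obtain ⟨rfl, rfl⟩ := hi
      have h1 : -1 ≤ y1 - x1 := by nlinarith [sq_nonneg (y2 - x2)]
      have h2 : y1 - x1 ≤ 1 := by nlinarith [sq_nonneg (y2 - x2)]
      have h3 : -1 ≤ y2 - x2 := by nlinarith [sq_nonneg (y1 - x1)]
      have h4 : y2 - x2 ≤ 1 := by nlinarith [sq_nonneg (y1 - x1)]
      obtain ⟨u, rfl⟩ : ∃ u, y1 = x1 + u := ⟨y1 - x1, by ring⟩
      obtain ⟨v, rfl⟩ : ∃ v, y2 = x2 + v := ⟨y2 - x2, by ring⟩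
      simp only [add_sub_cancel_left] at hd' h1 h2 h3 h4
      interval_cases u <;> interval_cases v <;> simp at hd' ⊢ <;> grind
    · simp [hi]
  · simp [flow_eq_zero c (fun h => hx h.1)]

theorem height_step {n : ℕ} (c : Current n) (i j : ℤ) :
    height c (i, j) - height c (i - 1, j) = flow c (i, j) (i, j + 1) := by
  unfold height
  simp only
  by_cases hi : -(n : ℤ) ≤ i
  · have : Finset.Icc (-(n : ℤ)) i = insert i (Finset.Icc (-(n : ℤ)) (i - 1)) := by
      ext k; simp only [Finset.mem_Icc, Finset.mem_insert]; omega
    rw [this, Finset.sum_insert (by simp)]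
    ring
  · rw [Finset.Icc_eq_empty (by omega), Finset.Icc_eq_empty (by omega), flow_eq_zero]
    · simp
    · rintro ⟨h, -⟩
      exact hi (mem_box.1 h).1.1

theorem height_of_lt {n : ℕ} (c : Current n) {i : ℤ} (hi : i < -(n : ℤ)) (j : ℤ) :
    height c (i, j) = 0 := by
  unfold height
  rw [Finset.Icc_eq_empty (by simpa using hi), Finset.sum_empty]

theorem height_horizontal {n : ℕ} {c : Current n} (hc : Sourceless c) (i j : ℤ) :
    height c (i, j - 1) - height c (i, j) = flow c (i, j) (i + 1, j) := by
  by_cases hi : i < -(n : ℤ)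
  · rw [height_of_lt c hi, height_of_lt c hi, flow_eq_zero]
    · simp
    · rintro ⟨h, -⟩
      have := (mem_box.1 h).1.1
      simp only at this
      omega
  · have hi' : -(n : ℤ) - 1 ≤ i := by omega
    clear hi
    induction i, hi' using Int.leInduction with
    | base =>
      rw [height_of_lt c (by omega), height_of_lt c (by omega), flow_eq_zero]
      · simp
      · rintro ⟨h, -⟩
        have := (mem_box.1 h).1.1
        simp only at this
        omega
    | succ i hi ih =>
      have k1 := height_step c (i + 1) j
      have k2 := height_step c (i + 1) (j - 1)
      have k3 := flow_kirchhoff hc (i + 1) j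
      rw [flow_swap c (i + 1 - 1, j) (i + 1, j), flow_swap c (i + 1, j - 1) (i + 1, j)] at k3
      simp only [add_sub_cancel_right, sub_add_cancel] at k1 k2 k3
      linarith

/-- The height function of a sourceless current has the defining properties. -/
theorem height_isHeight {n : ℕ} {c : Current n} (hc : Sourceless c) : IsHeight c (height c) where
  vertical := height_step c
  horizontal := height_horizontal hc
  outside := by
    intro i j hij
    by_cases hj : -(n : ℤ) ≤ j ∧ j < n
    · by_cases hi : i < -(n : ℤ)
      · exact height_of_lt c hi j
      · have hi' : (n : ℤ) ≤ i := by
          by_contra h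
          exact hij ⟨⟨by omega, by omega⟩, hj⟩
        have key : ∀ m : ℕ, height c (i, -(n : ℤ) - 1 + m) = 0 := by
          intro m
          induction m with
          | zero =>
            unfold height
            refine Finset.sum_eq_zero fun k _ => flow_eq_zero c ?_
            rintro ⟨h, -⟩
            have := (mem_box.1 h).2.1
            simp at this
          | succ m ih =>
            have := height_horizontal hc i (-(n : ℤ) - 1 + (m + 1 : ℕ))
            rw [flow_eq_zero c] at this
            · have e : -(n : ℤ) - 1 + ((m + 1 : ℕ) : ℤ) - 1 = -(n : ℤ) - 1 + m := by
                push_cast; ring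
              rw [e, ih] at this
              linarith
            · rintro ⟨-, h⟩
              have := (mem_box.1 h).1.2
              simp only at this
              omega
        have := key (j + n + 1).toNat
        rwa [Int.toNat_of_nonneg (by omega), show -(n : ℤ) - 1 + (j + n + 1) = j by ring] at this
    · unfold height
      refine Finset.sum_eq_zero fun k _ => flow_eq_zero c ?_
      rintro ⟨h1, h2⟩
      have := (mem_box.1 h1).2
      have := (mem_box.1 h2).2
      simp only at *
      omega

/-- The covariance matrix `Cov_{n,β}[a; b]` of the height function. -/
def heightCov (n : ℕ) (β : ℝ) (a b : ℤ × ℤ) : ℝ :=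
  ∫ c, (height c a : ℝ) * (height c b : ℝ) ∂(currentLaw n (β / 2))

/-- The covariance matrix `SigCov_{n,β}[a; b]` of the signs of the height function. -/
def signCov (n : ℕ) (β : ℝ) (a b : ℤ × ℤ) : ℝ :=
  ∫ c, ((height c a).sign : ℝ) * ((height c b).sign : ℝ) ∂(currentLaw n (β / 2))

/-- The limit `Cov_{∞,β}[a; b] ∈ [0, ∞]` of `Cov_{n,β}[a; b] ≥ 0` as `n → ∞`. It is written as an
upper limit, which is always defined and is the limit whenever there is one. -/
def heightCovInf (β : ℝ) (a b : ℤ × ℤ) : ℝ≥0∞ :=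
  limsup (fun n : ℕ => ENNReal.ofReal (heightCov n β a b)) atTop

/-- The mass of the height function. -/
def massHeight (β : ℝ) : EReal :=
  liminf (fun k : ℕ =>
    -ENNReal.log (min (heightCovInf β (0, 0) (0, (k : ℤ))) 1) / ((k : ℝ) : EReal)) atTop

/-! ### Poisson edges and their cycle decomposition -/

/-- A Poisson edge: a directed edge with a time. -/
abbrev PEdge (n : ℕ) : Type := DirEdge n × ℝ

/-- A point configuration on `DirEdge n × ℝ`: the number of points on each directed edge, together
with a list of their times. -/
abbrev PConfig (n : ℕ) : Type := Σ c : Current n, ∀ d : DirEdge n, Fin (c d) → ℝ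

/-- `e^{‖T‖}` times the law of the Poisson point process on `DirEdge n × [0, T]` with intensity the
product of counting measure and Lebesgue measure: independently for every directed edge, `k` points
have weight `1 / k!` times the Lebesgue measure on `[0, T]^k`. -/
def poissonMeasure (n : ℕ) (T : ℝ) : Measure (PConfig n) :=
  Measure.sum fun c : Current n =>
    ENNReal.ofReal (∏ d, 1 / ((c d)! : ℝ)) •
      (Measure.pi fun d : DirEdge n => Measure.pi fun _ : Fin (c d) =>
        (volume : Measure ℝ).restrict (Set.Icc 0 T)).map (Sigma.mk c)

/-- The probability measure `P_{n,T}`: the Poisson point process conditioned on `∂𝐧 = 0`. -/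
def poissonLaw (n : ℕ) (T : ℝ) : Measure (PConfig n) :=
  ProbabilityTheory.cond (poissonMeasure n T) {ω | Sourceless ω.1}

open Classical in
/-- The set `Π` of Poisson edges of a configuration. -/
def poissonEdges {n : ℕ} (ω : PConfig n) : Finset (PEdge n) :=
  (Finset.univ : Finset (Σ d : DirEdge n, Fin (ω.1 d))).image fun p => (p.1, ω.2 p.1 p.2)

/-- The set `V(A)` of vertices incident to an edge in `A`. -/
def vertices {n : ℕ} (A : Finset (PEdge n)) : Set (box n) :=
  {x | ∃ p ∈ A, p.1.fst = x ∨ p.1.snd = x}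

/-- `η` is a cycle: a non-empty set of Poisson edges such that `(V(η), η)` is connected and has
in-degree and out-degree one at each vertex. -/
structure IsCycle {n : ℕ} (η : Finset (PEdge n)) : Prop where
  nonempty : η.Nonempty
  out_degree : ∀ x ∈ vertices η, ∃! p, p ∈ η ∧ p.1.fst = x
  in_degree : ∀ x ∈ vertices η, ∃! p, p ∈ η ∧ p.1.snd = x
  connected : ∀ x ∈ vertices η, ∀ y ∈ vertices η,
    Relation.EqvGen (fun u v => ∃ p ∈ η, p.1.fst = u ∧ p.1.snd = v) x y

open Classical in
/-- The set `M(Π)` which contains for each vertex the outgoing Poisson edge with maximal time. -/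
def topEdges {n : ℕ} (P : Finset (PEdge n)) : Finset (PEdge n) :=
  P.filter fun p => ∀ q ∈ P, q.1.fst = p.1.fst → q.2 ≤ p.2

open Classical in
/-- The set `C¹(Π)` of the cycles of the directed graph `(V(Π), M(Π))`. -/
def topCycles {n : ℕ} (P : Finset (PEdge n)) : Finset (Finset (PEdge n)) :=
  (topEdges P).powerset.filter IsCycle

open Classical in
/-- The sets `C^k(Π)`: `C⁰(Π) = ∅` and `C^{k+1}(Π) = C^k(Π) ∪ C¹(Π ∖ ⋃ C^k(Π))`. -/
def layerCycles {n : ℕ} (P : Finset (PEdge n)) : ℕ → Finset (Finset (PEdge n))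
  | 0 => ∅
  | k + 1 => layerCycles P k ∪ topCycles (P \ (layerCycles P k).biUnion id)

/-- The cycle decomposition `C(Π)`, the increasing limit of the sets `C^k(Π)`. -/
def cycleDecomp {n : ℕ} (P : Finset (PEdge n)) : Set (Finset (PEdge n)) :=
  {η | ∃ k, η ∈ layerCycles P k}

open Classical in
/-- The current that counts the edges in a set of Poisson edges. -/
def edgeCount {n : ℕ} (A : Finset (PEdge n)) : Current n :=
  fun d => (A.filter fun p => p.1 = d).card

/-- The cycle `η` surrounds the face `F_a`: it winds around `F_a`. -/
def Surrounds {n : ℕ} (η : Finset (PEdge n)) (a : ℤ × ℤ) : Prop :=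
  height (edgeCount η) a ≠ 0

/-- The event that some cycle in `C(Π)` surrounds both `F_a` and `F_b`. -/
def surroundEvent (n : ℕ) (a b : ℤ × ℤ) : Set (PConfig n) :=
  {ω | ∃ η ∈ cycleDecomp (poissonEdges ω), Surrounds η a ∧ Surrounds η b}

/-- The lower part `{(0, k) : k ≤ 0}` of the vertical axis. -/
def axisBelow : Set (ℤ × ℤ) := {x | x.1 = 0 ∧ x.2 ≤ 0}

/-- The upper part `{(0, k) : k ≥ m}` of the vertical axis. -/
def axisAbove (m : ℕ) : Set (ℤ × ℤ) := {y | y.1 = 0 ∧ (m : ℤ) ≤ y.2}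

end XYHeight

end

open XYHeight

noncomputable section

namespace XYHeight

open scoped Classical

/-! ### Popping cycles -/

/-! Two facts about the cycle decomposition of a sourceless Poisson configuration carry everything:
its cycles can be reversed without changing the law, and the probability that one cycle visits two
given distinct vertices `x`, `y` is at most twice the square of their two-point function.

Combinatorics. Removing top cycles one at a time, in any order, gives the same cycles as removing
them in layers (`mem_cycleDecomp_iff`), and the outcome depends only on the order of the outgoing
edges at each vertex (`Relabels.pops_image`). A configuration may therefore be replaced by a word,
one list of directed edges per vertex, and the law of the word is discrete and explicit
(`timedMeasure_eq_tsum`).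

Reversal. A cycle is reversed while the slots (origin, time) of its edges are kept. The new
configuration decomposes into the reversed cycles (`pops_flipMap`), so reversal is a
weight-preserving involution on words. Let `F`, `G` be additive in the current and odd under
reversal. Reversing the cycles with `F ≠ 0` negates `F`, and it keeps `G` unless some cycle charges
both. Hence only configurations with a common cycle contribute to the covariance
(`integral_noCommonCycle`). Applied to signs of heights this is the bound on the sign covariance;
applied to net flows it leads to the masses.

Exploration. Read the edges out of `x` and out of `y` in one common list, and follow first unread
edges from there until a path leads from one of the two vertices to the other. If a cycle visits
both, this happens (`exists_crosses`). The unread edges then have sources at `x` and `y`. Given the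
part already read, the weight of the unread parts with these sources is at most the two-point
function times the weight of those without: the ratio is a two-point function with smaller
couplings, and Ginibre's inequality applies (`tailSum_dipole_le`). After this exchange the whole
current has sources at `x` and `y`, and its total weight gives the second factor
(`crossSum_start_le`). The two directions of crossing account for the factor 2.

Masses. The heights of two faces on the vertical axis are sums of net flows across edges below and
above them (`height_below`, `height_above`), so a cycle around both faces visits the axis twice, and
the covariance is a double sum of flow correlations. Each of these lives on a common-cycle event;
flows are unbounded, but their exponential moments are bounded uniformly in the box
(`lintegral_pow_traffic_le`), and truncation at a level equal to the distance costs only a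
polynomial factor (`abs_integral_flow_mul_flow_le`). On the XY side, `corr_mul_corr_le` makes the
two-point function along an axis supermultiplicative, so Fekete's lemma gives the limit and an
exponential bound at every distance (`axisCorr_le_exp`). -/

/-- Distinct Poisson edges with the same origin have distinct times. -/
def Slotted {n : ℕ} (P : Finset (PEdge n)) : Prop :=
  ∀ p ∈ P, ∀ q ∈ P, p.1.fst = q.1.fst → p.2 = q.2 → p = q

/-- The in-degree and the out-degree agree at each vertex. -/
def Balanced {n : ℕ} (P : Finset (PEdge n)) : Prop :=
  ∀ v, (P.filter fun p => p.1.fst = v).card = (P.filter fun p => p.1.snd = v).card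

/-- `Pops P z`: the cycle `z` shows up when top cycles are removed from `P` one at a time. -/
inductive Pops {n : ℕ} : Finset (PEdge n) → Finset (PEdge n) → Prop
  | top {P z : Finset (PEdge n)} : z ∈ topCycles P → Pops P z
  | pop {P e z : Finset (PEdge n)} : e ∈ topCycles P → Pops (P \ e) z → Pops P z

variable {n : ℕ}

theorem mem_topEdges {P : Finset (PEdge n)} {p : PEdge n} :
    p ∈ topEdges P ↔ p ∈ P ∧ ∀ q ∈ P, q.1.fst = p.1.fst → q.2 ≤ p.2 := by
  simp [topEdges]

theorem mem_topCycles {P z : Finset (PEdge n)} :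
    z ∈ topCycles P ↔ z ⊆ topEdges P ∧ IsCycle z := by
  simp [topCycles]

theorem topEdges_subset (P : Finset (PEdge n)) : topEdges P ⊆ P := Finset.filter_subset _ _

theorem subset_of_mem_topCycles {P z : Finset (PEdge n)} (hz : z ∈ topCycles P) : z ⊆ P :=
  (mem_topCycles.1 hz).1.trans (topEdges_subset P)

theorem Slotted.mono {P Q : Finset (PEdge n)} (h : Slotted P) (hQ : Q ⊆ P) : Slotted Q :=
  fun p hp q hq => h p (hQ hp) q (hQ hq)

theorem Slotted.topEdges_unique {P : Finset (PEdge n)} (h : Slotted P) {p q : PEdge n}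
    (hp : p ∈ topEdges P) (hq : q ∈ topEdges P) (hpq : p.1.fst = q.1.fst) : p = q := by
  rw [mem_topEdges] at hp hq
  exact h p hp.1 q hq.1 hpq (le_antisymm (hq.2 p hp.1 hpq) (hp.2 q hq.1 hpq.symm))

theorem fst_mem_vertices {z : Finset (PEdge n)} {p : PEdge n} (hp : p ∈ z) :
    p.1.fst ∈ vertices z := ⟨p, hp, Or.inl rfl⟩

theorem snd_mem_vertices {z : Finset (PEdge n)} {p : PEdge n} (hp : p ∈ z) :
    p.1.snd ∈ vertices z := ⟨p, hp, Or.inr rfl⟩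

/-! ### Walking along a cycle. -/

namespace IsCycle

variable {z : Finset (PEdge n)}

theorem exists_next (hz : IsCycle z) {p : PEdge n} (hp : p ∈ z) :
    ∃ q ∈ z, q.1.fst = p.1.snd := by
  obtain ⟨q, hq, -⟩ := hz.out_degree _ (snd_mem_vertices hp)
  exact ⟨q, hq.1, hq.2⟩

theorem exists_prev (hz : IsCycle z) {p : PEdge n} (hp : p ∈ z) :
    ∃ q ∈ z, q.1.snd = p.1.fst := by
  obtain ⟨q, hq, -⟩ := hz.in_degree _ (fst_mem_vertices hp)
  exact ⟨q, hq.1, hq.2⟩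

theorem fst_inj (hz : IsCycle z) {p q : PEdge n} (hp : p ∈ z) (hq : q ∈ z)
    (h : p.1.fst = q.1.fst) : p = q :=
  (hz.out_degree _ (fst_mem_vertices hq)).unique ⟨hp, h⟩ ⟨hq, rfl⟩

theorem snd_inj (hz : IsCycle z) {p q : PEdge n} (hp : p ∈ z) (hq : q ∈ z)
    (h : p.1.snd = q.1.snd) : p = q :=
  (hz.in_degree _ (snd_mem_vertices hq)).unique ⟨hp, h⟩ ⟨hq, rfl⟩

theorem exists_fst (hz : IsCycle z) {x : box n} (hx : x ∈ vertices z) :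
    ∃ p ∈ z, p.1.fst = x := by
  obtain ⟨q, hq, -⟩ := hz.out_degree _ hx
  exact ⟨q, hq.1, hq.2⟩

theorem exists_snd (hz : IsCycle z) {x : box n} (hx : x ∈ vertices z) :
    ∃ p ∈ z, p.1.snd = x := by
  obtain ⟨q, hq, -⟩ := hz.in_degree _ hx
  exact ⟨q, hq.1, hq.2⟩

/-- A property that propagates forward along a cycle holds everywhere on it. -/
theorem forward_induction (hz : IsCycle z) (A : box n → Prop)
    (hA : ∀ p ∈ z, A p.1.fst → A p.1.snd) {x y : box n} (hx : x ∈ vertices z)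
    (hy : y ∈ vertices z) (h : A x) : A y := by
  -- `f` maps an edge to its successor. It is injective on the finite set of edges whose origin
  -- satisfies `A`, hence permutes it. So `A` also propagates backward, and undirected connectivity
  -- is enough.
  choose! f hf hf' using fun p (hp : p ∈ z) => hz.exists_next hp
  set N := z.filter fun p => A p.1.fst with hN
  have hmaps : Set.MapsTo f N N := by
    intro p hp
    simp only [hN, Finset.coe_filter, Set.mem_ofPred_eq] at hp ⊢
    exact ⟨hf p hp.1, by rw [hf' p hp.1]; exact hA p hp.1 hp.2⟩
  have hinj : Set.InjOn f N := by
    intro p hp q hq hpq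
    simp only [hN, Finset.coe_filter, Set.mem_ofPred_eq] at hp hq
    exact hz.snd_inj hp.1 hq.1 (by rw [← hf' p hp.1, hpq, hf' q hq.1])
  have hsurj := Finset.surjOn_of_injOn_of_card_le f hmaps hinj le_rfl
  have hback : ∀ p ∈ z, A p.1.snd → A p.1.fst := by
    intro p hp hAp
    have : f p ∈ (N : Set (PEdge n)) := by
      simp only [hN, Finset.coe_filter, Set.mem_ofPred_eq]
      exact ⟨hf p hp, by rwa [hf' p hp]⟩
    obtain ⟨q, hq, hqp⟩ := hsurj this
    simp only [hN, Finset.coe_filter, Set.mem_ofPred_eq] at hq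
    have : q = p := hz.snd_inj hq.1 hp (by rw [← hf' q hq.1, hqp, hf' p hp])
    exact this ▸ hq.2
  have key : ∀ u v, Relation.EqvGen (fun u v => ∃ p ∈ z, p.1.fst = u ∧ p.1.snd = v) u v →
      (A u ↔ A v) := by
    intro u v huv
    induction huv with
    | rel u v h =>
      obtain ⟨p, hp, rfl, rfl⟩ := h
      exact ⟨hA p hp, hback p hp⟩
    | refl => rfl
    | symm u v _ ih => exact ih.symm
    | trans u v w _ _ ih1 ih2 => exact ih1.trans ih2
  exact (key x y (hz.connected x hx y hy)).1 h

/-- A property that propagates backward along a cycle holds everywhere on it. -/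
theorem backward_induction (hz : IsCycle z) (A : box n → Prop)
    (hA : ∀ p ∈ z, A p.1.snd → A p.1.fst) {x y : box n} (hx : x ∈ vertices z)
    (hy : y ∈ vertices z) (h : A x) : A y := by
  by_contra hAy
  exact hz.forward_induction (fun v => ¬ A v) (fun p hp h h' => h (hA p hp h')) hy hx hAy h

theorem card_fst (hz : IsCycle z) (v : box n) :
    (z.filter fun p => p.1.fst = v).card = if v ∈ vertices z then 1 else 0 := by
  split_ifs with h
  · rw [Finset.card_eq_one]
    obtain ⟨p, hp, rfl⟩ := hz.exists_fst h
    refine ⟨p, ?_⟩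
    ext q
    simp only [Finset.mem_filter, Finset.mem_singleton]
    exact ⟨fun hq => hz.fst_inj hq.1 hp hq.2, by rintro rfl; exact ⟨hp, rfl⟩⟩
  · rw [Finset.card_eq_zero, Finset.filter_eq_empty_iff]
    rintro p hp rfl
    exact h (fst_mem_vertices hp)

theorem card_snd (hz : IsCycle z) (v : box n) :
    (z.filter fun p => p.1.snd = v).card = if v ∈ vertices z then 1 else 0 := by
  split_ifs with h
  · rw [Finset.card_eq_one]
    obtain ⟨p, hp, rfl⟩ := hz.exists_snd h
    refine ⟨p, ?_⟩
    ext q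
    simp only [Finset.mem_filter, Finset.mem_singleton]
    exact ⟨fun hq => hz.snd_inj hq.1 hp hq.2, by rintro rfl; exact ⟨hp, rfl⟩⟩
  · rw [Finset.card_eq_zero, Finset.filter_eq_empty_iff]
    rintro p hp rfl
    exact h (snd_mem_vertices hp)

theorem balanced (hz : IsCycle z) : Balanced z := fun v => by rw [hz.card_fst, hz.card_snd]

end IsCycle

theorem Balanced.sdiff {P Q : Finset (PEdge n)} (hP : Balanced P) (hQ : Balanced Q)
    (h : Q ⊆ P) : Balanced (P \ Q) := by
  intro v
  have h1 := Finset.card_sdiff_add_card_eq_card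
    (Finset.filter_subset_filter (fun p : PEdge n => p.1.fst = v) h)
  have h2 := Finset.card_sdiff_add_card_eq_card
    (Finset.filter_subset_filter (fun p : PEdge n => p.1.snd = v) h)
  have e : ∀ (R : PEdge n → Prop) [DecidablePred R], (P.filter R) \ (Q.filter R) = (P \ Q).filter R := by
    intro R _
    ext p
    simp only [Finset.mem_sdiff, Finset.mem_filter]
    tauto
  rw [e] at h1 h2
  have := hP v
  have := hQ v
  omega

theorem Balanced.union {P Q : Finset (PEdge n)} (hP : Balanced P) (hQ : Balanced Q)
    (h : Disjoint P Q) : Balanced (P ∪ Q) := by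
  intro v
  rw [Finset.filter_union, Finset.filter_union, Finset.card_union_of_disjoint,
    Finset.card_union_of_disjoint, hP v, hQ v]
  · exact Finset.disjoint_filter_filter h
  · exact Finset.disjoint_filter_filter h

/-- A vertex has only one top edge, so a top cycle that meets another one must follow it from then
on. -/
theorem topCycles_eq_of_common_vertex {P z e : Finset (PEdge n)} (hP : Slotted P)
    (hz : z ∈ topCycles P) (he : e ∈ topCycles P) {x : box n} (hxz : x ∈ vertices z)
    (hxe : x ∈ vertices e) : z = e := by
  have key : ∀ {z e : Finset (PEdge n)}, z ∈ topCycles P → e ∈ topCycles P →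
      x ∈ vertices z → x ∈ vertices e → z ⊆ e := by
    intro z e hz he hxz hxe
    rw [mem_topCycles] at hz he
    have same : ∀ p ∈ z, p.1.fst ∈ vertices e → p ∈ e := by
      intro p hp hpe
      obtain ⟨q, hq, hqp⟩ := he.2.exists_fst hpe
      rwa [← hP.topEdges_unique (he.1 hq) (hz.1 hp) hqp]
    intro p hp
    exact same p hp (hz.2.forward_induction (· ∈ vertices e)
      (fun q hq h => snd_mem_vertices (same q hq h)) hxz (fst_mem_vertices hp) hxe)
  exact (key hz he hxz hxe).antisymm (key he hz hxe hxz)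

/-- Top cycles are vertex-disjoint, so removing one of them leaves the top edges of the others in
place. -/
theorem topCycles_sdiff {P z e : Finset (PEdge n)} (hP : Slotted P)
    (hz : z ∈ topCycles P) (he : e ∈ topCycles P) (hne : z ≠ e) : z ∈ topCycles (P \ e) := by
  have hz' := mem_topCycles.1 hz
  refine mem_topCycles.2 ⟨fun p hp => ?_, hz'.2⟩
  have := mem_topEdges.1 (hz'.1 hp)
  refine mem_topEdges.2 ⟨Finset.mem_sdiff.2 ⟨this.1, fun hpe => hne ?_⟩,
    fun q hq => this.2 q (Finset.mem_sdiff.1 hq).1⟩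
  exact topCycles_eq_of_common_vertex hP hz he (fst_mem_vertices hp) (fst_mem_vertices hpe)

theorem Pops.isCycle {P z : Finset (PEdge n)} (h : Pops P z) : IsCycle z := by
  induction h with
  | top h => exact (mem_topCycles.1 h).2
  | pop _ _ ih => exact ih

theorem Pops.subset {P z : Finset (PEdge n)} (h : Pops P z) : z ⊆ P := by
  induction h with
  | top h => exact subset_of_mem_topCycles h
  | pop _ _ ih => exact ih.trans Finset.sdiff_subset

theorem Pops.exists_topCycle {P z : Finset (PEdge n)} (h : Pops P z) : ∃ e, e ∈ topCycles P := by
  cases h with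
  | top h => exact ⟨_, h⟩
  | pop h _ => exact ⟨_, h⟩

/-- The order in which the cycles are removed does not matter. -/
theorem Pops.eq_or_sdiff {P z e : Finset (PEdge n)} (hP : Slotted P) (h : Pops P z)
    (he : e ∈ topCycles P) : z = e ∨ Pops (P \ e) z := by
  induction h generalizing e with
  | @top P z hz =>
    by_cases hze : z = e
    · exact Or.inl hze
    · exact Or.inr (.top (topCycles_sdiff hP hz he hze))
  | @pop P t z ht h ih =>
    by_cases hte : t = e
    · exact Or.inr (hte ▸ h)
    · rcases ih (hP.mono Finset.sdiff_subset) (topCycles_sdiff hP he ht (Ne.symm hte)) with h | h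
      · exact Or.inl h
      · refine Or.inr (.pop (topCycles_sdiff hP ht he hte) ?_)
        rwa [sdiff_right_comm]

theorem pops_iff_of_topCycle {P e : Finset (PEdge n)} (hP : Slotted P) (he : e ∈ topCycles P)
    (z : Finset (PEdge n)) : Pops P z ↔ z = e ∨ Pops (P \ e) z :=
  ⟨fun h => h.eq_or_sdiff hP he, fun h => h.elim (fun h => h ▸ .top he) (.pop he)⟩

/-- Compares the removal of a whole layer with successive removals of single cycles. -/
theorem pops_iff_of_subset_topCycles {P : Finset (PEdge n)} (hP : Slotted P)
    (S : Finset (Finset (PEdge n))) (hS : S ⊆ topCycles P) (z : Finset (PEdge n)) :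
    Pops P z ↔ z ∈ S ∨ Pops (P \ S.biUnion id) z := by
  induction S using Finset.induction_on generalizing P with
  | empty => simp
  | insert e S heS ih =>
    have he := hS (Finset.mem_insert_self e S)
    rw [pops_iff_of_topCycle hP he, ih (hP.mono Finset.sdiff_subset)]
    · simp [Finset.biUnion_insert, or_assoc, sdiff_sdiff_left]
    · intro t ht
      exact topCycles_sdiff hP (hS (Finset.mem_insert_of_mem ht)) he
        (fun h => heS (h ▸ ht))

/-- The definition adds the last layer; the recursion of `Pops` starts with the first one, so the
first layer has to be split off. -/
theorem layerCycles_succ (P : Finset (PEdge n)) (k : ℕ) :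
    layerCycles P (k + 1) =
      topCycles P ∪ layerCycles (P \ (topCycles P).biUnion id) k := by
  induction k with
  | zero => simp [layerCycles]
  | succ k ih =>
    rw [layerCycles, ih]
    conv_rhs => rw [layerCycles]
    rw [Finset.union_assoc, sdiff_sdiff_left, Finset.union_biUnion]
    rfl

theorem mem_cycleDecomp_iff {P : Finset (PEdge n)} (hP : Slotted P) (z : Finset (PEdge n)) :
    z ∈ cycleDecomp P ↔ Pops P z := by
  constructor
  · rintro ⟨k, hk⟩
    induction k generalizing P with
    | zero => simp [layerCycles] at hk
    | succ k ih =>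
      rw [layerCycles_succ, Finset.mem_union] at hk
      rw [pops_iff_of_subset_topCycles hP _ subset_rfl]
      exact hk.imp_right (ih (hP.mono Finset.sdiff_subset))
  · intro h
    induction hN : P.card using Nat.strong_induction_on generalizing P with
    | _ N ih =>
      subst hN
      obtain ⟨e, he⟩ := h.exists_topCycle
      rw [pops_iff_of_subset_topCycles hP _ subset_rfl] at h
      rcases h with h | h
      · exact ⟨1, by rw [layerCycles_succ]; exact Finset.mem_union_left _ h⟩
      · obtain ⟨p, hp⟩ := (mem_topCycles.1 he).2.nonempty
        have hlt : (P \ (topCycles P).biUnion id).card < P.card := by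
          refine Finset.card_lt_card (Finset.ssubset_iff_of_subset Finset.sdiff_subset |>.2
            ⟨p, subset_of_mem_topCycles he hp, fun h => ?_⟩)
          exact (Finset.mem_sdiff.1 h).2 (Finset.mem_biUnion.2 ⟨e, he, hp⟩)
        obtain ⟨k, hk⟩ := ih _ hlt (hP.mono Finset.sdiff_subset) h rfl
        exact ⟨k + 1, by rw [layerCycles_succ]; exact Finset.mem_union_right _ hk⟩

/-- A non-empty balanced set of Poisson edges has a top cycle. -/
theorem Balanced.exists_topCycle {P : Finset (PEdge n)} (hb : Balanced P)
    (hne : P.Nonempty) : ∃ z, z ∈ topCycles P := by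
  set S := P.image fun p => p.1.fst with hS
  have htop : ∀ v ∈ S, ∃ p ∈ topEdges P, p.1.fst = v := by
    intro v hv
    obtain ⟨q, hq, rfl⟩ := Finset.mem_image.1 hv
    obtain ⟨p, hp, hmax⟩ := Finset.exists_max_image (P.filter fun p => p.1.fst = q.1.fst)
      (fun p => p.2) ⟨q, Finset.mem_filter.2 ⟨hq, rfl⟩⟩
    rw [Finset.mem_filter] at hp
    refine ⟨p, mem_topEdges.2 ⟨hp.1, fun r hr hrp => hmax r ?_⟩, hp.2⟩
    exact Finset.mem_filter.2 ⟨hr, hrp.trans hp.2⟩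
  have : Nonempty (PEdge n) := ⟨hne.choose⟩
  choose! t ht ht' using htop
  set f : box n → box n := fun v => (t v).1.snd with hf
  -- This is the only use of balance: the end of a top edge has positive in-degree, hence an
  -- outgoing edge.
  have hfS : ∀ v ∈ S, f v ∈ S := by
    intro v hv
    have h1 : 0 < (P.filter fun p => p.1.snd = f v).card :=
      Finset.card_pos.2 ⟨t v, Finset.mem_filter.2 ⟨topEdges_subset P (ht v hv), rfl⟩⟩
    rw [← hb] at h1
    obtain ⟨p, hp⟩ := Finset.card_pos.1 h1
    rw [Finset.mem_filter] at hp
    exact Finset.mem_image.2 ⟨p, hp.1, hp.2⟩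
  -- The cycle sits on a smallest non-empty set closed under `f`. Minimality makes `f` a permutation
  -- of this set, since the image is closed as well.
  obtain ⟨A, hA, hmin⟩ := Finset.exists_min_image
    (S.powerset.filter fun A => A.Nonempty ∧ A.image f ⊆ A) Finset.card
    ⟨S, by
      simp only [Finset.mem_filter, Finset.mem_powerset, subset_rfl, true_and]
      refine ⟨hne.image _, ?_⟩
      intro v hv
      obtain ⟨u, hu, rfl⟩ := Finset.mem_image.1 hv
      exact hfS u hu⟩
  simp only [Finset.mem_filter, Finset.mem_powerset] at hA hmin
  obtain ⟨hAS, hAne, hAf⟩ := hA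
  have himage : A.image f = A := by
    refine Finset.eq_of_subset_of_card_le hAf (hmin _ ⟨hAf.trans hAS, hAne.image _, ?_⟩)
    exact Finset.image_subset_image hAf
  have hinj : Set.InjOn f A := Finset.card_image_iff.1 (by rw [himage])
  have hvert : ∀ x, x ∈ vertices (A.image t) → x ∈ A := by
    rintro x ⟨p, hp, hx⟩
    obtain ⟨v, hv, rfl⟩ := Finset.mem_image.1 hp
    rcases hx with rfl | rfl
    · rwa [ht' v (hAS hv)]
    · exact hAf (Finset.mem_image_of_mem f hv)
  refine ⟨A.image t, mem_topCycles.2 ⟨?_, ?_⟩⟩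
  · intro p hp
    obtain ⟨v, hv, rfl⟩ := Finset.mem_image.1 hp
    exact ht v (hAS hv)
  · refine ⟨hAne.image _, ?_, ?_, ?_⟩
    · intro x hx
      refine ⟨t x, ⟨Finset.mem_image_of_mem t (hvert x hx), ht' x (hAS (hvert x hx))⟩, ?_⟩
      rintro p ⟨hp, hpx⟩
      obtain ⟨v, hv, rfl⟩ := Finset.mem_image.1 hp
      rw [ht' v (hAS hv)] at hpx
      rw [hpx]
    · intro x hx
      have hx' := hvert x hx
      rw [← himage] at hx'
      obtain ⟨u, hu, hux⟩ := Finset.mem_image.1 hx'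
      refine ⟨t u, ⟨Finset.mem_image_of_mem t hu, hux⟩, ?_⟩
      rintro p ⟨hp, hpx⟩
      obtain ⟨v, hv, rfl⟩ := Finset.mem_image.1 hp
      rw [hinj hv hu (hpx.trans hux.symm)]
    · intro x hx y hy
      set R := fun u v => ∃ p ∈ A.image t, p.1.fst = u ∧ p.1.snd = v with hR
      -- The vertices connected to `x` form a closed subset, so by minimality they are all of `A`.
      have hB : A.card ≤ (A.filter fun v => Relation.EqvGen R x v).card := by
        refine hmin _ ⟨(Finset.filter_subset _ _).trans hAS, ⟨x, ?_⟩, ?_⟩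
        · exact Finset.mem_filter.2 ⟨hvert x hx, .refl x⟩
        · intro v hv
          obtain ⟨u, hu, rfl⟩ := Finset.mem_image.1 hv
          rw [Finset.mem_filter] at hu ⊢
          exact ⟨hAf (Finset.mem_image_of_mem f hu.1), hu.2.trans _ _ _
            (.rel _ _ ⟨t u, Finset.mem_image_of_mem t hu.1, ht' u (hAS hu.1), rfl⟩)⟩
      have := Finset.eq_of_subset_of_card_le (Finset.filter_subset _ _) hB
      have hyA := hvert y hy
      rw [← this] at hyA
      exact (Finset.mem_filter.1 hyA).2

/-- Induction over the removal of top cycles. -/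
theorem popping_induction {motive : Finset (PEdge n) → Prop} (empty : motive ∅)
    (pop : ∀ P z, Slotted P → Balanced P → z ∈ topCycles P → motive (P \ z) → motive P)
    {P : Finset (PEdge n)} (hP : Slotted P) (hb : Balanced P) : motive P := by
  induction hN : P.card using Nat.strong_induction_on generalizing P with
  | _ N ih =>
    subst hN
    rcases P.eq_empty_or_nonempty with rfl | hne
    · exact empty
    · obtain ⟨z, hz⟩ := hb.exists_topCycle hne
      have hsub := subset_of_mem_topCycles hz
      have hc := (mem_topCycles.1 hz).2
      refine pop P z hP hb hz (ih _ ?_ (hP.mono Finset.sdiff_subset) (hb.sdiff hc.balanced hsub) rfl)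
      obtain ⟨p, hp⟩ := hc.nonempty
      exact Finset.card_lt_card ((Finset.ssubset_iff_of_subset Finset.sdiff_subset).2
        ⟨p, hsub hp, fun h => (Finset.mem_sdiff.1 h).2 hp⟩)

/-! ### Maps that keep the order of the edges at each vertex. -/

/-- The map `f` keeps the origins of the edges of `P` and the order of their times. -/
structure Relabels (f : PEdge n → PEdge n) (P : Finset (PEdge n)) : Prop where
  fst : ∀ p ∈ P, (f p).1.fst = p.1.fst
  le_iff : ∀ p ∈ P, ∀ q ∈ P, p.1.fst = q.1.fst → ((f p).2 ≤ (f q).2 ↔ p.2 ≤ q.2)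

namespace Relabels

variable {f : PEdge n → PEdge n} {P : Finset (PEdge n)}

theorem mono (h : Relabels f P) {Q : Finset (PEdge n)} (hQ : Q ⊆ P) : Relabels f Q :=
  ⟨fun p hp => h.fst p (hQ hp), fun p hp q hq => h.le_iff p (hQ hp) q (hQ hq)⟩

theorem slot_inj (h : Relabels f P) (hP : Slotted P) {p q : PEdge n} (hp : p ∈ P) (hq : q ∈ P)
    (h1 : (f p).1.fst = (f q).1.fst) (h2 : (f p).2 = (f q).2) : p = q := by
  rw [h.fst p hp, h.fst q hq] at h1
  exact hP p hp q hq h1 (le_antisymm ((h.le_iff p hp q hq h1).1 h2.le)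
    ((h.le_iff q hq p hp h1.symm).1 h2.ge))

theorem injOn (h : Relabels f P) (hP : Slotted P) : Set.InjOn f P := fun p hp q hq hpq =>
  h.slot_inj hP hp hq (by rw [hpq]) (by rw [hpq])

theorem slotted (h : Relabels f P) (hP : Slotted P) : Slotted (P.image f) := by
  intro p hp q hq h1 h2
  obtain ⟨p, hp', rfl⟩ := Finset.mem_image.1 hp
  obtain ⟨q, hq', rfl⟩ := Finset.mem_image.1 hq
  rw [h.slot_inj hP hp' hq' h1 h2]

theorem topEdges_image (h : Relabels f P) {p : PEdge n} (hp : p ∈ topEdges P) :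
    f p ∈ topEdges (P.image f) := by
  rw [mem_topEdges] at hp ⊢
  refine ⟨Finset.mem_image_of_mem f hp.1, fun q hq hqp => ?_⟩
  obtain ⟨q, hq', rfl⟩ := Finset.mem_image.1 hq
  rw [h.fst q hq', h.fst p hp.1] at hqp
  exact (h.le_iff q hq' p hp.1 hqp).2 (hp.2 q hq' hqp)

/-- If a relabelling of a balanced set maps the cycles of its decomposition to cycles, then it maps
the decomposition to that of the image. -/
theorem pops_image (h : Relabels f P) (hP : Slotted P) (hb : Balanced P)
    (hc : ∀ z, Pops P z → IsCycle (z.image f)) (y : Finset (PEdge n)) :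
    Pops (P.image f) y ↔ ∃ z, Pops P z ∧ z.image f = y := by
  revert h hc
  refine popping_induction (motive := fun P => Relabels f P →
    (∀ z, Pops P z → IsCycle (z.image f)) →
    (Pops (P.image f) y ↔ ∃ z, Pops P z ∧ z.image f = y)) ?_ ?_ hP hb
  · intro _ _
    have h0 : ∀ z : Finset (PEdge n), ¬ Pops ∅ z := fun z hz => by
      obtain ⟨p, hp⟩ := hz.isCycle.nonempty
      simpa using hz.subset hp
    simp [h0]
  · intro P e hP hb he ih h hc
    have heP := subset_of_mem_topCycles he
    have he' : e.image f ∈ topCycles (P.image f) := by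
      refine mem_topCycles.2 ⟨fun p hp => ?_, hc e (.top he)⟩
      obtain ⟨p, hp', rfl⟩ := Finset.mem_image.1 hp
      exact h.topEdges_image ((mem_topCycles.1 he).1 hp')
    have hsd : P.image f \ e.image f = (P \ e).image f := by
      ext q
      simp only [Finset.mem_sdiff, Finset.mem_image]
      constructor
      · rintro ⟨⟨p, hp, rfl⟩, hpe⟩
        exact ⟨p, ⟨hp, fun h => hpe ⟨p, h, rfl⟩⟩, rfl⟩
      · rintro ⟨p, ⟨hp, hpe⟩, rfl⟩
        refine ⟨⟨p, hp, rfl⟩, ?_⟩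
        rintro ⟨q, hq, hqp⟩
        exact hpe (h.injOn hP (heP hq) hp hqp ▸ hq)
    rw [pops_iff_of_topCycle (h.slotted hP) he', hsd,
      ih (h.mono Finset.sdiff_subset) (fun z hz => hc z (.pop he hz))]
    constructor
    · rintro (rfl | ⟨z, hz, rfl⟩)
      · exact ⟨e, .top he, rfl⟩
      · exact ⟨z, .pop he hz, rfl⟩
    · rintro ⟨z, hz, rfl⟩
      rcases hz.eq_or_sdiff hP he with rfl | hz
      · exact Or.inl rfl
      · exact Or.inr ⟨z, hz, rfl⟩

end Relabels

end XYHeight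

end

noncomputable section

set_option linter.unusedSectionVars false

namespace XYHeight

open scoped Classical

/-! ### Sorting independent uniform times within classes -/

section Sorting

variable {I V : Type*} [Fintype I] [Fintype V]

/-- The enumeration `e` lists the members of each class by decreasing time. -/
structure Sorts (cls : I → V) (t : I → ℝ) {k : V → ℕ} (e : (Σ v, Fin (k v)) ≃ I) : Prop where
  cls_eq : ∀ p, cls (e p) = p.1
  lt : ∀ v (i j : Fin (k v)), i < j → t (e ⟨v, j⟩) < t (e ⟨v, i⟩)

theorem card_class {cls : I → V} {k : V → ℕ} {e : (Σ v, Fin (k v)) ≃ I}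
    (h : ∀ p, cls (e p) = p.1) (v : V) : Fintype.card {q // cls q = v} = k v := by
  have := Fintype.card_congr (e.symm.subtypeEquiv (p := fun q => cls q = v)
    (q := fun p => p.1 = v) fun q => by rw [← h (e.symm q), e.apply_symm_apply])
  rw [this, Fintype.card_congr (Equiv.sigmaSubtype v), Fintype.card_fin]

/-- Within a class, both enumerations list the same set of negated times in strictly increasing
order, and strictness makes a place recoverable from its time. -/
theorem Sorts.unique {cls : I → V} {t : I → ℝ} {k : V → ℕ} {e e' : (Σ v, Fin (k v)) ≃ I}
    (h : Sorts cls t e) (h' : Sorts cls t e') : e = e' := by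
  have hanti : ∀ {e : (Σ v, Fin (k v)) ≃ I}, Sorts cls t e → ∀ v,
      StrictMono fun i : Fin (k v) => -t (e ⟨v, i⟩) :=
    fun h v i j hij => neg_lt_neg (h.lt v i j hij)
  have hmem : ∀ {e : (Σ v, Fin (k v)) ≃ I}, Sorts cls t e → ∀ v q, cls q = v →
      ∃ i, e ⟨v, i⟩ = q := by
    rintro e h v q rfl
    obtain ⟨⟨v, i⟩, rfl⟩ := e.surjective q
    rw [h.cls_eq]
    exact ⟨i, rfl⟩
  have hsub : ∀ {e e' : (Σ v, Fin (k v)) ≃ I}, Sorts cls t e → Sorts cls t e' → ∀ v,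
      (Set.range fun i : Fin (k v) => -t (e ⟨v, i⟩)) ⊆
        Set.range fun i : Fin (k v) => -t (e' ⟨v, i⟩) := by
    rintro e e' h h' v _ ⟨i, rfl⟩
    obtain ⟨j, hj⟩ := hmem h' v (e ⟨v, i⟩) (h.cls_eq _)
    exact ⟨j, by simp only [hj]⟩
  ext ⟨v, i⟩
  have key := ((hanti h v).range_inj (hanti h' v)).1 ((hsub h h' v).antisymm (hsub h' h v))
  obtain ⟨j, hj⟩ := hmem h' v (e ⟨v, i⟩) (h.cls_eq _)
  have h1 : -t (e ⟨v, i⟩) = -t (e' ⟨v, i⟩) := congrFun key i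
  rw [← hj] at h1
  have : j = i := (hanti h' v).injective h1
  rw [← hj, this]

theorem exists_sorts {cls : I → V} {t : I → ℝ}
    (ht : ∀ q q', cls q = cls q' → t q = t q' → q = q') :
    ∃ (k : V → ℕ) (e : (Σ v, Fin (k v)) ≃ I), Sorts cls t e := by
  set A : V → Finset I := fun v => Finset.univ.filter fun q => cls q = v with hA
  have hinj : ∀ v, Set.InjOn t (A v) := by
    intro v q hq q' hq' h
    simp only [hA, Finset.coe_filter, Finset.mem_univ, true_and, Set.mem_ofPred_eq] at hq hq'
    exact ht q q' (hq.trans hq'.symm) h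
  -- Negated, because `orderEmbOfFin` enumerates in increasing order.
  set B : V → Finset ℝ := fun v => (A v).image fun q => -t q with hB
  have hex : ∀ p : Σ v, Fin (B v).card, ∃ q, cls q = p.1 ∧ -t q = (B p.1).orderEmbOfFin rfl p.2 := by
    rintro ⟨v, i⟩
    have := (B v).orderEmbOfFin_mem rfl i
    obtain ⟨q, hq, hq'⟩ := Finset.mem_image.1 this
    exact ⟨q, (Finset.mem_filter.1 hq).2, hq'⟩
  choose f hf hf' using hex
  have hbij : Function.Bijective f := by
    constructor
    · rintro ⟨v, i⟩ ⟨v', i'⟩ h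
      obtain rfl : v = v' := (hf ⟨v, i⟩).symm.trans (h ▸ hf ⟨v', i'⟩)
      have : (B v).orderEmbOfFin rfl i = (B v).orderEmbOfFin rfl i' := by
        rw [← hf' ⟨v, i⟩, h, hf']
      rw [((B v).orderEmbOfFin rfl).injective this]
    · intro q
      have hq : -t q ∈ B (cls q) := Finset.mem_image_of_mem _ (by simp [hA])
      have : -t q ∈ Set.range ((B (cls q)).orderEmbOfFin rfl) := by
        rw [Finset.range_orderEmbOfFin]; exact hq
      obtain ⟨i, hi⟩ := this
      refine ⟨⟨cls q, i⟩, ht _ _ (hf _) ?_⟩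
      have := hf' ⟨cls q, i⟩
      simp only [hi] at this
      linarith
  refine ⟨fun v => (B v).card, Equiv.ofBijective f hbij, fun p => hf p, fun v i j hij => ?_⟩
  have h1 := hf' ⟨v, i⟩
  have h2 := hf' ⟨v, j⟩
  have h3 := ((B v).orderEmbOfFin rfl).strictMono hij
  simp only [Equiv.ofBijective_apply] at *
  linarith

/-- Independent times, uniform on `[0, τ v]` for the members of the class `v`. -/
def classMeasure (cls : I → V) (τ : V → ℝ) : Measure (I → ℝ) :=
  Measure.pi fun q => (volume : Measure ℝ).restrict (Set.Icc 0 (τ (cls q)))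

/-- A permutation within the classes only exchanges equal factors of the product measure. -/
theorem classMeasure_perm (cls : I → V) (τ : V → ℝ) (σ : Equiv.Perm I)
    (hσ : ∀ q, cls (σ q) = cls q) {S : Set (I → ℝ)} (hS : MeasurableSet S) :
    classMeasure cls τ {t | t ∘ σ ∈ S} = classMeasure cls τ S := by
  have hmeas : Measurable fun t : I → ℝ => t ∘ σ :=
    measurable_pi_lambda _ fun q => measurable_pi_apply _
  have : (classMeasure cls τ).map (fun t => t ∘ σ) = classMeasure cls τ := by
    unfold classMeasure
    refine (Measure.pi_eq fun s hs => ?_).symm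
    rw [Measure.map_apply hmeas (MeasurableSet.univ_pi hs)]
    have : (fun t : I → ℝ => t ∘ σ) ⁻¹' Set.univ.pi s = Set.univ.pi fun q => s (σ.symm q) := by
      ext t
      simp only [Set.mem_preimage, Set.mem_univ_pi, Function.comp_apply]
      exact ⟨fun h q => by simpa using h (σ.symm q), fun h q => by simpa using h (σ q)⟩
    rw [this, Measure.pi_pi]
    refine (Fintype.prod_equiv σ _ _ fun q => ?_).symm
    rw [σ.symm_apply_apply, hσ]
  conv_rhs => rw [← this, Measure.map_apply hmeas hS]
  rfl

/-- The measure is dominated by Lebesgue measure, for which a proper subspace is null. -/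
theorem classMeasure_eq_null (cls : I → V) (τ : V → ℝ) {q q' : I} (h : q ≠ q') :
    classMeasure cls τ {t | t q = t q'} = 0 := by
  have h1 : classMeasure cls τ ≤ (volume : Measure (I → ℝ)) := by
    unfold classMeasure
    rw [← Measure.restrict_pi_pi, volume_pi]
    exact Measure.restrict_le_self
  refine le_antisymm ((h1 _).trans ?_) zero_le
  set L : Submodule ℝ (I → ℝ) :=
    LinearMap.ker ((LinearMap.proj q : (I → ℝ) →ₗ[ℝ] ℝ) - LinearMap.proj q') with hL
  have : {t : I → ℝ | t q = t q'} = L := by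
    ext t
    simp [hL, LinearMap.mem_ker, sub_eq_zero]
  rw [this, Measure.addHaar_submodule]
  intro htop
  have : (Pi.single q 1 : I → ℝ) ∈ L := htop ▸ Submodule.mem_top
  simp [hL, LinearMap.mem_ker, h.symm] at this

theorem classMeasure_ae_inj (cls : I → V) (τ : V → ℝ) :
    ∀ᵐ t ∂classMeasure cls τ, Function.Injective t := by
  have : ∀ q q' : I, ∀ᵐ t ∂classMeasure cls τ, q ≠ q' → t q ≠ t q' := by
    intro q q'
    by_cases h : q = q'
    · simp [h]
    · have := classMeasure_eq_null cls τ h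
      rw [ae_iff]
      convert this using 3
      simp [h]
  filter_upwards [ae_all_iff.2 fun q => ae_all_iff.2 (this q)] with t ht q q' hqq'
  by_contra h
  exact ht q q' h hqq'

theorem measurableSet_sorts (cls : I → V) {k : V → ℕ} (e : (Σ v, Fin (k v)) ≃ I) :
    MeasurableSet {t | Sorts cls t e} := by
  by_cases h : ∀ p, cls (e p) = p.1
  · have : {t : I → ℝ | Sorts cls t e} =
        ⋂ v, ⋂ i : Fin (k v), ⋂ j : Fin (k v), ⋂ (_ : i < j), {t | t (e ⟨v, j⟩) < t (e ⟨v, i⟩)} := by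
      ext t
      simp only [Set.mem_ofPred_eq, Set.mem_iInter]
      exact ⟨fun h => h.lt, fun h' => ⟨h, h'⟩⟩
    rw [this]
    refine .iInter fun v => .iInter fun i => .iInter fun j => .iInter fun _ => ?_
    exact measurableSet_lt (measurable_pi_apply _) (measurable_pi_apply _)
  · convert MeasurableSet.empty
    ext t
    simp only [Set.mem_ofPred_eq, Set.mem_empty_iff_false, iff_false]
    exact fun h' => h h'.cls_eq

theorem card_perm_fiber {ι : Type*} [Fintype ι] [DecidableEq I] (f : I → ι)
    [DecidablePred fun σ : Equiv.Perm I => ∀ q, f (σ q) = f q] :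
    (Finset.univ.filter fun σ : Equiv.Perm I => ∀ q, f (σ q) = f q).card =
      ∏ i, (Fintype.card {q // f q = i})! := by
  rw [← DomMulAct.stabilizer_card f, Fintype.card_subtype]
  congr 1
  ext σ
  simp [funext_iff]

theorem sorts_trans {cls : I → V} {t : I → ℝ} {k : V → ℕ} {e : (Σ v, Fin (k v)) ≃ I}
    {σ : Equiv.Perm I} (hσ : ∀ q, cls (σ q) = cls q) :
    Sorts cls t (e.trans σ) ↔ Sorts cls (t ∘ σ) e :=
  ⟨fun h => ⟨fun p => by rw [← h.cls_eq p, Equiv.trans_apply, hσ], h.lt⟩,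
    fun h => ⟨fun p => by rw [← h.cls_eq p, Equiv.trans_apply, hσ], h.lt⟩⟩

theorem classMeasure_univ {cls : I → V} {τ : V → ℝ} {k : V → ℕ}
    {e : (Σ v, Fin (k v)) ≃ I} (he : ∀ p, cls (e p) = p.1) :
    classMeasure cls τ Set.univ = ∏ v, ENNReal.ofReal (τ v) ^ k v := by
  rw [classMeasure, Measure.pi_univ, ← e.prod_comp, Fintype.prod_sigma]
  refine Finset.prod_congr rfl fun v _ => ?_
  simp [he]

/-- The orderings for different `σ` exclude each other because the sorting is unique, and they have
equal measure by invariance under permutations. -/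
theorem card_mul_classMeasure_sorts {cls : I → V} {τ : V → ℝ} {k : V → ℕ}
    {e : (Σ v, Fin (k v)) ≃ I} (H : Finset (Equiv.Perm I))
    (hH : ∀ σ ∈ H, ∀ q, cls (σ q) = cls q) :
    classMeasure cls τ {t | ∃ σ ∈ H, Sorts cls t (e.trans σ)} =
      H.card * classMeasure cls τ {t | Sorts cls t e} := by
  have : {t : I → ℝ | ∃ σ ∈ H, Sorts cls t (e.trans σ)} =
      ⋃ σ ∈ H, {t | Sorts cls t (e.trans σ)} := by
    ext t; simp
  rw [this, measure_biUnion_finset]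
  · rw [Finset.sum_congr rfl fun σ hσ => ?_, Finset.sum_const, nsmul_eq_mul]
    simp_rw [sorts_trans (hH σ hσ)]
    exact classMeasure_perm cls τ σ (hH σ hσ) (measurableSet_sorts cls e)
  · intro σ hσ σ' hσ' hne
    refine Set.disjoint_left.2 fun t ht ht' => hne ?_
    have h := Sorts.unique ht ht'
    ext q
    have := Equiv.congr_fun h (e.symm q)
    simpa using this
  · exact fun σ _ => measurableSet_sorts cls _

/-- Almost surely exactly one of the `∏ k v !` orderings within the classes occurs, and all are
equally likely. -/
theorem classMeasure_sorts {cls : I → V} {τ : V → ℝ} (hτ : ∀ v, 0 ≤ τ v) {k : V → ℕ}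
    {e : (Σ v, Fin (k v)) ≃ I} (he : ∀ p, cls (e p) = p.1) :
    classMeasure cls τ {t | Sorts cls t e} = ENNReal.ofReal (∏ v, τ v ^ k v / (k v)!) := by
  have h1 := card_mul_classMeasure_sorts (cls := cls) (τ := τ) (e := e)
    (Finset.univ.filter fun σ : Equiv.Perm I => ∀ q, cls (σ q) = cls q)
    (fun σ hσ => (Finset.mem_filter.1 hσ).2)
  have h2 : classMeasure cls τ {t | ∃ σ ∈ Finset.univ.filter
      (fun σ : Equiv.Perm I => ∀ q, cls (σ q) = cls q), Sorts cls t (e.trans σ)} =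
      classMeasure cls τ Set.univ := by
    refine measure_congr ?_
    filter_upwards [classMeasure_ae_inj cls τ] with t ht
    refine propext ⟨fun _ => trivial, fun _ => ?_⟩
    obtain ⟨k', e', h'⟩ := exists_sorts (cls := cls) (t := t) fun q q' _ h => ht h
    obtain rfl : k' = k := by
      funext v
      rw [← card_class h'.cls_eq v, ← card_class he v]
    refine ⟨e.symm.trans e', ?_, ?_⟩
    · simp only [Finset.mem_filter, Finset.mem_univ, true_and, Equiv.trans_apply]
      intro q
      rw [h'.cls_eq, ← he, e.apply_symm_apply]
    · convert h'
      ext p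
      simp
  rw [h2, classMeasure_univ he, card_perm_fiber] at h1
  simp only [card_class he] at h1
  rw [Finset.prod_div_distrib, ENNReal.ofReal_div_of_pos (by positivity),
    ENNReal.ofReal_prod_of_nonneg fun v _ => pow_nonneg (hτ v) _]
  simp_rw [ENNReal.ofReal_pow (hτ _)]
  rw [h1, ← Nat.cast_prod, ENNReal.ofReal_natCast, mul_comm, ENNReal.mul_div_cancel_right]
  · exact Nat.cast_ne_zero.2 (Finset.prod_ne_zero_iff.2 fun v _ => Nat.factorial_ne_zero _)
  · exact ENNReal.natCast_ne_top _

end Sorting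

end XYHeight

end

noncomputable section

set_option linter.unusedSectionVars false

namespace XYHeight

open scoped Classical

/-! ### Words -/

/-- A finite sequence of directed edges for each vertex. -/
abbrev Word (n : ℕ) : Type := box n → List (DirEdge n)

/-- The places of the letters of a word. -/
abbrev Place {n : ℕ} (w : Word n) : Type := Σ v, Fin (w v).length

/-- The letter at a place. -/
def letter {n : ℕ} (w : Word n) (p : Place w) : DirEdge n := (w p.1)[p.2]

/-- The directed edges in `w v` have their origins in the class `v`. -/
def Valid {n : ℕ} (κ : box n → box n) (w : Word n) : Prop :=
  ∀ v, ∀ d ∈ w v, κ d.fst = v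

/-- The current that counts the letters of a word. -/
def wordCount {n : ℕ} (w : Word n) : Current n := fun d => ∑ v, (w v).count d

/-- The Poisson edges of a word: the letter with index `i` has time `-i`. -/
def stdEdges {n : ℕ} (w : Word n) : Finset (PEdge n) :=
  (Finset.univ : Finset (Place w)).image fun p => (letter w p, -((p.2 : ℕ) : ℝ))

/-- The configuration `ω` has the letters of `w`, by decreasing time in each class. -/
def Realizes {n : ℕ} (κ : box n → box n) (ω : PConfig n) (w : Word n) : Prop :=
  ∃ e : Place w ≃ (Σ d, Fin (ω.1 d)), (∀ p, (e p).1 = letter w p) ∧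
    Sorts (fun q => κ q.1.fst) (fun q => ω.2 q.1 q.2) e

/-- The Poisson process in which the edge `d` has times in `[0, τ d]`, up to a factor. -/
def timedMeasure (n : ℕ) (τ : DirEdge n → ℝ) : Measure (PConfig n) :=
  Measure.sum fun c : Current n =>
    ENNReal.ofReal (∏ d, 1 / ((c d)! : ℝ)) •
      (Measure.pi fun d : DirEdge n => Measure.pi fun _ : Fin (c d) =>
        (volume : Measure ℝ).restrict (Set.Icc 0 (τ d))).map (Sigma.mk c)

/-- The weight of a word whose class `v` has times in `[0, τ v]`. -/
def wordWeight {n : ℕ} (κ : box n → box n) (τ : box n → ℝ) (w : Word n) : ℝ≥0∞ :=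
  if Valid κ w then ENNReal.ofReal (∏ v, τ v ^ (w v).length / ((w v).length)!) else 0

variable {n : ℕ}

theorem card_getElem_eq {α : Type*} [DecidableEq α] (l : List α) (d : α) :
    Fintype.card {i : Fin l.length // l[i] = d} = l.count d := by
  induction l with
  | nil => simp
  | cons a l ih =>
    rw [List.count_cons, ← ih, Fintype.card_subtype, Fintype.card_subtype, Finset.card_filter,
      Finset.card_filter]
    refine (Fin.sum_univ_succ _).trans ?_
    simp only [Fin.getElem_fin, add_comm, List.length_cons, Fin.val_zero, List.getElem_cons_zero,
      Fin.val_succ, List.getElem_cons_succ, beq_iff_eq]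
    congr

theorem card_letter_eq (w : Word n) (d : DirEdge n) :
    Fintype.card {p : Place w // letter w p = d} = wordCount w d := by
  rw [wordCount, ← Finset.sum_congr rfl fun v _ => card_getElem_eq (w v) d, Fintype.card_subtype,
    Finset.card_filter, Fintype.sum_sigma]
  refine Finset.sum_congr rfl fun v _ => ?_
  rw [Fintype.card_subtype, Finset.card_filter]
  rfl

theorem Valid.class_letter {κ : box n → box n} {w : Word n} (h : Valid κ w) (p : Place w) :
    κ (letter w p).fst = p.1 := h p.1 _ (List.getElem_mem _)

theorem Realizes.valid {κ : box n → box n} {ω : PConfig n} {w : Word n} (h : Realizes κ ω w) :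
    Valid κ w := by
  obtain ⟨e, he, hs⟩ := h
  intro v d hd
  obtain ⟨i, hi, rfl⟩ := List.mem_iff_getElem.1 hd
  have := hs.cls_eq ⟨v, ⟨i, hi⟩⟩
  rwa [he] at this

theorem Realizes.wordCount_eq {κ : box n → box n} {ω : PConfig n} {w : Word n}
    (h : Realizes κ ω w) : wordCount w = ω.1 := by
  obtain ⟨e, he, -⟩ := h
  funext d
  rw [← card_letter_eq, Fintype.card_congr (e.subtypeEquiv (q := fun q => q.1 = d)
    fun p => by rw [he]), Fintype.card_congr (Equiv.sigmaSubtype d), Fintype.card_fin]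

theorem exists_letter_equiv {w : Word n} {c : Current n} (h : wordCount w = c) :
    ∃ e : Place w ≃ (Σ d, Fin (c d)), ∀ p, (e p).1 = letter w p := by
  have e1 : ∀ d, {p : Place w // letter w p = d} ≃ Fin (c d) := fun d =>
    Fintype.equivFinOfCardEq (by rw [card_letter_eq, h])
  exact ⟨(Equiv.sigmaFiberEquiv (letter w)).symm.trans (Equiv.sigmaCongrRight e1), fun p => rfl⟩

/-- Currying: the times of a configuration are indexed first by edge and then by point, those of
`classMeasure` by all points at once. -/
theorem pi_pi_eq_classMeasure (κ : box n → box n) (τ : box n → ℝ) (c : Current n)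
    {S : Set ((Σ d, Fin (c d)) → ℝ)} (hS : MeasurableSet S) :
    (Measure.pi fun d : DirEdge n => Measure.pi fun _ : Fin (c d) =>
        (volume : Measure ℝ).restrict (Set.Icc 0 (τ (κ d.fst))))
      {t | (fun q : Σ d, Fin (c d) => t q.1 q.2) ∈ S} =
    classMeasure (fun q : Σ d, Fin (c d) => κ q.1.fst) τ S := by
  have hm : Measurable fun (t : ∀ d, Fin (c d) → ℝ) (q : Σ d, Fin (c d)) => t q.1 q.2 :=
    measurable_pi_lambda _ fun q => (measurable_pi_apply q.2).comp (measurable_pi_apply q.1)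
  rw [classMeasure, Measure.pi_eq (μ' := (Measure.pi fun d : DirEdge n => Measure.pi
    fun _ : Fin (c d) => (volume : Measure ℝ).restrict (Set.Icc 0 (τ (κ d.fst)))).map
      (fun (t : ∀ d, Fin (c d) → ℝ) (q : Σ d, Fin (c d)) => t q.1 q.2)),
    Measure.map_apply hm hS]
  · rfl
  · intro s hs
    rw [Measure.map_apply hm (MeasurableSet.univ_pi hs)]
    have : (fun (t : ∀ d, Fin (c d) → ℝ) (q : Σ d, Fin (c d)) => t q.1 q.2) ⁻¹' Set.univ.pi s =
        Set.univ.pi fun d => Set.univ.pi fun i => s ⟨d, i⟩ := by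
      ext t
      simp only [Set.mem_preimage, Set.mem_univ_pi]
      exact ⟨fun h d i => h ⟨d, i⟩, fun h q => h q.1 q.2⟩
    rw [this, Measure.pi_pi, Fintype.prod_sigma]
    exact Finset.prod_congr rfl fun d _ => Measure.pi_pi _ _

theorem measurable_sigmaMk (c : Current n) :
    Measurable fun t : ∀ d : DirEdge n, Fin (c d) → ℝ => (⟨c, t⟩ : PConfig n) :=
  fun _ hs => MeasurableSpace.measurableSet_iInf.1 hs c

theorem measurableSet_pconfig {S : Set (PConfig n)}
    (h : ∀ c, MeasurableSet {t | (⟨c, t⟩ : PConfig n) ∈ S}) : MeasurableSet S :=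
  MeasurableSpace.measurableSet_iInf.2 h

theorem timedMeasure_apply (τ : DirEdge n → ℝ) {S : Set (PConfig n)} (hS : MeasurableSet S) :
    timedMeasure n τ S = ∑' c : Current n, ENNReal.ofReal (∏ d, 1 / ((c d)! : ℝ)) *
      (Measure.pi fun d : DirEdge n => Measure.pi fun _ : Fin (c d) =>
        (volume : Measure ℝ).restrict (Set.Icc 0 (τ d))) {t | (⟨c, t⟩ : PConfig n) ∈ S} := by
  rw [timedMeasure, Measure.sum_apply _ hS]
  refine tsum_congr fun c => ?_
  rw [Measure.smul_apply, Measure.map_apply (measurable_sigmaMk c) hS, smul_eq_mul]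
  rfl

theorem measurableSet_realizes_aux (κ : box n → box n) (w : Word n) (c : Current n) :
    MeasurableSet {t : (Σ d, Fin (c d)) → ℝ | ∃ e : Place w ≃ (Σ d, Fin (c d)),
      (∀ p, (e p).1 = letter w p) ∧ Sorts (fun q => κ q.1.fst) t e} := by
  have : {t : (Σ d, Fin (c d)) → ℝ | ∃ e : Place w ≃ (Σ d, Fin (c d)),
      (∀ p, (e p).1 = letter w p) ∧ Sorts (fun q => κ q.1.fst) t e} =
      ⋃ (e : Place w ≃ (Σ d, Fin (c d))) (_ : ∀ p, (e p).1 = letter w p),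
        {t | Sorts (fun q => κ q.1.fst) t e} := by
    ext t; simp
  rw [this]
  exact .iUnion fun e => .iUnion fun _ => measurableSet_sorts _ e

theorem measurableSet_realizes (κ : box n → box n) (w : Word n) :
    MeasurableSet {ω : PConfig n | Realizes κ ω w} := by
  refine measurableSet_pconfig fun c => ?_
  have hm : Measurable fun (t : ∀ d, Fin (c d) → ℝ) (q : Σ d, Fin (c d)) => t q.1 q.2 :=
    measurable_pi_lambda _ fun q => (measurable_pi_apply q.2).comp (measurable_pi_apply q.1)
  exact hm (measurableSet_realizes_aux κ w c)

/-- The law of the word of a configuration. -/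
theorem timedMeasure_realizes (κ : box n → box n) {τ : box n → ℝ} (hτ : ∀ v, 0 ≤ τ v)
    (w : Word n) :
    timedMeasure n (fun d => τ (κ d.fst)) {ω | Realizes κ ω w} = wordWeight κ τ w := by
  rw [wordWeight]
  split_ifs with hw
  swap
  · convert measure_empty (μ := timedMeasure n (fun d => τ (κ d.fst)))
    ext ω
    simp only [Set.mem_ofPred_eq, Set.mem_empty_iff_false, iff_false]
    exact fun h => hw h.valid
  rw [timedMeasure_apply _ (measurableSet_realizes κ w), tsum_eq_single (wordCount w)]
  · set c := wordCount w with hc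
    obtain ⟨e, he⟩ := exists_letter_equiv hc.symm
    have h1 := pi_pi_eq_classMeasure κ τ c (measurableSet_realizes_aux κ w c)
    have hcls : ∀ p, κ (e p).1.fst = p.1 := fun p => by rw [he, hw.class_letter]
    -- The enumerations with the letters of `w` differ by permutations of the points on each
    -- directed edge. There are `∏ (c d)!` of them, which cancels the prefactor of the Poisson
    -- weight.
    have h2 := card_mul_classMeasure_sorts (cls := fun q : Σ d, Fin (c d) => κ q.1.fst) (τ := τ)
      (e := e) (Finset.univ.filter fun σ : Equiv.Perm (Σ d, Fin (c d)) => ∀ q, (σ q).1 = q.1)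
      (fun σ hσ q => by rw [(Finset.mem_filter.1 hσ).2])
    have h3 : {t : (Σ d, Fin (c d)) → ℝ | ∃ e : Place w ≃ (Σ d, Fin (c d)),
        (∀ p, (e p).1 = letter w p) ∧ Sorts (fun q => κ q.1.fst) t e} =
        {t | ∃ σ ∈ Finset.univ.filter (fun σ : Equiv.Perm (Σ d, Fin (c d)) => ∀ q, (σ q).1 = q.1),
          Sorts (fun q : Σ d, Fin (c d) => κ q.1.fst) t (e.trans σ)} := by
      ext t
      constructor
      · rintro ⟨e', he', hs⟩
        refine ⟨e.symm.trans e', ?_, ?_⟩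
        · simp only [Finset.mem_filter, Finset.mem_univ, true_and, Equiv.trans_apply]
          intro q
          rw [he', ← he, e.apply_symm_apply]
        · convert hs
          exact Equiv.ext fun p => by simp
      · rintro ⟨σ, hσ, hs⟩
        refine ⟨e.trans σ, fun p => ?_, hs⟩
        rw [Equiv.trans_apply, (Finset.mem_filter.1 hσ).2, he]
    rw [← h3, card_perm_fiber (fun q : Σ d, Fin (c d) => q.1), classMeasure_sorts hτ hcls] at h2
    have h4 : ∀ d, ∀ _ : Fintype {q : Σ d, Fin (c d) // q.1 = d},
        Fintype.card {q : Σ d, Fin (c d) // q.1 = d} = c d := fun d _ => by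
      rw [Fintype.card_congr (Equiv.sigmaSubtype d), Fintype.card_fin]
    simp_rw [h4] at h2
    have h5 := h1.trans h2
    refine (congrArg _ h5).trans ?_
    rw [← mul_assoc, ← ENNReal.ofReal_natCast, ← ENNReal.ofReal_mul (by positivity)]
    have : (∏ d, 1 / ((c d)! : ℝ)) * ((∏ d, (c d)! : ℕ) : ℝ) = 1 := by
      push_cast
      rw [← Finset.prod_mul_distrib]
      exact Finset.prod_eq_one fun d _ => one_div_mul_cancel (by positivity)
    rw [this, ENNReal.ofReal_one, one_mul]
  · intro c hc
    have : {t : ∀ d, Fin (c d) → ℝ | (⟨c, t⟩ : PConfig n) ∈ {ω | Realizes κ ω w}} = ∅ := by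
      ext t
      simp only [Set.mem_ofPred_eq, Set.mem_empty_iff_false, iff_false]
      exact fun h => hc h.wordCount_eq.symm
    rw [this, measure_empty, mul_zero]

theorem Realizes.word_unique {κ : box n → box n} {ω : PConfig n} {w w' : Word n}
    (h : Realizes κ ω w) (h' : Realizes κ ω w') : w = w' := by
  obtain ⟨e, he, hs⟩ := h
  obtain ⟨e', he', hs'⟩ := h'
  have hl : (fun v => (w v).length) = fun v => (w' v).length := by
    funext v
    exact (card_class (cls := fun q : Σ d, Fin (ω.1 d) => κ q.1.fst)
      (k := fun v => (w v).length) hs.cls_eq v).symm.trans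
      (card_class (cls := fun q : Σ d, Fin (ω.1 d) => κ q.1.fst)
      (k := fun v => (w' v).length) hs'.cls_eq v)
  -- The two enumerations have different types until the lengths are identified, hence the general
  -- `k` and `k'`.
  have key : ∀ {k k' : box n → ℕ} (_ : k = k') {e : (Σ v, Fin (k v)) ≃ (Σ d, Fin (ω.1 d))}
      {e' : (Σ v, Fin (k' v)) ≃ (Σ d, Fin (ω.1 d))}
      (_ : Sorts (fun q => κ q.1.fst) (fun q => ω.2 q.1 q.2) e)
      (_ : Sorts (fun q => κ q.1.fst) (fun q => ω.2 q.1 q.2) e') (v : box n) (i : ℕ)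
      (hi : i < k v) (hi' : i < k' v), e ⟨v, ⟨i, hi⟩⟩ = e' ⟨v, ⟨i, hi'⟩⟩ := by
    rintro k k' rfl e e' h h' v i hi hi'
    rw [h.unique h']
  funext v
  refine List.ext_getElem (congrFun hl v) fun i hi hi' => ?_
  have h1 := he ⟨v, ⟨i, hi⟩⟩
  have h2 := he' ⟨v, ⟨i, hi'⟩⟩
  rw [key hl hs hs' v i hi hi', h2] at h1
  exact h1.symm

theorem exists_realizes (κ : box n → box n) (ω : PConfig n)
    (h : Function.Injective fun q : Σ d, Fin (ω.1 d) => ω.2 q.1 q.2) : ∃ w, Realizes κ ω w := by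
  obtain ⟨k, e, hs⟩ := exists_sorts (cls := fun q : Σ d, Fin (ω.1 d) => κ q.1.fst)
    (t := fun q => ω.2 q.1 q.2) fun q q' _ hq => h hq
  let w : Word n := fun v => List.ofFn fun i : Fin (k v) => (e ⟨v, i⟩).1
  have hl : ∀ v, (w v).length = k v := fun v => List.length_ofFn
  let e' : Place w ≃ (Σ v, Fin (k v)) := Equiv.sigmaCongrRight fun v => finCongr (hl v)
  refine ⟨w, e'.trans e, ?_, ?_⟩
  · rintro ⟨v, i⟩
    simp [e', letter, w]
    rfl
  · refine ⟨fun p => hs.cls_eq (e' p), fun v i j hij => hs.lt v _ _ ?_⟩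
    exact hij

theorem timedMeasure_ae_realizes (κ : box n → box n) (τ : box n → ℝ) :
    timedMeasure n (fun d => τ (κ d.fst)) (⋃ w, {ω | Realizes κ ω w})ᶜ = 0 := by
  rw [timedMeasure_apply _ (MeasurableSet.iUnion (measurableSet_realizes κ)).compl,
    ENNReal.tsum_eq_zero]
  intro c
  refine mul_eq_zero.2 (Or.inr ?_)
  have h0 := classMeasure_ae_inj (fun q : Σ d, Fin (c d) => κ q.1.fst) τ
  rw [ae_iff] at h0
  have hm : Measurable fun (t : ∀ d, Fin (c d) → ℝ) (q : Σ d, Fin (c d)) => t q.1 q.2 :=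
    measurable_pi_lambda _ fun q => (measurable_pi_apply q.2).comp (measurable_pi_apply q.1)
  obtain ⟨S, hS, hSm, hS0⟩ := exists_measurable_superset_of_null h0
  refine measure_mono_null (fun t ht => ?_) ((pi_pi_eq_classMeasure κ τ c hSm).trans hS0)
  refine hS fun hinj => ht ?_
  obtain ⟨w, hw⟩ := exists_realizes κ ⟨c, t⟩ hinj
  exact Set.mem_iUnion.2 ⟨w, hw⟩

/-- Events that depend only on the word have the probability given by the weights of words. -/
theorem timedMeasure_eq_tsum (κ : box n → box n) {τ : box n → ℝ} (hτ : ∀ v, 0 ≤ τ v)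
    {A : Set (PConfig n)} {B : Word n → Prop} (h : ∀ ω w, Realizes κ ω w → (ω ∈ A ↔ B w)) :
    timedMeasure n (fun d => τ (κ d.fst)) A = ∑' w, if B w then wordWeight κ τ w else 0 := by
  have h1 : timedMeasure n (fun d => τ (κ d.fst)) A =
      timedMeasure n (fun d => τ (κ d.fst)) (⋃ w, if B w then {ω | Realizes κ ω w} else ∅) := by
    refine measure_congr ?_
    filter_upwards [mem_ae_iff.2 (timedMeasure_ae_realizes κ τ)] with ω hω
    obtain ⟨w, hw⟩ := Set.mem_iUnion.1 hω
    refine propext ⟨fun hA => Set.mem_iUnion.2 ⟨w, ?_⟩, fun hA => ?_⟩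
    · rw [if_pos ((h ω w hw).1 hA)]; exact hw
    · obtain ⟨w', hw'⟩ := Set.mem_iUnion.1 hA
      split_ifs at hw' with hB
      · exact (h ω w' hw').2 hB
      · exact hw'.elim
  rw [h1, measure_iUnion]
  · refine tsum_congr fun w => ?_
    split_ifs
    · exact timedMeasure_realizes κ hτ w
    · exact measure_empty
  · intro w w' hne
    refine Set.disjoint_left.2 fun ω hω hω' => hne ?_
    beta_reduce at hω hω'
    split_ifs at hω hω'
    · exact hω.word_unique hω'
    all_goals simp_all
  · intro w
    split_ifs
    · exact measurableSet_realizes κ w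
    · exact .empty

/-- The weights of the words with a given number of letters of each kind. -/
theorem tsum_wordWeight_count (κ : box n → box n) {τ : box n → ℝ} (hτ : ∀ v, 0 ≤ τ v)
    (B : Current n → Prop) :
    ∑' w, (if B (wordCount w) then wordWeight κ τ w else 0) =
      ∑' c : Current n, if B c then
        ENNReal.ofReal (∏ d, τ (κ d.fst) ^ c d / (c d)!) else 0 := by
  rw [← timedMeasure_eq_tsum κ hτ (A := {ω | B ω.1})
    fun ω w hw => by rw [hw.wordCount_eq]; rfl, timedMeasure_apply]
  · refine tsum_congr fun c => ?_
    split_ifs with hc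
    · have : {t : ∀ d, Fin (c d) → ℝ | (⟨c, t⟩ : PConfig n) ∈ {ω : PConfig n | B ω.1}} =
          Set.univ := by
        ext t; simp [hc]
      rw [this, Measure.pi_univ]
      simp only [Measure.pi_univ, Measure.restrict_apply_univ, Real.volume_Icc, sub_zero,
        Finset.prod_const, Finset.card_univ, Fintype.card_fin]
      rw [Finset.prod_congr rfl fun d _ => (ENNReal.ofReal_pow (hτ (κ d.fst)) (c d)).symm,
        ← ENNReal.ofReal_prod_of_nonneg fun d _ => pow_nonneg (hτ _) _,
        ← ENNReal.ofReal_mul (Finset.prod_nonneg fun d _ => by positivity),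
        ← Finset.prod_mul_distrib]
      congr 1
      exact Finset.prod_congr rfl fun d _ => by ring
    · have : {t : ∀ d, Fin (c d) → ℝ | (⟨c, t⟩ : PConfig n) ∈ {ω : PConfig n | B ω.1}} =
          ∅ := by
        ext t; simp [hc]
      rw [this, measure_empty, mul_zero]
  · refine measurableSet_pconfig fun c => ?_
    by_cases hc : B c
    · convert MeasurableSet.univ; simp [hc]
    · convert MeasurableSet.empty; simp [hc]

end XYHeight

end

noncomputable section

set_option linter.unusedSectionVars false

namespace XYHeight

open scoped Classical

variable {n : ℕ}

/-! ### Counting edges -/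

theorem edgeCount_apply (A : Finset (PEdge n)) (d : DirEdge n) :
    edgeCount A d = (A.filter fun p => p.1 = d).card := by
  unfold edgeCount
  congr

theorem edgeCount_add_sdiff {A P : Finset (PEdge n)} (h : A ⊆ P) :
    edgeCount P = edgeCount A + edgeCount (P \ A) := by
  funext d
  rw [Pi.add_apply, edgeCount_apply, edgeCount_apply, edgeCount_apply,
    ← Finset.card_union_of_disjoint (Finset.disjoint_filter_filter Finset.disjoint_sdiff),
    ← Finset.filter_union, Finset.union_sdiff_of_subset h]

theorem sum_edgeCount_fst (P : Finset (PEdge n)) (x : box n) :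
    ∑ d : DirEdge n with d.fst = x, edgeCount P d = (P.filter fun p => p.1.fst = x).card := by
  rw [Finset.card_eq_sum_card_fiberwise (f := fun p : PEdge n => p.1)
    (t := Finset.univ.filter fun d : DirEdge n => d.fst = x)]
  · refine Finset.sum_congr rfl fun d hd => ?_
    rw [edgeCount_apply, Finset.filter_filter]
    congr 1
    ext p
    simp only [Finset.mem_filter, Finset.mem_univ, true_and] at hd ⊢
    constructor
    · rintro ⟨hp, rfl⟩
      exact ⟨hp, hd, rfl⟩
    · rintro ⟨hp, -, rfl⟩
      exact ⟨hp, rfl⟩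
  · intro p hp
    simpa using (Finset.mem_filter.1 hp).2

theorem sum_edgeCount_symm_fst (P : Finset (PEdge n)) (x : box n) :
    ∑ d : DirEdge n with d.fst = x, edgeCount P d.symm =
      (P.filter fun p => p.1.snd = x).card := by
  rw [Finset.card_eq_sum_card_fiberwise (f := fun p : PEdge n => p.1.symm)
    (t := Finset.univ.filter fun d : DirEdge n => d.fst = x)]
  · refine Finset.sum_congr rfl fun d hd => ?_
    rw [edgeCount_apply, Finset.filter_filter]
    congr 1
    ext p
    simp only [Finset.mem_filter, Finset.mem_univ, true_and] at hd ⊢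
    constructor
    · rintro ⟨hp, h⟩
      exact ⟨hp, by rw [h]; exact hd, by rw [h, SimpleGraph.Dart.symm_symm]⟩
    · rintro ⟨hp, -, rfl⟩
      exact ⟨hp, (SimpleGraph.Dart.symm_symm _).symm⟩
  · intro p hp
    simpa using (Finset.mem_filter.1 hp).2

theorem source_edgeCount (P : Finset (PEdge n)) (x : box n) :
    source (edgeCount P) x =
      (P.filter fun p => p.1.fst = x).card - (P.filter fun p => p.1.snd = x).card := by
  rw [← sum_edgeCount_fst, ← sum_edgeCount_symm_fst, source, Finset.sum_sub_distrib]
  push_cast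
  rfl

theorem balanced_iff_sourceless (P : Finset (PEdge n)) :
    Balanced P ↔ Sourceless (edgeCount P) := by
  refine forall_congr' fun x => ?_
  rw [source_edgeCount, sub_eq_zero, Nat.cast_inj]

theorem IsCycle.edgeCount_eq {z : Finset (PEdge n)} (hz : IsCycle z) (d : DirEdge n) :
    edgeCount z d = if ∃ p ∈ z, p.1 = d then 1 else 0 := by
  rw [edgeCount_apply]
  split_ifs with h
  · obtain ⟨p, hp, rfl⟩ := h
    rw [Finset.card_eq_one]
    refine ⟨p, ?_⟩
    ext q
    simp only [Finset.mem_filter, Finset.mem_singleton]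
    exact ⟨fun hq => hz.fst_inj hq.1 hp (by rw [hq.2]), by rintro rfl; exact ⟨hp, rfl⟩⟩
  · rw [Finset.card_eq_zero, Finset.filter_eq_empty_iff]
    exact fun p hp hpd => h ⟨p, hp, hpd⟩

theorem edgeCount_pos {A : Finset (PEdge n)} {d : DirEdge n} :
    0 < edgeCount A d ↔ ∃ p ∈ A, p.1 = d := by
  rw [edgeCount_apply, Finset.card_pos]
  exact ⟨fun ⟨p, hp⟩ => ⟨p, (Finset.mem_filter.1 hp).1, (Finset.mem_filter.1 hp).2⟩,
    fun ⟨p, hp, hpd⟩ => ⟨p, Finset.mem_filter.2 ⟨hp, hpd⟩⟩⟩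

theorem mem_vertices_iff_edgeCount {A : Finset (PEdge n)} {x : box n} :
    x ∈ vertices A ↔ ∃ d, 0 < edgeCount A d ∧ (d.fst = x ∨ d.snd = x) := by
  constructor
  · rintro ⟨p, hp, h⟩
    exact ⟨p.1, edgeCount_pos.2 ⟨p, hp, rfl⟩, h⟩
  · rintro ⟨d, hd, h⟩
    obtain ⟨p, hp, rfl⟩ := edgeCount_pos.1 hd
    exact ⟨p, hp, h⟩

theorem edgeCount_image {A : Finset (PEdge n)} {g : PEdge n → PEdge n} (hg : Set.InjOn g A)
    (hd : ∀ p, (g p).1 = p.1) : edgeCount (A.image g) = edgeCount A := by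
  funext d
  rw [edgeCount_apply, edgeCount_apply, Finset.filter_image,
    Finset.card_image_of_injOn (hg.mono (Finset.filter_subset _ _))]
  simp only [hd]

theorem IsCycle.image {z : Finset (PEdge n)} (hz : IsCycle z) {g : PEdge n → PEdge n}
    (hd : ∀ p, (g p).1 = p.1) : IsCycle (z.image g) := by
  have hv : ∀ x, x ∈ vertices (z.image g) → x ∈ vertices z := by
    rintro x ⟨p, hp, h⟩
    obtain ⟨p, hp', rfl⟩ := Finset.mem_image.1 hp
    rw [hd] at h
    exact ⟨p, hp', h⟩
  refine ⟨hz.nonempty.image g, fun x hx => ?_, fun x hx => ?_, fun x hx y hy => ?_⟩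
  · obtain ⟨p, hp, hpx⟩ := hz.exists_fst (hv x hx)
    refine ⟨g p, ⟨Finset.mem_image_of_mem g hp, by rwa [hd]⟩, ?_⟩
    rintro q ⟨hq, hqx⟩
    obtain ⟨q, hq', rfl⟩ := Finset.mem_image.1 hq
    rw [hd] at hqx
    rw [hz.fst_inj hq' hp (hqx.trans hpx.symm)]
  · obtain ⟨p, hp, hpx⟩ := hz.exists_snd (hv x hx)
    refine ⟨g p, ⟨Finset.mem_image_of_mem g hp, by rwa [hd]⟩, ?_⟩
    rintro q ⟨hq, hqx⟩
    obtain ⟨q, hq', rfl⟩ := Finset.mem_image.1 hq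
    rw [hd] at hqx
    rw [hz.snd_inj hq' hp (hqx.trans hpx.symm)]
  · refine Relation.EqvGen.mono ?_ _ _ (hz.connected x (hv x hx) y (hv y hy))
    rintro u v ⟨p, hp, h1, h2⟩
    exact ⟨g p, Finset.mem_image_of_mem g hp, by rwa [hd], by rwa [hd]⟩

/-! ### The Poisson edges of a word -/

theorem mem_stdEdges {w : Word n} {q : PEdge n} :
    q ∈ stdEdges w ↔ ∃ p : Place w, (letter w p, -((p.2 : ℕ) : ℝ)) = q := by
  simp [stdEdges]

theorem Valid.stdEdges_injective {κ : box n → box n} {w : Word n} (hw : Valid κ w) :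
    Function.Injective fun p : Place w => ((letter w p, -((p.2 : ℕ) : ℝ)) : PEdge n) := by
  rintro ⟨v, i⟩ ⟨v', i'⟩ h
  simp only [Prod.mk.injEq, neg_inj, Nat.cast_inj] at h
  obtain rfl : v = v' := by
    have h1 := hw.class_letter ⟨v, i⟩
    have h2 := hw.class_letter ⟨v', i'⟩
    rw [h.1, h2] at h1
    exact h1.symm
  rw [Fin.ext h.2]

theorem Valid.edgeCount_stdEdges {κ : box n → box n} {w : Word n} (hw : Valid κ w) :
    edgeCount (stdEdges w) = wordCount w := by
  funext d
  rw [edgeCount_apply, stdEdges, Finset.filter_image,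
    Finset.card_image_of_injective _ hw.stdEdges_injective, ← card_letter_eq, Fintype.card_subtype]

theorem Valid.slotted {κ : box n → box n} {w : Word n} (hw : Valid κ w) :
    Slotted (stdEdges w) := by
  intro p hp q hq h1 h2
  obtain ⟨⟨v, i⟩, rfl⟩ := mem_stdEdges.1 hp
  obtain ⟨⟨v', i'⟩, rfl⟩ := mem_stdEdges.1 hq
  obtain rfl : v = v' := by
    have h3 := hw.class_letter ⟨v, i⟩
    have h4 := hw.class_letter ⟨v', i'⟩
    simp only at h1
    rw [h1, h4] at h3
    exact h3.symm
  simp only [neg_inj, Nat.cast_inj] at h2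
  rw [Fin.ext h2]

/-- The true times are an increasing function of the standard times `-i` in each class, and all
edges out of a vertex belong to one class. -/
theorem Realizes.exists_relabels {κ : box n → box n} {ω : PConfig n} {w : Word n}
    (h : Realizes κ ω w) :
    ∃ g : PEdge n → PEdge n, (∀ p, (g p).1 = p.1) ∧ Relabels g (stdEdges w) ∧
      (stdEdges w).image g = poissonEdges ω := by
  have hw := h.valid
  obtain ⟨e, he, hs⟩ := h
  set t : (Σ d, Fin (ω.1 d)) → ℝ := fun q => ω.2 q.1 q.2 with ht
  let s : box n → ℕ → ℝ := fun v i => if h : i < (w v).length then t (e ⟨v, ⟨i, h⟩⟩) else 0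
  -- The index of a letter is read off from its standard time; the default values `0` do not occur
  -- on `stdEdges w`.
  let g : PEdge n → PEdge n := fun q => (q.1,
    if h : ∃ i : ℕ, -(i : ℝ) = q.2 then s (κ q.1.fst) h.choose else 0)
  have hg : ∀ p : Place w, g (letter w p, -((p.2 : ℕ) : ℝ)) = (letter w p, t (e p)) := by
    intro p
    have hex : ∃ i : ℕ, -(i : ℝ) = -((p.2 : ℕ) : ℝ) := ⟨p.2, rfl⟩
    have h1 : hex.choose = p.2 := Nat.cast_injective (neg_injective hex.choose_spec)
    have h2 : s p.1 p.2 = t (e p) := dif_pos p.2.2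
    simp only [g, dif_pos hex, h1]
    rw [hw.class_letter p, h2]
  refine ⟨g, fun p => rfl, ⟨fun p _ => rfl, ?_⟩, ?_⟩
  · intro p hp q hq hpq
    obtain ⟨⟨v, i⟩, rfl⟩ := mem_stdEdges.1 hp
    obtain ⟨⟨v', i'⟩, rfl⟩ := mem_stdEdges.1 hq
    obtain rfl : v = v' := by
      have h3 := hw.class_letter ⟨v, i⟩
      have h4 := hw.class_letter ⟨v', i'⟩
      simp only at hpq
      rw [hpq, h4] at h3
      exact h3.symm
    rw [hg, hg]
    have hanti : StrictAnti fun i => t (e ⟨v, i⟩) := fun i j hij => hs.lt v i j hij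
    have := hanti.le_iff_ge (a := i) (b := i')
    simp only [neg_le_neg_iff, Nat.cast_le, Fin.val_fin_le]
    exact this
  · ext q
    simp only [Finset.mem_image, mem_stdEdges, poissonEdges, Finset.mem_univ, true_and]
    constructor
    · rintro ⟨_, ⟨p, rfl⟩, rfl⟩
      exact ⟨e p, by rw [hg]; exact Prod.ext (he p) rfl⟩
    · rintro ⟨q, rfl⟩
      refine ⟨_, ⟨e.symm q, rfl⟩, ?_⟩
      rw [hg, ← he, e.apply_symm_apply]

/-- Some cycle of the decomposition of the edges of `w` has the property `R`. -/
def HasCycle {n : ℕ} (R : Current n → Prop) (w : Word n) : Prop :=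
  ∃ z, Pops (stdEdges w) z ∧ R (edgeCount z)

/-- The decomposition commutes with the relabelling of times, which also keeps the current of each
cycle. This holds for every class map, not only for `id`; the exploration uses it with two merged
vertices. -/
theorem Realizes.hasCycle_iff {κ : box n → box n} {ω : PConfig n} {w : Word n}
    (h : Realizes κ ω w) (hc : Sourceless ω.1) (R : Current n → Prop) :
    (∃ z ∈ cycleDecomp (poissonEdges ω), R (edgeCount z)) ↔ HasCycle R w := by
  obtain ⟨g, hd, hg, hgi⟩ := h.exists_relabels
  have hsl := h.valid.slotted
  have hb : Balanced (stdEdges w) := by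
    rw [balanced_iff_sourceless, h.valid.edgeCount_stdEdges, h.wordCount_eq]
    exact hc
  have hsl' : Slotted (poissonEdges ω) := hgi ▸ hg.slotted hsl
  have hp : ∀ y, Pops (poissonEdges ω) y ↔ ∃ z, Pops (stdEdges w) z ∧ z.image g = y := by
    rw [← hgi]
    exact hg.pops_image hsl hb fun z hz => hz.isCycle.image hd
  constructor
  · rintro ⟨y, hy, hR⟩
    rw [mem_cycleDecomp_iff hsl', hp] at hy
    obtain ⟨z, hz, rfl⟩ := hy
    refine ⟨z, hz, ?_⟩
    rwa [edgeCount_image ((hg.injOn hsl).mono hz.subset) hd] at hR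
  · rintro ⟨z, hz, hR⟩
    refine ⟨z.image g, (mem_cycleDecomp_iff hsl' _).2 ((hp _).2 ⟨z, hz, rfl⟩), ?_⟩
    rwa [edgeCount_image ((hg.injOn hsl).mono hz.subset) hd]

/-! ### Reversing cycles -/

/-- Reversal of a cycle `z`: the edge that leaves a vertex is replaced by the reversal of the edge
of `z` that enters it, with the same time. -/
def flipEdge {n : ℕ} (z : Finset (PEdge n)) (q : PEdge n) : PEdge n :=
  if h : ∃ p ∈ z, p.1.snd = q.1.fst then (h.choose.1.symm, q.2) else q

theorem flipEdge_eq {z : Finset (PEdge n)} (hz : IsCycle z) {p q : PEdge n} (hp : p ∈ z)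
    (h : p.1.snd = q.1.fst) : flipEdge z q = (p.1.symm, q.2) := by
  have hex : ∃ p ∈ z, p.1.snd = q.1.fst := ⟨p, hp, h⟩
  rw [flipEdge, dif_pos hex]
  rw [hz.snd_inj hex.choose_spec.1 hp (hex.choose_spec.2.trans h.symm)]

theorem flipEdge_fst (z : Finset (PEdge n)) (q : PEdge n) :
    (flipEdge z q).1.fst = q.1.fst := by
  unfold flipEdge
  split_ifs with h
  · exact h.choose_spec.2
  · rfl

theorem flipEdge_time (z : Finset (PEdge n)) (q : PEdge n) : (flipEdge z q).2 = q.2 := by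
  unfold flipEdge
  split_ifs <;> rfl

namespace IsCycle

variable {z : Finset (PEdge n)}

theorem mem_flip_iff (hz : IsCycle z) {d : DirEdge n} :
    (∃ q ∈ z.image (flipEdge z), q.1 = d) ↔ ∃ p ∈ z, p.1 = d.symm := by
  constructor
  · rintro ⟨q, hq, rfl⟩
    obtain ⟨q, hq', rfl⟩ := Finset.mem_image.1 hq
    obtain ⟨p, hp, hpq⟩ := hz.exists_prev hq'
    exact ⟨p, hp, by rw [flipEdge_eq hz hp hpq, SimpleGraph.Dart.symm_symm]⟩
  · rintro ⟨p, hp, hd⟩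
    obtain ⟨q, hq, hpq⟩ := hz.exists_next hp
    refine ⟨flipEdge z q, Finset.mem_image_of_mem _ hq, ?_⟩
    rw [flipEdge_eq hz hp hpq.symm, hd, SimpleGraph.Dart.symm_symm]

theorem vertices_flip_subset (hz : IsCycle z) :
    vertices (z.image (flipEdge z)) ⊆ vertices z := by
  rintro x ⟨q, hq, h⟩
  obtain ⟨p, hp, hd⟩ := hz.mem_flip_iff.1 ⟨q, hq, rfl⟩
  refine ⟨p, hp, ?_⟩
  rw [hd]
  exact h.symm

theorem flip (hz : IsCycle z) : IsCycle (z.image (flipEdge z)) := by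
  refine ⟨hz.nonempty.image _, fun x hx => ?_, fun x hx => ?_, fun x hx y hy => ?_⟩
  · obtain ⟨p, hp, hpx⟩ := hz.exists_fst (hz.vertices_flip_subset hx)
    refine ⟨flipEdge z p, ⟨Finset.mem_image_of_mem _ hp, by rwa [flipEdge_fst]⟩, ?_⟩
    rintro q ⟨hq, hqx⟩
    obtain ⟨q, hq', rfl⟩ := Finset.mem_image.1 hq
    rw [flipEdge_fst] at hqx
    rw [hz.fst_inj hq' hp (hqx.trans hpx.symm)]
  · obtain ⟨p, hp, hpx⟩ := hz.exists_fst (hz.vertices_flip_subset hx)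
    obtain ⟨q, hq, hpq⟩ := hz.exists_next hp
    refine ⟨flipEdge z q, ⟨Finset.mem_image_of_mem _ hq, ?_⟩, ?_⟩
    · rw [flipEdge_eq hz hp hpq.symm]
      exact hpx
    rintro r ⟨hr, hrx⟩
    obtain ⟨r, hr', rfl⟩ := Finset.mem_image.1 hr
    obtain ⟨s, hs, hsr⟩ := hz.exists_prev hr'
    rw [flipEdge_eq hz hs hsr] at hrx
    have : s = p := hz.fst_inj hs hp (hrx.trans hpx.symm)
    subst this
    rw [hz.fst_inj hr' hq (hsr.symm.trans hpq.symm)]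
  · have h := hz.connected x (hz.vertices_flip_subset hx) y (hz.vertices_flip_subset hy)
    clear hx hy
    induction h with
    | rel u v h =>
      obtain ⟨p, hp, rfl, rfl⟩ := h
      obtain ⟨q, hq, hd⟩ := hz.mem_flip_iff.2 ⟨p, hp, (SimpleGraph.Dart.symm_symm p.1).symm⟩
      refine .symm _ _ (.rel _ _ ⟨q, hq, ?_, ?_⟩) <;> rw [hd] <;> rfl
    | refl => exact .refl _
    | symm u v _ ih => exact .symm _ _ ih
    | trans u v w _ _ ih1 ih2 => exact .trans _ _ _ ih1 ih2

theorem edgeCount_flip (hz : IsCycle z) (d : DirEdge n) :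
    edgeCount (z.image (flipEdge z)) d = edgeCount z d.symm := by
  rw [hz.flip.edgeCount_eq, hz.edgeCount_eq]
  simp only [hz.mem_flip_iff]

/-- In the reversed cycle, the edge that enters the origin of `q` is the reversal of `q`; it
occupies the slot of the successor `r` of `q`. -/
theorem flipEdge_flipEdge (hz : IsCycle z) {q : PEdge n} (hq : q ∈ z) :
    flipEdge (z.image (flipEdge z)) (flipEdge z q) = q := by
  obtain ⟨r, hr, hqr⟩ := hz.exists_next hq
  have h1 := flipEdge_eq hz hq hqr.symm
  rw [flipEdge_eq hz.flip (Finset.mem_image_of_mem _ hr), h1, flipEdge_time]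
  · simp
  · rw [h1, flipEdge_fst]
    rfl

end IsCycle

/-- A removed cycle takes its edges with it, so an edge belongs to at most one cycle of the
decomposition. This removes the ambiguity of the choice in `flipMap`. -/
theorem Pops.eq_of_mem {P z y : Finset (PEdge n)} (hP : Slotted P) (hz : Pops P z)
    (hy : Pops P y) {p : PEdge n} (hpz : p ∈ z) (hpy : p ∈ y) : z = y := by
  induction hz with
  | @top P z hz =>
    rcases hy.eq_or_sdiff hP hz with h | h
    · exact h.symm
    · exact absurd hpz (Finset.mem_sdiff.1 (h.subset hpy)).2
  | @pop P e z he h ih =>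
    rcases hy.eq_or_sdiff hP he with rfl | h'
    · exact absurd hpy (Finset.mem_sdiff.1 (h.subset hpz)).2
    · exact ih (hP.mono Finset.sdiff_subset) h' hpz

/-- Reversal of the cycles of the decomposition of `P` whose current has the property `R`. -/
def flipMap {n : ℕ} (R : Current n → Prop) (P : Finset (PEdge n)) (q : PEdge n) : PEdge n :=
  if h : ∃ z, (Pops P z ∧ R (edgeCount z)) ∧ q ∈ z then flipEdge h.choose q else q

/-! ### Reversing a selection of the cycles. -/

section flipMap

variable {R : Current n → Prop} {P : Finset (PEdge n)}

theorem flipMap_fst (q : PEdge n) : (flipMap R P q).1.fst = q.1.fst := by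
  unfold flipMap
  split_ifs
  · exact flipEdge_fst _ _
  · rfl

theorem flipMap_time (q : PEdge n) : (flipMap R P q).2 = q.2 := by
  unfold flipMap
  split_ifs
  · exact flipEdge_time _ _
  · rfl

theorem relabels_flipMap : Relabels (flipMap R P) P :=
  ⟨fun p _ => flipMap_fst p, fun p _ q _ _ => by rw [flipMap_time, flipMap_time]⟩

theorem flipMap_eq (hP : Slotted P) {z : Finset (PEdge n)} (hz : Pops P z) (hR : R (edgeCount z))
    {q : PEdge n} (hq : q ∈ z) : flipMap R P q = flipEdge z q := by
  have h : ∃ z, (Pops P z ∧ R (edgeCount z)) ∧ q ∈ z := ⟨z, ⟨hz, hR⟩, hq⟩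
  rw [flipMap, dif_pos h, h.choose_spec.1.1.eq_of_mem hP hz h.choose_spec.2 hq]

theorem image_flipMap (hP : Slotted P) {z : Finset (PEdge n)} (hz : Pops P z) :
    z.image (flipMap R P) = if R (edgeCount z) then z.image (flipEdge z) else z := by
  split_ifs with hR
  · exact Finset.image_congr fun q hq => flipMap_eq hP hz hR hq
  · conv_rhs => rw [← Finset.image_id (s := z)]
    refine Finset.image_congr fun q hq => ?_
    rw [flipMap, dif_neg]
    · rfl
    · rintro ⟨y, ⟨hy, hRy⟩, hqy⟩
      exact hR (hz.eq_of_mem hP hy hq hqy ▸ hRy)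

theorem isCycle_image_flipMap (hP : Slotted P) {z : Finset (PEdge n)} (hz : Pops P z) :
    IsCycle (z.image (flipMap R P)) := by
  rw [image_flipMap hP hz]
  split_ifs
  · exact hz.isCycle.flip
  · exact hz.isCycle

theorem edgeCount_image_flipMap (hP : Slotted P) {z : Finset (PEdge n)} (hz : Pops P z) :
    edgeCount (z.image (flipMap R P)) =
      if R (edgeCount z) then fun d => edgeCount z d.symm else edgeCount z := by
  rw [image_flipMap hP hz]
  split_ifs
  · exact funext hz.isCycle.edgeCount_flip
  · rfl

/-- Since the slots stay in place, the reversed cycles come to the top in the same order as the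
original ones. -/
theorem pops_flipMap (hP : Slotted P) (hb : Balanced P) (y : Finset (PEdge n)) :
    Pops (P.image (flipMap R P)) y ↔ ∃ z, Pops P z ∧ z.image (flipMap R P) = y :=
  relabels_flipMap.pops_image hP hb (fun _ hz => isCycle_image_flipMap hP hz) y

theorem prop_edgeCount_image_flipMap (hP : Slotted P) (hR : ∀ c, R (fun d => c d.symm) ↔ R c)
    {z : Finset (PEdge n)} (hz : Pops P z) :
    R (edgeCount (z.image (flipMap R P))) ↔ R (edgeCount z) := by
  rw [edgeCount_image_flipMap hP hz]
  split_ifs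
  · exact hR _
  · rfl

/-- `R` does not see orientation, so the same cycles are selected in the image and are reversed
back. -/
theorem flipMap_flipMap (hP : Slotted P) (hb : Balanced P)
    (hR : ∀ c, R (fun d => c d.symm) ↔ R c) {q : PEdge n} (hq : q ∈ P) :
    flipMap R (P.image (flipMap R P)) (flipMap R P q) = q := by
  have hP' := (relabels_flipMap (R := R)).slotted hP
  by_cases h : ∃ z, (Pops P z ∧ R (edgeCount z)) ∧ q ∈ z
  · obtain ⟨z, ⟨hz, hRz⟩, hqz⟩ := h
    have h1 : Pops (P.image (flipMap R P)) (z.image (flipMap R P)) :=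
      (pops_flipMap hP hb _).2 ⟨z, hz, rfl⟩
    rw [flipMap_eq hP' h1 ((prop_edgeCount_image_flipMap hP hR hz).2 hRz)
      (Finset.mem_image_of_mem _ hqz), flipMap_eq hP hz hRz hqz, image_flipMap hP hz, if_pos hRz,
      hz.isCycle.flipEdge_flipEdge hqz]
  · have h2 : flipMap R P q = q := by rw [flipMap, dif_neg h]
    have h3 : ¬ ∃ z, (Pops (P.image (flipMap R P)) z ∧ R (edgeCount z)) ∧
        flipMap R P q ∈ z := by
      rintro ⟨y, ⟨hy, hRy⟩, hqy⟩
      obtain ⟨z, hz, rfl⟩ := (pops_flipMap hP hb _).1 hy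
      obtain ⟨p, hp, hpq⟩ := Finset.mem_image.1 hqy
      have := relabels_flipMap.injOn hP (hz.subset hp) hq hpq
      exact h ⟨z, ⟨hz, (prop_edgeCount_image_flipMap hP hR hz).1 hRy⟩, this ▸ hp⟩
    rw [flipMap, dif_neg h3, h2]

end flipMap

/-- An additive function of the current is determined by its values on the cycles. -/
theorem Relabels.map_edgeCount_image {f : PEdge n → PEdge n} {P : Finset (PEdge n)}
    (h : Relabels f P) (hP : Slotted P) (hb : Balanced P) (F G : Current n →+ ℤ)
    (hFG : ∀ z, Pops P z → F (edgeCount (z.image f)) = G (edgeCount z)) :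
    F (edgeCount (P.image f)) = G (edgeCount P) := by
  revert h hFG
  refine popping_induction (motive := fun P => Relabels f P →
    (∀ z, Pops P z → F (edgeCount (z.image f)) = G (edgeCount z)) →
    F (edgeCount (P.image f)) = G (edgeCount P)) ?_ ?_ hP hb
  · intro _ _
    have : edgeCount (∅ : Finset (PEdge n)) = 0 := by
      funext d; simp [edgeCount_apply]
    rw [Finset.image_empty, this, map_zero, map_zero]
  · intro P z hP hb hz ih h hFG
    have hzP := subset_of_mem_topCycles hz
    have hsd : P.image f \ z.image f = (P \ z).image f := by
      rw [Finset.image_sdiff_of_injOn (h.injOn hP) hzP]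
    rw [edgeCount_add_sdiff (Finset.image_subset_image hzP), edgeCount_add_sdiff hzP, map_add,
      map_add, hsd, hFG z (.top hz),
      ih (h.mono Finset.sdiff_subset) fun y hy => hFG y (.pop hz hy)]

end XYHeight

end

noncomputable section

set_option linter.unusedSectionVars false

namespace XYHeight

open scoped Classical

/-! ### The exponential series in several variables -/

section ExpSeries

variable {D : Type*} [Fintype D] {𝕜 : Type*} [RCLike 𝕜]

/-- The multi-indices of a given degree. -/
instance fintypeDegree (k : ℕ) : Fintype {c : D → ℕ // ∑ d, c d = k} :=
  Fintype.subtype (Finset.piAntidiag Finset.univ k) fun c => by simp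

/-- The multinomial theorem divided by `k !`. -/
theorem sum_degree_prod_pow_div_factorial (a : D → 𝕜) (k : ℕ) :
    ∑ c : {c : D → ℕ // ∑ d, c d = k}, ∏ d, a d ^ c.1 d / ((c.1 d)! : 𝕜) =
      (∑ d, a d) ^ k / (k ! : 𝕜) := by
  rw [Finset.sum_pow_eq_sum_piAntidiag, Finset.sum_div, ← Finset.sum_subtype
    (Finset.piAntidiag Finset.univ k) (p := fun c : D → ℕ => ∑ d, c d = k) (fun c => by simp)
    (fun c : D → ℕ => ∏ d, a d ^ c d / ((c d)! : 𝕜))]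
  refine Finset.sum_congr rfl fun c hc => ?_
  have hc' : ∑ d, c d = k := by simpa using hc
  have h := Nat.multinomial_spec Finset.univ c
  rw [hc'] at h
  have hk : (k ! : 𝕜) ≠ 0 := Nat.cast_ne_zero.2 (Nat.factorial_ne_zero k)
  have hp : ((∏ d, (c d)! : ℕ) : 𝕜) ≠ 0 :=
    Nat.cast_ne_zero.2 (Finset.prod_ne_zero_iff.2 fun d _ => Nat.factorial_ne_zero _)
  rw [Finset.prod_div_distrib, eq_div_iff hk, ← h]
  push_cast at hp ⊢
  field_simp

/-- Grouped by degree, the norms sum to the exponential series of `∑ d, ‖a d‖`. -/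
theorem summable_prod_pow_div_factorial (a : D → 𝕜) :
    Summable fun c : D → ℕ => ∏ d, a d ^ c d / ((c d)! : 𝕜) := by
  refine Summable.of_norm ?_
  have : (fun c : D → ℕ => ‖∏ d, a d ^ c d / ((c d)! : 𝕜)‖) =
      fun c => ∏ d, ‖a d‖ ^ c d / ((c d)! : ℝ) := by
    funext c
    simp [norm_prod]
  rw [this, ← (Equiv.sigmaFiberEquiv fun c : D → ℕ => ∑ d, c d).summable_iff]
  refine (summable_sigma_of_nonneg fun c => ?_).2 ⟨fun k => Summable.of_finite, ?_⟩
  · exact Finset.prod_nonneg fun d _ => by positivity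
  have h := Real.summable_pow_div_factorial (∑ d, ‖a d‖)
  refine h.congr fun k => ?_
  have := sum_degree_prod_pow_div_factorial (fun d => ‖a d‖) k
  rw [← this, tsum_fintype]
  rfl

theorem tsum_prod_pow_div_factorial (a : D → ℂ) :
    ∑' c : D → ℕ, ∏ d, a d ^ c d / ((c d)! : ℂ) = Complex.exp (∑ d, a d) := by
  have hs := summable_prod_pow_div_factorial a
  rw [← (Equiv.sigmaFiberEquiv fun c : D → ℕ => ∑ d, c d).summable_iff] at hs
  rw [← (Equiv.sigmaFiberEquiv fun c : D → ℕ => ∑ d, c d).tsum_eq]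
  refine hs.tsum_sigma.trans ?_
  rw [Complex.exp_eq_exp_ℂ, NormedSpace.exp_eq_tsum_div]
  refine tsum_congr fun k => ?_
  rw [tsum_fintype, ← sum_degree_prod_pow_div_factorial]
  rfl

end ExpSeries

end XYHeight

end

noncomputable section

set_option linter.unusedSectionVars false

namespace XYHeight

open scoped Classical

variable {n : ℕ}

/-! ### Reversing cycles in words -/

/-- Reversal of the cycles with the property `R` in a balanced word. -/
def flipWord {n : ℕ} (R : Current n → Prop) (w : Word n) : Word n :=
  if Valid id w ∧ Balanced (stdEdges w) then
    fun v => (w v).mapIdx fun i d => (flipMap R (stdEdges w) (d, -(i : ℝ))).1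
  else w

theorem mem_stdEdges_iff {w : Word n} {q : PEdge n} :
    q ∈ stdEdges w ↔ ∃ (v : box n) (i : ℕ) (h : i < (w v).length), ((w v)[i], -(i : ℝ)) = q := by
  rw [mem_stdEdges]
  exact ⟨fun ⟨⟨v, i⟩, h⟩ => ⟨v, i, i.2, h⟩, fun ⟨v, i, hi, h⟩ => ⟨⟨v, ⟨i, hi⟩⟩, h⟩⟩

section flipWord

variable {R : Current n → Prop} {w : Word n}

theorem flipWord_length (R : Current n → Prop) (w : Word n) (v : box n) :
    (flipWord R w v).length = (w v).length := by
  unfold flipWord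
  split_ifs <;> simp

theorem flipWord_getElem (hw : Valid id w) (hb : Balanced (stdEdges w)) (v : box n) (i : ℕ)
    (h : i < (flipWord R w v).length) (h' : i < (w v).length) :
    (flipWord R w v)[i] = (flipMap R (stdEdges w) ((w v)[i], -(i : ℝ))).1 := by
  simp only [flipWord, if_pos (And.intro hw hb), List.getElem_mapIdx]

theorem Valid.flipWord (hw : Valid id w) : Valid id (flipWord R w) := by
  by_cases hb : Balanced (stdEdges w)
  · intro v d hd
    obtain ⟨i, hi, rfl⟩ := List.mem_iff_getElem.1 hd
    have hi' : i < (w v).length := by rwa [flipWord_length] at hi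
    rw [flipWord_getElem hw hb v i hi hi', flipMap_fst]
    exact hw v _ (List.getElem_mem hi')
  · rwa [XYHeight.flipWord, if_neg fun h => hb h.2]

theorem stdEdges_flipWord (hw : Valid id w) (hb : Balanced (stdEdges w)) :
    stdEdges (flipWord R w) = (stdEdges w).image (flipMap R (stdEdges w)) := by
  ext q
  simp only [Finset.mem_image, mem_stdEdges_iff]
  constructor
  · rintro ⟨v, i, hi, rfl⟩
    have hi' : i < (w v).length := by rwa [flipWord_length] at hi
    refine ⟨_, ⟨v, i, hi', rfl⟩, ?_⟩
    rw [flipWord_getElem hw hb v i hi hi']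
    exact Prod.ext rfl (flipMap_time _)
  · rintro ⟨_, ⟨v, i, hi, rfl⟩, rfl⟩
    have hi' : i < (flipWord R w v).length := by rwa [flipWord_length]
    refine ⟨v, i, hi', ?_⟩
    rw [flipWord_getElem hw hb v i hi' hi]
    exact Prod.ext rfl (by rw [flipMap_time])

/-- The decomposition exhausts a balanced configuration, and every one of its cycles is mapped to a
cycle, which is balanced. -/
theorem balanced_flipWord (hw : Valid id w) (hb : Balanced (stdEdges w)) :
    Balanced (stdEdges (flipWord R w)) := by
  rw [stdEdges_flipWord hw hb]
  refine popping_induction (motive := fun P => ∀ f, Relabels f P →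
    (∀ z, Pops P z → IsCycle (z.image f)) → Balanced (P.image f)) ?_ ?_ hw.slotted hb _
    relabels_flipMap fun z hz => isCycle_image_flipMap hw.slotted hz
  · intro f _ _ v
    simp
  · intro P z hP _ hz ih f hf hc
    have hzP := subset_of_mem_topCycles hz
    rw [← Finset.union_sdiff_of_subset hzP, Finset.image_union]
    refine (hc z (.top hz)).balanced.union (ih f (hf.mono Finset.sdiff_subset)
      fun y hy => hc y (.pop hz hy)) ?_
    rw [Finset.disjoint_left]
    intro p hp hp'
    obtain ⟨q, hq, rfl⟩ := Finset.mem_image.1 hp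
    obtain ⟨r, hr, hrq⟩ := Finset.mem_image.1 hp'
    rw [Finset.mem_sdiff] at hr
    exact hr.2 (hf.injOn hP hr.1 (hzP hq) hrq ▸ hq)

/-- Words that are not valid or not balanced are fixed by definition; on the others the claim is
`flipMap_flipMap` in each slot. -/
theorem flipWord_involutive (hR : ∀ c, R (fun d => c d.symm) ↔ R c) :
    Function.Involutive (flipWord R) := by
  intro w
  by_cases h : Valid id w ∧ Balanced (stdEdges w)
  · obtain ⟨hw, hb⟩ := h
    funext v
    refine List.ext_getElem (by rw [flipWord_length, flipWord_length]) fun i hi hi' => ?_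
    have hi'' : i < (flipWord R w v).length := by rwa [flipWord_length]
    rw [flipWord_getElem hw.flipWord (balanced_flipWord hw hb) v i hi hi'',
      flipWord_getElem hw hb v i hi'' hi']
    have h1 : ((flipMap R (stdEdges w) ((w v)[i], -(i : ℝ))).1, -(i : ℝ)) =
        flipMap R (stdEdges w) ((w v)[i], -(i : ℝ)) := Prod.ext rfl (by rw [flipMap_time])
    rw [h1, stdEdges_flipWord hw hb, flipMap_flipMap hw.slotted hb hR]
    exact mem_stdEdges_iff.2 ⟨v, i, hi', rfl⟩
  · have : flipWord R w = w := by rw [flipWord, if_neg h]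
    rw [this, this]

theorem hasCycle_flipWord (hw : Valid id w) (hb : Balanced (stdEdges w))
    {S : Current n → Prop} (hS : ∀ c, S (fun d => c d.symm) ↔ S c) :
    HasCycle S (flipWord R w) ↔ HasCycle S w := by
  have key : ∀ z, Pops (stdEdges w) z →
      (S (edgeCount (z.image (flipMap R (stdEdges w)))) ↔ S (edgeCount z)) := by
    intro z hz
    rw [edgeCount_image_flipMap hw.slotted hz]
    split_ifs
    · exact hS _
    · rfl
  unfold HasCycle
  rw [stdEdges_flipWord hw hb]
  constructor
  · rintro ⟨y, hy, hSy⟩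
    obtain ⟨z, hz, rfl⟩ := (pops_flipMap hw.slotted hb _).1 hy
    exact ⟨z, hz, (key z hz).1 hSy⟩
  · rintro ⟨z, hz, hSz⟩
    exact ⟨_, (pops_flipMap hw.slotted hb _).2 ⟨z, hz, rfl⟩, (key z hz).2 hSz⟩

/-- An additive function that is odd under reversal. -/
def OddUnderReversal {n : ℕ} (F : Current n →+ ℤ) : Prop := ∀ c, F (fun d => c d.symm) = -F c

theorem OddUnderReversal.ne_zero_iff {F : Current n →+ ℤ} (hF : OddUnderReversal F)
    (c : Current n) : F (fun d => c d.symm) ≠ 0 ↔ F c ≠ 0 := by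
  rw [hF, neg_ne_zero]

/-- The current is the sum of the currents of the cycles, so additive functions may be compared
cycle by cycle. `G` differs from `F` where reversal changes a sign. -/
theorem map_wordCount_flipWord (hw : Valid id w) (hb : Balanced (stdEdges w))
    (F G : Current n →+ ℤ)
    (h : ∀ z, Pops (stdEdges w) z →
      F (if R (edgeCount z) then fun d => edgeCount z d.symm else edgeCount z) =
        G (edgeCount z)) :
    F (wordCount (flipWord R w)) = G (wordCount w) := by
  rw [← hw.flipWord.edgeCount_stdEdges, ← hw.edgeCount_stdEdges, stdEdges_flipWord hw hb]
  refine relabels_flipMap.map_edgeCount_image hw.slotted hb F G fun z hz => ?_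
  rw [edgeCount_image_flipMap hw.slotted hz]
  exact h z hz

end flipWord

/-! ### The law of the word -/

instance : MeasurableSpace (List (DirEdge n)) := ⊤

instance : DiscreteMeasurableSpace (List (DirEdge n)) := ⟨fun _ => trivial⟩

/-- The measure on words in which the outgoing edges of a vertex are listed by decreasing time. -/
def wordMeasure (n : ℕ) (T : ℝ) : Measure (Word n) :=
  Measure.sum fun w => wordWeight id (fun _ => T) w • Measure.dirac w

/-- The words of sourceless currents. -/
def sourcelessWords (n : ℕ) : Set (Word n) := {w | Sourceless (wordCount w)}

/-- The law of the word of a sourceless current. -/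
def wordLaw (n : ℕ) (T : ℝ) : Measure (Word n) :=
  ProbabilityTheory.cond (wordMeasure n T) (sourcelessWords n)

theorem wordMeasure_apply (T : ℝ) (A : Set (Word n)) :
    wordMeasure n T A = ∑' w, if w ∈ A then wordWeight id (fun _ => T) w else 0 := by
  rw [wordMeasure, Measure.sum_apply _ (.of_discrete)]
  refine tsum_congr fun w => ?_
  rw [Measure.smul_apply, Measure.dirac_apply' _ .of_discrete, smul_eq_mul, Set.indicator_apply]
  split_ifs <;> simp

theorem currentMeasure_apply (T : ℝ) (A : Set (Current n)) :
    currentMeasure n T A =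
      ∑' c, if c ∈ A then ENNReal.ofReal (∏ d, T ^ c d / (c d)!) else 0 := by
  rw [currentMeasure, Measure.sum_apply _ (.of_discrete)]
  refine tsum_congr fun c => ?_
  rw [Measure.smul_apply, Measure.dirac_apply' _ .of_discrete, smul_eq_mul, Set.indicator_apply]
  split_ifs <;> simp

theorem currentMeasure_eq_wordMeasure {T : ℝ} (hT : 0 ≤ T) (A : Set (Current n)) :
    currentMeasure n T A = wordMeasure n T (wordCount ⁻¹' A) := by
  rw [currentMeasure_apply, wordMeasure_apply,
    ← tsum_wordWeight_count id (τ := fun _ => T) (fun _ => hT) (· ∈ A)]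
  rfl

theorem currentMeasure_ne_top (T : ℝ) (A : Set (Current n)) :
    currentMeasure n T A ≠ ⊤ := by
  refine ne_top_of_le_ne_top ?_ (measure_mono (Set.subset_univ A))
  rw [currentMeasure_apply]
  simp only [Set.mem_univ, if_true]
  have := summable_prod_pow_div_factorial (fun _ : DirEdge n => T)
  exact this.tsum_ofReal_ne_top

theorem currentMeasure_sourceless_pos (T : ℝ) :
    currentMeasure n T {c | Sourceless c} ≠ 0 := by
  rw [currentMeasure_apply]
  refine (ne_of_lt (lt_of_lt_of_le ?_ (ENNReal.le_tsum (0 : Current n)))).symm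
  rw [if_pos]
  · simp
  · intro x
    simp [source]

instance {T : ℝ} : IsZeroOrProbabilityMeasure (wordLaw n T) := by
  unfold wordLaw; infer_instance

theorem wordMeasure_sourceless {T : ℝ} (hT : 0 ≤ T) :
    wordMeasure n T (sourcelessWords n) = currentMeasure n T {c | Sourceless c} :=
  (currentMeasure_eq_wordMeasure hT {c | Sourceless c}).symm

theorem wordLaw_apply (T : ℝ) (A : Set (Word n)) :
    wordLaw n T A = (wordMeasure n T (sourcelessWords n))⁻¹ *
      wordMeasure n T (sourcelessWords n ∩ A) := by
  rw [wordLaw, cond_apply .of_discrete]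

theorem map_wordCount_wordLaw {T : ℝ} (hT : 0 ≤ T) :
    (wordLaw n T).map wordCount = currentLaw n T := by
  ext A hA
  rw [Measure.map_apply .of_discrete hA, wordLaw_apply, currentLaw,
    cond_apply .of_discrete, wordMeasure_sourceless hT, currentMeasure_eq_wordMeasure hT
    ({c | Sourceless c} ∩ A)]
  rfl

theorem measurableSet_of_fst (B : Current n → Prop) :
    MeasurableSet {ω : PConfig n | B ω.1} := by
  refine measurableSet_pconfig fun c => ?_
  by_cases hc : B c
  · convert MeasurableSet.univ; simp [hc]
  · convert MeasurableSet.empty; simp [hc]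

theorem poissonMeasure_eq_wordMeasure {T : ℝ} (hT : 0 ≤ T) {A : Set (PConfig n)}
    {B : Set (Word n)} (h : ∀ ω w, Realizes id ω w → (ω ∈ A ↔ w ∈ B)) :
    poissonMeasure n T A = wordMeasure n T B := by
  rw [wordMeasure_apply, ← timedMeasure_eq_tsum id (τ := fun _ => T) (fun _ => hT) h]
  rfl

theorem poissonMeasure_sourceless {T : ℝ} (hT : 0 ≤ T) :
    poissonMeasure n T {ω | Sourceless ω.1} = wordMeasure n T (sourcelessWords n) :=
  poissonMeasure_eq_wordMeasure hT fun ω w h => by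
    rw [Set.mem_ofPred_eq, ← h.wordCount_eq]; rfl

/-- The probability that some cycle of the decomposition has a given property. -/
theorem poissonLaw_hasCycle {T : ℝ} (hT : 0 ≤ T) (R : Current n → Prop) :
    poissonLaw n T {ω | ∃ z ∈ cycleDecomp (poissonEdges ω), R (edgeCount z)} =
      wordLaw n T {w | HasCycle R w} := by
  rw [poissonLaw, cond_apply (measurableSet_of_fst _), wordLaw_apply, poissonMeasure_sourceless hT]
  congr 1
  refine poissonMeasure_eq_wordMeasure hT fun ω w h => ?_
  simp only [Set.mem_inter_iff, Set.mem_ofPred_eq, sourcelessWords, h.wordCount_eq]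
  exact and_congr_right fun hc => h.hasCycle_iff hc R

theorem wordMeasure_ae_valid (T : ℝ) : ∀ᵐ w ∂wordMeasure n T, Valid id w := by
  rw [ae_iff, wordMeasure_apply, ENNReal.tsum_eq_zero]
  intro w
  split_ifs with h
  · rw [wordWeight, if_neg h]
  · rfl

theorem wordLaw_ae (T : ℝ) :
    ∀ᵐ w ∂wordLaw n T, Valid id w ∧ Balanced (stdEdges w) := by
  have h2 : ∀ᵐ w ∂wordLaw n T, w ∈ sourcelessWords n := ae_cond_mem .of_discrete
  filter_upwards [cond_absolutelyContinuous.ae_le (wordMeasure_ae_valid T), h2] with w hw hs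
  exact ⟨hw, by rw [balanced_iff_sourceless, hw.edgeCount_stdEdges]; exact hs⟩

theorem wordWeight_flipWord {R : Current n → Prop} (τ : box n → ℝ) (w : Word n)
    (hR : ∀ c, R (fun d => c d.symm) ↔ R c) :
    wordWeight id τ (flipWord R w) = wordWeight id τ w := by
  have : Valid id (flipWord R w) ↔ Valid id w :=
    ⟨fun h => by have := h.flipWord (R := R); rwa [flipWord_involutive hR w] at this,
      fun h => h.flipWord⟩
  simp only [wordWeight, this, flipWord_length]

/-- The weight of a valid word depends only on the lengths of its lists, which reversal keeps, and
reversal respects balance, which for valid words means sourcelessness. -/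
theorem map_flipWord_wordLaw (T : ℝ) {R : Current n → Prop}
    (hR : ∀ c, R (fun d => c d.symm) ↔ R c) :
    (wordLaw n T).map (flipWord R) = wordLaw n T := by
  have key : ∀ A, wordMeasure n T (flipWord R ⁻¹' A) = wordMeasure n T A := by
    intro A
    rw [wordMeasure_apply, wordMeasure_apply,
      ← (flipWord_involutive hR).toPerm.tsum_eq]
    refine tsum_congr fun w => ?_
    simp only [Function.Involutive.coe_toPerm, Set.mem_preimage, flipWord_involutive hR w,
      wordWeight_flipWord _ _ hR]
  have hS : ∀ A, wordMeasure n T (sourcelessWords n ∩ flipWord R ⁻¹' A) =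
      wordMeasure n T (flipWord R ⁻¹' (sourcelessWords n ∩ A)) := by
    intro A
    refine measure_congr ?_
    filter_upwards [wordMeasure_ae_valid T] with w hw
    have : w ∈ sourcelessWords n ↔ flipWord R w ∈ sourcelessWords n := by
      have e : ∀ w, Valid id w → (w ∈ sourcelessWords n ↔ Balanced (stdEdges w)) := fun w hw => by
        rw [balanced_iff_sourceless, hw.edgeCount_stdEdges]; rfl
      rw [e w hw, e _ hw.flipWord]
      refine ⟨balanced_flipWord hw, fun h => ?_⟩
      have := balanced_flipWord (R := R) hw.flipWord h
      rwa [flipWord_involutive hR] at this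
    exact propext (and_congr_left fun _ => this)
  ext A hA
  rw [Measure.map_apply .of_discrete hA, wordLaw_apply, wordLaw_apply, hS, key]

/-- The part of a covariance of odd functionals that does not come from common cycles vanishes. -/
theorem integral_noCommonCycle {T : ℝ} {F G : Current n →+ ℤ} (hF : OddUnderReversal F)
    (hG : OddUnderReversal G) (f g : ℤ → ℝ) (hf : ∀ k, f (-k) = -f k) :
    ∫ w in {w | HasCycle (fun c => F c ≠ 0 ∧ G c ≠ 0) w}ᶜ,
      f (F (wordCount w)) * g (G (wordCount w)) ∂wordLaw n T = 0 := by
  -- Reversed are the cycles that charge `F`. If no cycle charges both functionals, these have `G =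
  -- 0`, so `F` changes its sign, `G` keeps its value, and the integral equals its own negative.
  set R : Current n → Prop := fun c => F c ≠ 0 with hR
  set S : Current n → Prop := fun c => F c ≠ 0 ∧ G c ≠ 0 with hS
  have hR' : ∀ c, R (fun d => c d.symm) ↔ R c := hF.ne_zero_iff
  have hS' : ∀ c, S (fun d => c d.symm) ↔ S c := fun c =>
    and_congr (hF.ne_zero_iff c) (hG.ne_zero_iff c)
  rw [← integral_indicator .of_discrete]
  set u : Word n → ℝ := Set.indicator {w | HasCycle S w}ᶜ
    fun w => f (F (wordCount w)) * g (G (wordCount w)) with hu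
  have h1 : ∫ w, u w ∂wordLaw n T = ∫ w, u (flipWord R w) ∂wordLaw n T := by
    conv_lhs => rw [← map_flipWord_wordLaw T hR']
    rw [integral_map .of_discrete (.of_discrete)]
  have h2 : ∫ w, u (flipWord R w) ∂wordLaw n T = ∫ w, -u w ∂wordLaw n T := by
    refine integral_congr_ae ?_
    filter_upwards [wordLaw_ae T] with w hw
    have hc := hasCycle_flipWord (R := R) hw.1 hw.2 hS'
    by_cases h : HasCycle S w
    · rw [hu, Set.indicator_of_notMem, Set.indicator_of_notMem, neg_zero]
      · simpa using h
      · simpa using hc.2 h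
    · have hno : ∀ z, Pops (stdEdges w) z → ¬ S (edgeCount z) := fun z hz hz' => h ⟨z, hz, hz'⟩
      rw [hu, Set.indicator_of_mem, Set.indicator_of_mem]
      · rw [map_wordCount_flipWord hw.1 hw.2 F (-F), map_wordCount_flipWord hw.1 hw.2 G G]
        · rw [AddMonoidHom.neg_apply, hf, neg_mul]
        · intro z hz
          split_ifs with hRz
          · have : G (edgeCount z) = 0 := by
              by_contra hG0
              exact hno z hz ⟨hRz, hG0⟩
            rw [hG, this, neg_zero]
          · rfl
        · intro z hz
          split_ifs with hRz
          · rw [hF]; rfl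
          · have : F (edgeCount z) = 0 := not_not.1 hRz
            rw [AddMonoidHom.neg_apply, this, neg_zero]
      · exact h
      · exact fun h' => h (hc.1 h')
  rw [integral_neg] at h2
  linarith

end XYHeight

end

noncomputable section

set_option linter.unusedSectionVars false

namespace XYHeight

open scoped Classical

/-! ### Cosines on the circle -/

/-- The cosine of an angle in units of a full turn. -/
def cosC (u : UnitAddCircle) : ℝ := (AddCircle.toCircle u : ℂ).re

/-- The sine of an angle in units of a full turn. -/
def sinC (u : UnitAddCircle) : ℝ := (AddCircle.toCircle u : ℂ).im

theorem cosC_add (u v : UnitAddCircle) : cosC (u + v) = cosC u * cosC v - sinC u * sinC v := by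
  simp [cosC, sinC, AddCircle.toCircle_add]

theorem sinC_add (u v : UnitAddCircle) : sinC (u + v) = cosC u * sinC v + sinC u * cosC v := by
  simp [cosC, sinC, AddCircle.toCircle_add]

@[simp] theorem cosC_neg (u : UnitAddCircle) : cosC (-u) = cosC u := by
  simp [cosC, AddCircle.toCircle_neg]

@[simp] theorem sinC_neg (u : UnitAddCircle) : sinC (-u) = -sinC u := by
  simp [sinC, AddCircle.toCircle_neg]

theorem cosC_sub (u v : UnitAddCircle) : cosC (u - v) = cosC u * cosC v + sinC u * sinC v := by
  rw [sub_eq_add_neg, cosC_add, cosC_neg, sinC_neg]; ring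

@[simp] theorem cosC_zero : cosC 0 = 1 := by simp [cosC]

@[simp] theorem sinC_zero : sinC 0 = 0 := by simp [sinC]

@[fun_prop] theorem continuous_cosC : Continuous cosC :=
  Complex.continuous_re.comp (continuous_subtype_val.comp AddCircle.continuous_toCircle)

@[fun_prop] theorem continuous_sinC : Continuous sinC :=
  Complex.continuous_im.comp (continuous_subtype_val.comp AddCircle.continuous_toCircle)

theorem abs_cosC_le (u : UnitAddCircle) : |cosC u| ≤ 1 :=
  (Complex.abs_re_le_norm _).trans (Circle.norm_coe _).le

theorem cosC_sub_comm (u v : UnitAddCircle) : cosC (u - v) = cosC (v - u) := by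
  rw [← neg_sub, cosC_neg]

/-! ### The torus -/

/-- The torus of angles of the spins indexed by `V`. -/
abbrev Torus (V : Type*) : Type _ := V → UnitAddCircle

/-- The Haar probability measure on the torus. -/
def torusHaar (V : Type*) [Fintype V] : Measure (Torus V) :=
  Measure.pi fun _ => AddCircle.haarAddCircle

variable {V : Type*} [Fintype V]

instance : (torusHaar V).IsAddHaarMeasure := by unfold torusHaar; infer_instance

instance : IsProbabilityMeasure (torusHaar V) := by unfold torusHaar; infer_instance

instance : ((torusHaar V).prod (torusHaar V)).IsAddHaarMeasure :=
  Measure.prod.instIsAddHaarMeasure _ _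

instance : BorelSpace (Torus V × Torus V) := Prod.borelSpace

theorem exists_half (u : UnitAddCircle) : ∃ h : UnitAddCircle, h + h = u := by
  obtain ⟨r, rfl⟩ := QuotientAddGroup.mk_surjective u
  exact ⟨((r / 2 : ℝ) : UnitAddCircle), by
    rw [← AddCircle.coe_add, add_halves]⟩

/-- The homomorphism `(α, δ) ↦ (α - δ, α + δ)`. -/
def rotateHom (V : Type*) : Torus V × Torus V →+ Torus V × Torus V where
  toFun p := (p.1 - p.2, p.1 + p.2)
  map_zero' := by simp
  map_add' p q := by
    refine Prod.ext ?_ ?_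
    · exact add_sub_add_comm _ _ _ _
    · exact add_add_add_comm _ _ _ _

/-- A continuous surjective endomorphism of a compact group preserves Haar measure. Surjectivity
needs half angles; injectivity is not needed. -/
theorem measurePreserving_rotateHom :
    MeasurePreserving (rotateHom V) ((torusHaar V).prod (torusHaar V))
      ((torusHaar V).prod (torusHaar V)) := by
  refine AddMonoidHom.measurePreserving ?_ ?_ rfl
  · exact (continuous_fst.sub continuous_snd).prodMk (continuous_fst.add continuous_snd)
  · rintro ⟨θ, θ'⟩
    choose h hh using fun v => exists_half (θ' v - θ v)
    refine ⟨(θ + h, h), Prod.ext ?_ ?_⟩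
    · simp [rotateHom]
    · funext v
      simp [rotateHom, add_assoc, hh]

/-- The reflection of the spin at `v` through that at `y`. -/
def reflectHom {V : Type*} (y v : V) : Torus V →+ Torus V where
  toFun θ := Function.update θ v (θ y + θ y - θ v)
  map_zero' := by simp
  map_add' p q := by
    ext u
    by_cases h : u = v
    · subst h; simp; abel
    · simp [Function.update_of_ne h]

theorem reflectHom_apply_self (y v : V) (θ : Torus V) :
    reflectHom y v θ v = θ y + θ y - θ v := by simp [reflectHom]

theorem reflectHom_apply_of_ne (y : V) {v u : V} (h : u ≠ v) (θ : Torus V) :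
    reflectHom y v θ u = θ u := by simp [reflectHom, Function.update_of_ne h]

theorem measurePreserving_reflectHom {y v : V} (h : y ≠ v) :
    MeasurePreserving (reflectHom y v) (torusHaar V) (torusHaar V) := by
  refine AddMonoidHom.measurePreserving ?_ (fun θ => ⟨reflectHom y v θ, ?_⟩) rfl
  · exact continuous_id.update v (by fun_prop)
  · funext u
    by_cases hu : u = v
    · subst hu
      rw [reflectHom_apply_self, reflectHom_apply_self, reflectHom_apply_of_ne y h]
      abel
    · rw [reflectHom_apply_of_ne y hu, reflectHom_apply_of_ne y hu]

theorem integrable_of_continuous {X E : Type*} [TopologicalSpace X] [CompactSpace X]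
    [MeasurableSpace X] [OpensMeasurableSpace X] {μ : Measure X} [IsFiniteMeasure μ]
    [NormedAddCommGroup E] [SecondCountableTopology E] {f : X → E} (hf : Continuous f) :
    Integrable f μ := by
  obtain ⟨C, hC⟩ := isCompact_univ.exists_bound_of_continuousOn hf.continuousOn
  exact Integrable.of_bound hf.aestronglyMeasurable C (.of_forall fun x => hC x trivial)

/-- If a class of functions with non-negative integrals is closed under multiplication by `g i`,
then the integrals remain non-negative after multiplication by `exp (∑ i, J i * g i)`, `J ≥ 0`. -/
theorem integral_mul_exp_nonneg {X : Type*} [TopologicalSpace X] [CompactSpace X]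
    [MeasurableSpace X] [OpensMeasurableSpace X] {μ : Measure X} [IsFiniteMeasure μ] {ι : Type*}
    [Fintype ι] (g : ι → X → ℝ) (hg : ∀ i, Continuous (g i)) (J : ι → ℝ) (hJ : ∀ i, 0 ≤ J i)
    (S : Set (X → ℝ)) (hc : ∀ f ∈ S, Continuous f)
    (hmul : ∀ f ∈ S, ∀ i, (fun x => f x * g i x) ∈ S) (hpos : ∀ f ∈ S, 0 ≤ ∫ x, f x ∂μ)
    {f : X → ℝ} (hf : f ∈ S) : 0 ≤ ∫ x, f x * Real.exp (∑ i, J i * g i x) ∂μ := by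
  set H : X → ℝ := fun x => ∑ i, J i * g i x with hH
  have hHc : Continuous H := by fun_prop
  -- Closure of `S` handles the powers of `H`; the exponential series then transfers the sign by
  -- dominated convergence.
  have hpow : ∀ k : ℕ, ∀ f ∈ S, 0 ≤ ∫ x, f x * H x ^ k ∂μ := by
    intro k
    induction k with
    | zero => simpa using hpos
    | succ k ih =>
      intro f hf
      have : ∀ x, f x * H x ^ (k + 1) = ∑ i, J i * ((f x * g i x) * H x ^ k) := by
        intro x
        rw [pow_succ, ← mul_assoc]
        conv_lhs => rw [hH]
        simp only
        rw [Finset.mul_sum]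
        exact Finset.sum_congr rfl fun i _ => by ring
      simp_rw [this]
      have hcf := hc f hf
      rw [integral_finsetSum]
      · refine Finset.sum_nonneg fun i _ => ?_
        rw [integral_const_mul]
        exact mul_nonneg (hJ i) (ih _ (hmul f hf i))
      · intro i _
        have := hg i
        exact integrable_of_continuous (by fun_prop)
  obtain ⟨M, hM⟩ := isCompact_univ.exists_bound_of_continuousOn hHc.continuousOn
  obtain ⟨C, hC⟩ := isCompact_univ.exists_bound_of_continuousOn (hc f hf).continuousOn
  have hcf := hc f hf
  have hsum : Summable fun k : ℕ => C * (M ^ k / k !) :=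
    (Real.summable_pow_div_factorial M).mul_left C
  have h := hasSum_integral_of_dominated_convergence (μ := μ)
    (F := fun (k : ℕ) x => f x * (H x ^ k / k !)) (f := fun x => f x * Real.exp (H x))
    (fun k _ => C * (M ^ k / k !))
    (fun k => Continuous.aestronglyMeasurable (by fun_prop))
    (fun k => .of_forall fun x => by
      rw [norm_mul, norm_div, norm_pow, Real.norm_natCast]
      gcongr
      · exact (norm_nonneg _).trans (hC x trivial)
      · exact hC x trivial
      · exact hM x trivial)
    (.of_forall fun _ => hsum) (integrable_const _)
    (.of_forall fun x => by
      have := NormedSpace.expSeries_div_hasSum_exp (𝔸 := ℝ) (H x)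
      rw [← Real.exp_eq_exp_ℝ] at this
      exact this.mul_left _)
  refine h.nonneg fun k => ?_
  have : ∀ x, f x * (H x ^ k / k !) = (1 / (k ! : ℝ)) * (f x * H x ^ k) := fun x => by ring
  simp_rw [this]
  rw [integral_const_mul]
  exact mul_nonneg (by positivity) (hpow k f hf)

end XYHeight

end

noncomputable section

set_option linter.unusedSectionVars false

namespace XYHeight

open scoped Classical

/-! ### Correlation inequalities of Ginibre -/

variable {V D : Type*} [Fintype V] [Fintype D]

/-- The energy `∑ J_d cos (θ_{s d} - θ_{t d})`. -/
def ham (s t : D → V) (J : D → ℝ) (θ : Torus V) : ℝ :=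
  ∑ d, J d * cosC (θ (s d) - θ (t d))

@[fun_prop] theorem continuous_ham (s t : D → V) (J : D → ℝ) : Continuous (ham s t J) := by
  unfold ham; fun_prop

/-- The partition function. -/
def pf (s t : D → V) (J : D → ℝ) : ℝ := ∫ θ, Real.exp (ham s t J θ) ∂torusHaar V

/-- The unnormalised expectation. -/
def num (s t : D → V) (J : D → ℝ) (f : Torus V → ℝ) : ℝ :=
  ∫ θ, f θ * Real.exp (ham s t J θ) ∂torusHaar V

/-- The two-point function `⟨cos (θ_x - θ_y)⟩`. -/
def corr (s t : D → V) (J : D → ℝ) (x y : V) : ℝ :=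
  num s t J (fun θ => cosC (θ x - θ y)) / pf s t J

variable {s t : D → V} {J K : D → ℝ}

theorem num_one : num s t J (fun _ => 1) = pf s t J := by simp [num, pf]

theorem pf_pos (s t : D → V) (J : D → ℝ) : 0 < pf s t J :=
  integral_exp_pos (integrable_of_continuous (by fun_prop))

/-- Under the rotation to `(a - b, a + b)` the two energies add up to terms `(2J + K) cos cos + K
sin sin`, in which each product has the same function in `a` and in `b`. Functions `F a * F b`
integrate to squares and are closed under multiplication by such products. -/
theorem ginibre (hJ : ∀ d, 0 ≤ J d) (hK : ∀ d, 0 ≤ K d) {f : Torus V × Torus V → ℝ}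
    (hf : Continuous f) {F : Torus V → ℝ} (hF : Continuous F)
    (h : ∀ a b, f (a - b, a + b) = F a * F b) :
    0 ≤ ∫ p, f p * Real.exp (ham s t (J + K) p.1 + ham s t J p.2)
      ∂((torusHaar V).prod (torusHaar V)) := by
  rw [← measurePreserving_rotateHom.map_eq, integral_map
    measurePreserving_rotateHom.measurable.aemeasurable
    (Continuous.aestronglyMeasurable (by fun_prop))]
  have key := integral_mul_exp_nonneg (μ := (torusHaar V).prod (torusHaar V))
    (ι := D ⊕ D)
    (Sum.elim (fun d p => cosC (p.1 (s d) - p.1 (t d)) * cosC (p.2 (s d) - p.2 (t d)))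
      (fun d p => sinC (p.1 (s d) - p.1 (t d)) * sinC (p.2 (s d) - p.2 (t d))))
    (by rintro (d | d) <;> simp only [Sum.elim_inl, Sum.elim_inr] <;> fun_prop)
    (Sum.elim (fun d => 2 * J d + K d) K)
    (by rintro (d | d); exacts [add_nonneg (mul_nonneg zero_le_two (hJ d)) (hK d), hK d])
    {f | ∃ F : Torus V → ℝ, Continuous F ∧ ∀ p, f p = F p.1 * F p.2}
    (by
      rintro f ⟨F, hF, h⟩
      rw [funext h]; fun_prop)
    (by
      rintro f ⟨F, hF, h⟩ (d | d)
      · exact ⟨fun a => F a * cosC (a (s d) - a (t d)), by fun_prop, fun p => by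
          simp only [Sum.elim_inl, h]; ring⟩
      · exact ⟨fun a => F a * sinC (a (s d) - a (t d)), by fun_prop, fun p => by
          simp only [Sum.elim_inr, h]; ring⟩)
    (by
      rintro f ⟨F, hF, h⟩
      simp_rw [h]
      rw [integral_prod_mul F F]
      exact mul_self_nonneg _)
    (f := fun p => F p.1 * F p.2) ⟨F, hF, fun _ => rfl⟩
  refine key.trans_eq (integral_congr_ae (.of_forall fun p => ?_))
  simp only [rotateHom, AddMonoidHom.coe_mk, ZeroHom.coe_mk, h, Fintype.sum_sum_type,
    Sum.elim_inl, Sum.elim_inr, ham, ← Finset.sum_add_distrib, Pi.add_apply, Pi.sub_apply]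
  congr 2
  refine Finset.sum_congr rfl fun d _ => ?_
  rw [show p.1 (s d) - p.2 (s d) - (p.1 (t d) - p.2 (t d))
      = (p.1 (s d) - p.1 (t d)) - (p.2 (s d) - p.2 (t d)) by abel,
    show p.1 (s d) + p.2 (s d) - (p.1 (t d) + p.2 (t d))
      = (p.1 (s d) - p.1 (t d)) + (p.2 (s d) - p.2 (t d)) by abel,
    cosC_sub (p.1 (s d) - p.1 (t d)) (p.2 (s d) - p.2 (t d)), cosC_add]
  ring

theorem cos_sub_cos (a b : Torus V) (x y : V) :
    cosC ((a - b) x - (a - b) y) - cosC ((a + b) x - (a + b) y)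
      = 2 * (sinC (a x - a y) * sinC (b x - b y)) := by
  rw [show (a - b) x - (a - b) y = (a x - a y) - (b x - b y) by simp; abel,
    show (a + b) x - (a + b) y = (a x - a y) + (b x - b y) by simp; abel, cosC_sub, cosC_add]
  ring

theorem integral_prod_mul_exp {f g : Torus V → ℝ} :
    ∫ p : Torus V × Torus V, (f p.1 * g p.2) * Real.exp (ham s t J p.1 + ham s t K p.2)
      ∂((torusHaar V).prod (torusHaar V)) = num s t J f * num s t K g := by
  unfold num
  rw [← integral_prod_mul]
  refine integral_congr_ae (.of_forall fun p => ?_)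
  simp only [Real.exp_add]
  ring

/-- Take two independent copies, with couplings `K` and `J`. The difference of their cosines rotates
to twice a product of sines, and `√2` splits the 2 evenly between the factors. -/
theorem corr_mono (hJ : ∀ d, 0 ≤ J d) (hJK : ∀ d, J d ≤ K d) (x y : V) :
    corr s t J x y ≤ corr s t K x y := by
  have h := ginibre (s := s) (t := t) (J := J) (K := K - J) hJ (fun d => sub_nonneg.2 (hJK d))
    (f := fun p => cosC (p.1 x - p.1 y) - cosC (p.2 x - p.2 y)) (by fun_prop)
    (F := fun a => Real.sqrt 2 * sinC (a x - a y)) (by fun_prop) (fun a b => by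
      rw [cos_sub_cos]
      have := Real.mul_self_sqrt (zero_le_two (α := ℝ))
      linear_combination -(sinC (a x - a y) * sinC (b x - b y)) * this)
  have e := integral_prod_mul_exp (s := s) (t := t) (J := K) (K := J)
    (f := fun a => cosC (a x - a y)) (g := fun _ => 1)
  have e' := integral_prod_mul_exp (s := s) (t := t) (J := K) (K := J)
    (f := fun _ => 1) (g := fun a => cosC (a x - a y))
  simp only [add_sub_cancel] at h
  simp_rw [sub_mul] at h
  simp only [mul_one, one_mul] at e e'
  rw [integral_sub (integrable_of_continuous (by fun_prop))
    (integrable_of_continuous (by fun_prop)), e, e', num_one, num_one] at h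
  unfold corr
  rw [div_le_div_iff₀ (pf_pos _ _ _) (pf_pos _ _ _)]
  linarith

/-- With equal couplings in both copies, the product of two differences of cosines integrates to
twice the unnormalised covariance, and it rotates to a product `F a * F b`. -/
theorem num_mul_num_le (hJ : ∀ d, 0 ≤ J d) (x y z w : V) :
    num s t J (fun θ => cosC (θ x - θ y)) * num s t J (fun θ => cosC (θ z - θ w)) ≤
      num s t J (fun θ => cosC (θ x - θ y) * cosC (θ z - θ w)) * pf s t J := by
  have h := ginibre (s := s) (t := t) (J := J) (K := 0) hJ (fun d => le_rfl)
    (f := fun p => (cosC (p.1 x - p.1 y) - cosC (p.2 x - p.2 y))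
      * (cosC (p.1 z - p.1 w) - cosC (p.2 z - p.2 w))) (by fun_prop)
    (F := fun a => 2 * (sinC (a x - a y) * sinC (a z - a w))) (by fun_prop) (fun a b => by
      rw [cos_sub_cos, cos_sub_cos]
      ring)
  have e := integral_prod_mul_exp (s := s) (t := t) (J := J) (K := J)
    (f := fun a => cosC (a x - a y) * cosC (a z - a w)) (g := fun _ => 1)
  have e' := integral_prod_mul_exp (s := s) (t := t) (J := J) (K := J)
    (f := fun _ => 1) (g := fun a => cosC (a x - a y) * cosC (a z - a w))
  have e2 := integral_prod_mul_exp (s := s) (t := t) (J := J) (K := J)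
    (f := fun a => cosC (a x - a y)) (g := fun a => cosC (a z - a w))
  have e2' := integral_prod_mul_exp (s := s) (t := t) (J := J) (K := J)
    (f := fun a => cosC (a z - a w)) (g := fun a => cosC (a x - a y))
  simp only [mul_one, one_mul, num_one] at e e' e2 e2'
  have split : ∀ p : Torus V × Torus V, (cosC (p.1 x - p.1 y) - cosC (p.2 x - p.2 y))
      * (cosC (p.1 z - p.1 w) - cosC (p.2 z - p.2 w)) * Real.exp (ham s t J p.1 + ham s t J p.2)
      = (cosC (p.1 x - p.1 y) * cosC (p.1 z - p.1 w)
          * Real.exp (ham s t J p.1 + ham s t J p.2)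
        + cosC (p.2 x - p.2 y) * cosC (p.2 z - p.2 w)
          * Real.exp (ham s t J p.1 + ham s t J p.2))
        - (cosC (p.1 x - p.1 y) * cosC (p.2 z - p.2 w)
          * Real.exp (ham s t J p.1 + ham s t J p.2)
        + cosC (p.1 z - p.1 w) * cosC (p.2 x - p.2 y)
          * Real.exp (ham s t J p.1 + ham s t J p.2)) := fun p => by ring
  simp only [add_zero, split] at h
  rw [integral_sub (integrable_of_continuous (by fun_prop))
    (integrable_of_continuous (by fun_prop)), integral_add
    (integrable_of_continuous (by fun_prop)) (integrable_of_continuous (by fun_prop)), integral_add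
    (integrable_of_continuous (by fun_prop)) (integrable_of_continuous (by fun_prop)),
    e, e', e2, e2'] at h
  linarith

/-! ### Products of sines and cosines -/

theorem prod_pow_add_single {a : V → ℝ} (j : V → ℕ) (v : V) :
    ∏ u, a u ^ (j + Pi.single v 1 : V → ℕ) u = (∏ u, a u ^ j u) * a v := by
  simp only [Pi.add_apply, pow_add, Finset.prod_mul_distrib]
  congr 1
  rw [Finset.prod_eq_single v]
  · simp
  · intro u _ hu; simp [hu]
  · simp

theorem cosC_add_half {h : UnitAddCircle} (hh : cosC h = -1) (hs : sinC h = 0)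
    (u : UnitAddCircle) : cosC (u + h) = -cosC u := by rw [cosC_add, hh, hs]; ring

theorem sinC_add_half {h : UnitAddCircle} (hh : cosC h = -1) (hs : sinC h = 0)
    (u : UnitAddCircle) : sinC (u + h) = -sinC u := by rw [sinC_add, hh, hs]; ring

theorem exists_half_turn : ∃ h : UnitAddCircle, cosC h = -1 ∧ sinC h = 0 := by
  refine ⟨((1 / 2 : ℝ) : UnitAddCircle), ?_, ?_⟩ <;>
  · simp only [cosC, sinC, AddCircle.toCircle_apply_mk, Circle.coe_exp]
    rw [show (((2 * Real.pi / 1 * (1 / 2) : ℝ) : ℂ)) * Complex.I = Real.pi * Complex.I by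
      push_cast; ring]
    simp [Complex.exp_pi_mul_I]

/-- If a sine has an odd exponent, reflecting that spin through the one at `y` changes the sign. If
all sines are even and a cosine away from `y` is odd, a half turn of that spin does. Otherwise the
integrand is non-negative. -/
theorem integral_cos_sin_nonneg (y : V) (j k : V → ℕ) :
    0 ≤ ∫ θ, ((∏ v, cosC (θ v - θ y) ^ j v) * ∏ v, sinC (θ v - θ y) ^ k v) ∂torusHaar V := by
  set f : Torus V → ℝ :=
    fun θ => (∏ v, cosC (θ v - θ y) ^ j v) * ∏ v, sinC (θ v - θ y) ^ k v with hf
  have hfc : Continuous f := by fun_prop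
  by_cases hy : k y = 0
  swap
  · have : ∀ θ, f θ = 0 := fun θ =>
      mul_eq_zero_of_right _ (Finset.prod_eq_zero (Finset.mem_univ y) (by simp [hy]))
    exact integral_nonneg fun θ => (this θ).ge
  by_cases hk : ∃ v, Odd (k v)
  · obtain ⟨v, hv⟩ := hk
    have hvy : y ≠ v := by rintro rfl; simp [hy] at hv
    have h1 : ∀ θ, f (reflectHom y v θ) = -f θ := by
      intro θ
      have hs : ∀ u, reflectHom y v θ u - reflectHom y v θ y
          = if u = v then -(θ u - θ y) else θ u - θ y := by
        intro u
        split_ifs with h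
        · subst h
          rw [reflectHom_apply_self, reflectHom_apply_of_ne y hvy]; abel
        · rw [reflectHom_apply_of_ne y h, reflectHom_apply_of_ne y hvy]
      simp only [hf, hs]
      rw [← mul_neg]
      congr 1
      · refine Finset.prod_congr rfl fun u _ => ?_
        split_ifs
        · rw [cosC_neg]
        · rfl
      · rw [← Finset.mul_prod_erase _ _ (Finset.mem_univ v),
          ← Finset.mul_prod_erase _ _ (Finset.mem_univ v), ← neg_mul]
        congr 1
        · rw [if_pos rfl, sinC_neg, hv.neg_pow]
        · refine Finset.prod_congr rfl fun u hu => ?_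
          simp [Finset.ne_of_mem_erase hu]
    have h2 : ∫ θ, f θ ∂torusHaar V = ∫ θ, f (reflectHom y v θ) ∂torusHaar V := by
      conv_lhs => rw [← (measurePreserving_reflectHom hvy).map_eq]
      exact integral_map (measurePreserving_reflectHom hvy).measurable.aemeasurable
        hfc.aestronglyMeasurable
    simp_rw [h1, integral_neg] at h2
    linarith
  by_cases hj : ∃ v, v ≠ y ∧ Odd (j v)
  · obtain ⟨v, hvy, hv⟩ := hj
    obtain ⟨h, hc, hs⟩ := exists_half_turn
    have h1 : ∀ θ, f (θ + Pi.single v h) = -f θ := by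
      intro θ
      have hs' : ∀ u, (θ + Pi.single v h : Torus V) u - (θ + Pi.single v h : Torus V) y
          = if u = v then θ u - θ y + h else θ u - θ y := by
        intro u
        split_ifs with h
        · subst h; simp [hvy.symm]; abel
        · simp [h, hvy.symm]
      simp only [hf, hs']
      rw [← neg_mul]
      congr 1
      · rw [← Finset.mul_prod_erase _ _ (Finset.mem_univ v),
          ← Finset.mul_prod_erase _ _ (Finset.mem_univ v), ← neg_mul]
        congr 1
        · simp [cosC_add_half hc hs, hv.neg_pow]
        · refine Finset.prod_congr rfl fun u hu => ?_
          simp [Finset.ne_of_mem_erase hu]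
      · refine Finset.prod_congr rfl fun u _ => ?_
        have : Even (k u) := by simpa using fun h => hk ⟨u, h⟩
        split_ifs
        · rw [sinC_add_half hc hs, this.neg_pow]
        · rfl
    have h2 : ∫ θ, f θ ∂torusHaar V = ∫ θ, f (θ + Pi.single v h) ∂torusHaar V :=
      (integral_add_right_eq_self f _).symm
    simp_rw [h1, integral_neg] at h2
    linarith
  refine integral_nonneg fun θ => mul_nonneg (Finset.prod_nonneg fun v _ => ?_)
    (Finset.prod_nonneg fun v _ => ?_)
  · by_cases hv : v = y
    · simp [hv]
    · have : Even (j v) := by simpa using fun h => hj ⟨v, hv, h⟩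
      exact this.pow_nonneg _
  · have : Even (k v) := by simpa using fun h => hk ⟨v, h⟩
    exact this.pow_nonneg _

/-- In angles relative to `y`, the energy is a non-negative combination of products of two cosines
and products of two sines, so monomials are closed under multiplication by its terms. -/
theorem num_cos_sin_nonneg (hJ : ∀ d, 0 ≤ J d) (y : V) (j k : V → ℕ) :
    0 ≤ num s t J
      (fun θ => (∏ v, cosC (θ v - θ y) ^ j v) * ∏ v, sinC (θ v - θ y) ^ k v) := by
  have key := integral_mul_exp_nonneg (μ := torusHaar V) (ι := D ⊕ D)
    (Sum.elim (fun d θ => cosC (θ (s d) - θ y) * cosC (θ (t d) - θ y))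
      (fun d θ => sinC (θ (s d) - θ y) * sinC (θ (t d) - θ y)))
    (by rintro (d | d) <;> simp only [Sum.elim_inl, Sum.elim_inr] <;> fun_prop)
    (Sum.elim J J) (by rintro (d | d); exacts [hJ d, hJ d])
    {f | ∃ j k : V → ℕ, ∀ θ, f θ = (∏ v, cosC (θ v - θ y) ^ j v) * ∏ v, sinC (θ v - θ y) ^ k v}
    (by
      rintro f ⟨j, k, h⟩
      rw [funext h]; fun_prop)
    (by
      rintro f ⟨j, k, h⟩ (d | d)
      · refine ⟨j + Pi.single (s d) 1 + Pi.single (t d) 1, k, fun θ => ?_⟩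
        simp only [h, prod_pow_add_single, Sum.elim_inl]; ring
      · refine ⟨j, k + Pi.single (s d) 1 + Pi.single (t d) 1, fun θ => ?_⟩
        simp only [h, prod_pow_add_single, Sum.elim_inr]; ring)
    (by
      rintro f ⟨j, k, h⟩
      simp_rw [h]
      exact integral_cos_sin_nonneg y j k)
    (f := fun θ => (∏ v, cosC (θ v - θ y) ^ j v) * ∏ v, sinC (θ v - θ y) ^ k v)
    ⟨j, k, fun _ => rfl⟩
  refine key.trans_eq (integral_congr_ae (.of_forall fun θ => ?_))
  simp only [Fintype.sum_sum_type, Sum.elim_inl, Sum.elim_inr, ham, ← Finset.sum_add_distrib]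
  congr 2
  refine Finset.sum_congr rfl fun d _ => ?_
  rw [show θ (s d) - θ (t d) = (θ (s d) - θ y) - (θ (t d) - θ y) by abel,
    cosC_sub (θ (s d) - θ y)]
  ring

theorem num_sin_sin_nonneg (hJ : ∀ d, 0 ≤ J d) (x y z : V) :
    0 ≤ num s t J (fun θ => sinC (θ x - θ y) * sinC (θ z - θ y)) := by
  have h := num_cos_sin_nonneg (s := s) (t := t) hJ y 0 (0 + Pi.single x 1 + Pi.single z 1)
  simp only [prod_pow_add_single] at h
  simpa using h

/-- The addition formula splits the cosine of `x - z` into a product of cosines, which is positively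
correlated, and a product of sines relative to `y`, whose expectation is non-negative. -/
theorem corr_mul_corr_le (hJ : ∀ d, 0 ≤ J d) (x y z : V) :
    corr s t J x y * corr s t J y z ≤ corr s t J x z := by
  have h1 := num_mul_num_le (s := s) (t := t) hJ x y y z
  have h2 := num_sin_sin_nonneg (s := s) (t := t) hJ x y z
  have h3 : num s t J (fun θ => cosC (θ x - θ z))
      = num s t J (fun θ => cosC (θ x - θ y) * cosC (θ y - θ z))
        + num s t J (fun θ => sinC (θ x - θ y) * sinC (θ z - θ y)) := by
    unfold num
    rw [← integral_add (integrable_of_continuous (by fun_prop))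
      (integrable_of_continuous (by fun_prop))]
    refine integral_congr_ae (.of_forall fun θ => ?_)
    simp only
    rw [show θ x - θ z = (θ x - θ y) - (θ z - θ y) by abel, cosC_sub, cosC_sub_comm (θ z) (θ y)]
    ring
  have hp := pf_pos s t J
  unfold corr
  rw [div_mul_div_comm, div_le_div_iff₀ (mul_pos hp hp) hp, h3]
  nlinarith

theorem corr_nonneg (hJ : ∀ d, 0 ≤ J d) (x y : V) : 0 ≤ corr s t J x y := by
  have h := num_cos_sin_nonneg (s := s) (t := t) hJ y (0 + Pi.single x 1) 0
  simp only [prod_pow_add_single] at h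
  exact div_nonneg (by simpa using h) (pf_pos _ _ _).le

theorem corr_le_one (x y : V) : corr s t J x y ≤ 1 := by
  unfold corr
  rw [div_le_one (pf_pos _ _ _)]
  refine integral_mono (integrable_of_continuous (by fun_prop))
    (integrable_of_continuous (by fun_prop)) fun θ => ?_
  exact mul_le_of_le_one_left (Real.exp_pos _).le ((abs_le.1 (abs_cosC_le _)).2)

theorem corr_comm (x y : V) : corr s t J x y = corr s t J y x := by
  unfold corr num; simp_rw [cosC_sub_comm (_ : UnitAddCircle) _]

theorem corr_self (x : V) : corr s t J x x = 1 := by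
  unfold corr
  simp only [sub_self, cosC_zero, num_one]
  exact div_self (pf_pos _ _ _).ne'

end XYHeight

end

noncomputable section

set_option linter.unusedSectionVars false

namespace XYHeight

open scoped Classical

/-! ### Embeddings of models -/

section Embedding

variable {V V' D D' : Type*} [Fintype V] [Fintype V'] [Fintype D] [Fintype D']

/-- The restriction of a spin configuration along `ι`. -/
def restrictHom (ι : V → V') : Torus V' →+ Torus V where
  toFun θ := θ ∘ ι
  map_zero' := rfl
  map_add' _ _ := rfl

theorem measurePreserving_restrictHom {ι : V → V'} (hι : Function.Injective ι) :
    MeasurePreserving (restrictHom ι) (torusHaar V') (torusHaar V) := by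
  refine AddMonoidHom.measurePreserving ?_ (fun θ => ⟨Function.extend ι θ 0, ?_⟩) (by simp)
  · exact continuous_pi fun v => continuous_apply (ι v)
  · funext v
    simp [restrictHom, hι.extend_apply]

theorem integral_restrictHom {ι : V → V'} (hι : Function.Injective ι) {f : Torus V → ℝ}
    (hf : Continuous f) : ∫ θ, f (θ ∘ ι) ∂torusHaar V' = ∫ θ, f θ ∂torusHaar V := by
  conv_rhs => rw [← (measurePreserving_restrictHom hι).map_eq]
  exact (integral_map (measurePreserving_restrictHom hι).measurable.aemeasurable
    hf.aestronglyMeasurable).symm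

/-- Pushing `J` forward along `j` leaves the spins outside the image of `ι` uncoupled, so they
integrate out; the remaining couplings are added by monotonicity. -/
theorem corr_le_corr_of_embedding {s t : D → V} {s' t' : D' → V'} {J : D → ℝ} {J' : D' → ℝ}
    {ι : V → V'} (hι : Function.Injective ι) {j : D → D'} (hs : ∀ d, s' (j d) = ι (s d))
    (ht : ∀ d, t' (j d) = ι (t d)) (hJ : ∀ d, 0 ≤ J d)
    (hJ' : ∀ d', ∑ d with j d = d', J d ≤ J' d') (x y : V) :
    corr s t J x y ≤ corr s' t' J' (ι x) (ι y) := by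
  refine le_trans (Eq.le ?_)
    (corr_mono (s := s') (t := t') (fun d' => Finset.sum_nonneg fun d _ => hJ d) hJ' _ _)
  have hH : ∀ θ : Torus V', ham s' t' (fun d' => ∑ d with j d = d', J d) θ
      = ham s t J (θ ∘ ι) := by
    intro θ
    unfold ham
    rw [← Finset.sum_fiberwise (s := Finset.univ) (g := j)]
    refine Finset.sum_congr rfl fun d' _ => ?_
    rw [Finset.sum_mul]
    refine Finset.sum_congr rfl fun d hd => ?_
    obtain rfl := (Finset.mem_filter.1 hd).2
    simp [hs, ht]
  unfold corr num pf
  simp_rw [hH]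
  rw [← integral_restrictHom hι (f := fun θ => cosC (θ x - θ y) * Real.exp (ham s t J θ))
    (by fun_prop), ← integral_restrictHom hι (f := fun θ => Real.exp (ham s t J θ)) (by fun_prop)]
  rfl

theorem integral_cosC_sub {x y : V} (hxy : x ≠ y) :
    ∫ θ, cosC (θ x - θ y) ∂torusHaar V = 0 := by
  obtain ⟨h, hc, hs⟩ := exists_half_turn
  have h2 : ∫ θ, cosC (θ x - θ y) ∂torusHaar V
      = ∫ θ, cosC ((θ + Pi.single x h : Torus V) x - (θ + Pi.single x h : Torus V) y)
        ∂torusHaar V :=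
    (integral_add_right_eq_self (fun θ : Torus V => cosC (θ x - θ y)) _).symm
  have h3 : ∀ θ : Torus V, cosC ((θ + Pi.single x h : Torus V) x
      - (θ + Pi.single x h : Torus V) y) = -cosC (θ x - θ y) := by
    intro θ
    rw [← cosC_add_half hc hs]
    congr 1
    simp [hxy.symm]; abel
  simp_rw [h3, integral_neg] at h2
  linarith

theorem corr_zero {s t : D → V} {x y : V} (hxy : x ≠ y) : corr s t 0 x y = 0 := by
  simp [corr, num, ham, integral_cosC_sub hxy]

/-- Monotonicity reduces to a single bond. There, subtracting the vanishing integral of the cosine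
`c` leaves `c * (exp (J * c) - 1)`, which is non-negative. -/
theorem corr_pos {s t : D → V} {J : D → ℝ} (hJ : ∀ d, 0 ≤ J d) {d₀ : D} (hd : 0 < J d₀)
    (hst : s d₀ ≠ t d₀) : 0 < corr s t J (s d₀) (t d₀) := by
  refine lt_of_lt_of_le ?_ (corr_mono (J := Pi.single d₀ (J d₀)) (K := J) (fun d => ?_)
    (fun d => ?_) _ _)
  rotate_left
  · by_cases h : d = d₀
    · subst h; simpa using hJ d
    · simp [h]
  · by_cases h : d = d₀
    · subst h; simp
    · simpa [h] using hJ d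
  refine div_pos ?_ (pf_pos _ _ _)
  have hH : ∀ θ, ham s t (Pi.single d₀ (J d₀)) θ = J d₀ * cosC (θ (s d₀) - θ (t d₀)) := by
    intro θ
    unfold ham
    rw [Finset.sum_eq_single d₀]
    · simp
    · intro d _ h; simp [h]
    · simp
  unfold num
  simp_rw [hH]
  set c : Torus V → ℝ := fun θ => cosC (θ (s d₀) - θ (t d₀)) with hc
  have hcc : Continuous c := by fun_prop
  have h1 : 0 < ∫ θ, c θ * (Real.exp (J d₀ * c θ) - 1) ∂torusHaar V := by
    refine Continuous.integral_pos_of_hasCompactSupport_nonneg_nonzero (x := 0) (by fun_prop)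
      (HasCompactSupport.of_compactSpace _) (fun θ => ?_) ?_
    · rcases le_total 0 (c θ) with h | h
      · exact mul_nonneg h (sub_nonneg.2 (Real.one_le_exp (by positivity)))
      · exact mul_nonneg_of_nonpos_of_nonpos h
          (sub_nonpos.2 (Real.exp_le_one_iff.2 (mul_nonpos_of_nonneg_of_nonpos hd.le h)))
    · simp [hc, hd.ne', sub_eq_zero]
  have h2 : ∫ θ, c θ * (Real.exp (J d₀ * c θ) - 1) ∂torusHaar V
      = ∫ θ, c θ * Real.exp (J d₀ * c θ) ∂torusHaar V := by
    simp_rw [mul_sub, mul_one]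
    rw [integral_sub (integrable_of_continuous (by fun_prop))
      (integrable_of_continuous (by fun_prop)), integral_cosC_sub hst, sub_zero]
  exact h2 ▸ h1

end Embedding

/-! ### The two-point function of the XY model -/

/-- The two-point function in a box, in the notation of general models. -/
abbrev boxCorr (n : ℕ) (β : ℝ) (x y : box n) : ℝ :=
  corr (fun d : DirEdge n => d.fst) (fun d => d.snd) (fun _ => β / 2) x y

theorem spins_mul_conj {n : ℕ} (θ : box n → UnitAddCircle) (x y : box n) :
    spins θ x * (starRingEnd ℂ) (spins θ y)
      = (cosC (θ x - θ y) : ℂ) + (sinC (θ x - θ y) : ℂ) * Complex.I := by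
  unfold spins cosC sinC
  rw [Complex.re_add_im, sub_eq_add_neg, AddCircle.toCircle_add, AddCircle.toCircle_neg,
    Circle.coe_mul, Circle.coe_inv_eq_conj]

/-- The imaginary parts of the two orientations of an edge cancel. -/
theorem sum_mul_spins_eq_ham {n : ℕ} {J : DirEdge n → ℝ} (hJ : ∀ d, J d.symm = J d)
    (θ : box n → UnitAddCircle) :
    ∑ d : DirEdge n, (J d : ℂ) * (spins θ d.fst * (starRingEnd ℂ) (spins θ d.snd))
      = (ham (fun d : DirEdge n => d.fst) (fun d => d.snd) J θ : ℂ) := by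
  have h : ∑ d : DirEdge n, J d * sinC (θ d.fst - θ d.snd) = 0 := by
    have h : ∑ d : DirEdge n, J d * sinC (θ d.fst - θ d.snd)
        = ∑ d : DirEdge n, J d.symm * sinC (θ d.symm.fst - θ d.symm.snd) :=
      (Equiv.sum_comp (Function.Involutive.toPerm _ SimpleGraph.Dart.symm_involutive)
        fun d : DirEdge n => J d * sinC (θ d.fst - θ d.snd)).symm
    have h' : ∀ d : DirEdge n, J d.symm * sinC (θ d.symm.fst - θ d.symm.snd)
        = -(J d * sinC (θ d.fst - θ d.snd)) := by
      intro d
      rw [hJ, ← mul_neg, ← sinC_neg, neg_sub]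
      rfl
    simp_rw [h', Finset.sum_neg_distrib] at h
    linarith
  have h' : ∑ d : DirEdge n, (J d : ℂ) * ((sinC (θ d.fst - θ d.snd) : ℂ) * Complex.I) = 0 := by
    simp_rw [← mul_assoc]
    rw [← Finset.sum_mul]
    exact mul_eq_zero_of_left (by exact_mod_cast h) _
  unfold ham
  simp_rw [spins_mul_conj, mul_add, Finset.sum_add_distrib]
  rw [h', add_zero]
  push_cast
  rfl

theorem xyExponent_eq {n : ℕ} (β : ℝ) (θ : box n → UnitAddCircle) :
    xyExponent n β (spins θ)
      = (ham (fun d : DirEdge n => d.fst) (fun d => d.snd) (fun _ => β / 2) θ : ℂ) := by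
  rw [← sum_mul_spins_eq_ham (fun _ => rfl)]
  simp [xyExponent]

theorem twoPoint_eq_boxCorr {n : ℕ} (β : ℝ) (x y : box n) :
    twoPoint n β x.1 y.1 = boxCorr n β x y := by
  have hp : xyPartition n β
      = (pf (fun d : DirEdge n => d.fst) (fun d => d.snd) (fun _ => β / 2) : ℂ) := by
    unfold xyPartition pf
    rw [← integral_complex_ofReal]
    simp_rw [xyExponent_eq, Complex.ofReal_exp]
    rfl
  unfold twoPoint
  rw [dif_pos ⟨x.2, y.2⟩]
  unfold xyExpect boxCorr corr
  rw [hp, Complex.div_ofReal_re]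
  congr 1
  have hint : Integrable (fun θ => spins θ x * (starRingEnd ℂ) (spins θ y)
      * Complex.exp (xyExponent n β (spins θ))) (torusHaar (box n)) := by
    simp_rw [spins_mul_conj, xyExponent_eq]
    exact integrable_of_continuous (by fun_prop)
  have hre := Complex.reCLM.integral_comp_comm hint
  simp only [Complex.reCLM_apply] at hre
  refine hre.symm.trans (integral_congr_ae (.of_forall fun θ => ?_))
  simp only [spins_mul_conj, xyExponent_eq, ← Complex.ofReal_exp]
  simp [Complex.add_re, Complex.mul_re, Complex.exp_ofReal_re]

theorem twoPoint_of_not_mem {n : ℕ} {β : ℝ} {x y : ℤ × ℤ} (h : ¬(x ∈ box n ∧ y ∈ box n)) :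
    twoPoint n β x y = 0 := by
  rw [twoPoint, dif_neg h]

theorem twoPoint_nonneg {β : ℝ} (hβ : 0 ≤ β) (n : ℕ) (x y : ℤ × ℤ) : 0 ≤ twoPoint n β x y := by
  by_cases h : x ∈ box n ∧ y ∈ box n
  · rw [twoPoint_eq_boxCorr β ⟨x, h.1⟩ ⟨y, h.2⟩]
    exact corr_nonneg (fun _ => by positivity) _ _
  · rw [twoPoint_of_not_mem h]

theorem twoPoint_le_one (β : ℝ) (n : ℕ) (x y : ℤ × ℤ) : twoPoint n β x y ≤ 1 := by
  by_cases h : x ∈ box n ∧ y ∈ box n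
  · rw [twoPoint_eq_boxCorr β ⟨x, h.1⟩ ⟨y, h.2⟩]
    exact corr_le_one _ _
  · rw [twoPoint_of_not_mem h]
    exact zero_le_one

theorem twoPoint_mul_le {β : ℝ} (hβ : 0 ≤ β) (n : ℕ) (x y z : ℤ × ℤ) :
    twoPoint n β x y * twoPoint n β y z ≤ twoPoint n β x z := by
  by_cases h : x ∈ box n ∧ y ∈ box n
  · by_cases h' : z ∈ box n
    · rw [twoPoint_eq_boxCorr β ⟨x, h.1⟩ ⟨y, h.2⟩, twoPoint_eq_boxCorr β ⟨y, h.2⟩ ⟨z, h'⟩,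
        twoPoint_eq_boxCorr β ⟨x, h.1⟩ ⟨z, h'⟩]
      exact corr_mul_corr_le (fun _ => by positivity) _ _ _
    · rw [twoPoint_of_not_mem fun h => h' h.2, mul_zero]
      exact twoPoint_nonneg hβ _ _ _
  · rw [twoPoint_of_not_mem h, zero_mul]
    exact twoPoint_nonneg hβ _ _ _

/-! ### Monotonicity in the box and symmetries of the plane. -/

/-- Maps that preserve Euclidean distances. -/
def IsDistPreserving (ι : ℤ × ℤ → ℤ × ℤ) : Prop :=
  ∀ x y, ((ι y).1 - (ι x).1) ^ 2 + ((ι y).2 - (ι x).2) ^ 2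
    = (y.1 - x.1) ^ 2 + (y.2 - x.2) ^ 2

theorem IsDistPreserving.injective {ι : ℤ × ℤ → ℤ × ℤ} (h : IsDistPreserving ι) :
    Function.Injective ι := by
  intro x y hxy
  have := h x y
  rw [hxy] at this
  have h1 : y.1 - x.1 = 0 := by nlinarith [sq_nonneg (y.1 - x.1), sq_nonneg (y.2 - x.2)]
  have h2 : y.2 - x.2 = 0 := by nlinarith [sq_nonneg (y.1 - x.1), sq_nonneg (y.2 - x.2)]
  exact Prod.ext (by omega) (by omega)

/-- Adjacency is defined by distance, so such a map embeds one box graph into the other. This covers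
enlarging the box, translations and the exchange of the axes. -/
theorem IsDistPreserving.twoPoint_le {ι : ℤ × ℤ → ℤ × ℤ} (h : IsDistPreserving ι) {β : ℝ}
    (hβ : 0 ≤ β) {n n' : ℕ} (hn : ∀ x ∈ box n, ι x ∈ box n') (x y : ℤ × ℤ) :
    twoPoint n β x y ≤ twoPoint n' β (ι x) (ι y) := by
  by_cases hxy : x ∈ box n ∧ y ∈ box n
  swap
  · rw [twoPoint_of_not_mem hxy]; exact twoPoint_nonneg hβ _ _ _
  let i : box n → box n' := fun x => ⟨ι x.1, hn _ x.2⟩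
  have hi : Function.Injective i := fun a b hab =>
    Subtype.ext (h.injective (congrArg Subtype.val hab))
  let j : DirEdge n → DirEdge n' := fun d => ⟨(i d.fst, i d.snd), (h _ _).trans d.adj⟩
  have hj : Function.Injective j := fun a b hab => by
    refine SimpleGraph.Dart.ext _ _ (Prod.ext (hi ?_) (hi ?_))
    · exact congrArg (fun d => d.toProd.1) hab
    · exact congrArg (fun d => d.toProd.2) hab
  rw [twoPoint_eq_boxCorr β ⟨x, hxy.1⟩ ⟨y, hxy.2⟩,
    twoPoint_eq_boxCorr β (i ⟨x, hxy.1⟩) (i ⟨y, hxy.2⟩)]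
  refine corr_le_corr_of_embedding hi (j := j) (fun _ => rfl) (fun _ => rfl)
    (fun _ => by positivity) (fun d' => ?_) _ _
  rw [Finset.sum_const, nsmul_eq_mul]
  refine mul_le_of_le_one_left (by positivity) ?_
  norm_cast
  rw [Finset.card_le_one]
  intro a ha b hb
  simp only [Finset.mem_filter, Finset.mem_univ, true_and] at ha hb
  exact hj (ha.trans hb.symm)

theorem twoPoint_mono {β : ℝ} (hβ : 0 ≤ β) (x y : ℤ × ℤ) :
    Monotone fun n => twoPoint n β x y := fun n n' hn =>
  IsDistPreserving.twoPoint_le (ι := id) (fun _ _ => rfl) hβ (fun x hx => by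
    rw [mem_box] at hx ⊢; simp only [id]; omega) x y

theorem tendsto_twoPoint {β : ℝ} (hβ : 0 ≤ β) (x y : ℤ × ℤ) :
    Tendsto (fun n : ℕ => twoPoint n β x y) atTop (𝓝 (twoPointInf β x y)) :=
  tendsto_nhds_limUnder ⟨_, tendsto_atTop_ciSup (twoPoint_mono hβ x y)
    ⟨1, by rintro _ ⟨n, rfl⟩; exact twoPoint_le_one β n x y⟩⟩

theorem twoPoint_le_twoPointInf {β : ℝ} (hβ : 0 ≤ β) (n : ℕ) (x y : ℤ × ℤ) :
    twoPoint n β x y ≤ twoPointInf β x y :=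
  (twoPoint_mono hβ x y).ge_of_tendsto (tendsto_twoPoint hβ x y) n

theorem twoPointInf_le_one {β : ℝ} (hβ : 0 ≤ β) (x y : ℤ × ℤ) : twoPointInf β x y ≤ 1 :=
  le_of_tendsto' (tendsto_twoPoint hβ x y) fun n => twoPoint_le_one β n x y

theorem twoPointInf_mul_le {β : ℝ} (hβ : 0 ≤ β) (x y z : ℤ × ℤ) :
    twoPointInf β x y * twoPointInf β y z ≤ twoPointInf β x z :=
  le_of_tendsto_of_tendsto' ((tendsto_twoPoint hβ x y).mul (tendsto_twoPoint hβ y z))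
    (tendsto_twoPoint hβ x z) fun n => twoPoint_mul_le hβ n x y z

theorem IsDistPreserving.twoPointInf_le {ι : ℤ × ℤ → ℤ × ℤ} (h : IsDistPreserving ι) {β : ℝ}
    (hβ : 0 ≤ β) (hι : ∀ n, ∃ n', ∀ x ∈ box n, ι x ∈ box n') (x y : ℤ × ℤ) :
    twoPointInf β x y ≤ twoPointInf β (ι x) (ι y) :=
  le_of_tendsto' (tendsto_twoPoint hβ x y) fun n => by
    obtain ⟨n', hn'⟩ := hι n
    exact (h.twoPoint_le hβ hn' x y).trans (twoPoint_le_twoPointInf hβ _ _ _)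

/-- A translation merely embeds a box into a larger one. Equality appears in the limit, from the
inequality for the translation and for its inverse. -/
theorem twoPointInf_add {β : ℝ} (hβ : 0 ≤ β) (x y a : ℤ × ℤ) :
    twoPointInf β (x + a) (y + a) = twoPointInf β x y := by
  have h : ∀ x y a : ℤ × ℤ, twoPointInf β x y ≤ twoPointInf β (x + a) (y + a) := fun x y a =>
    IsDistPreserving.twoPointInf_le (ι := (· + a)) (fun x y => by simp) hβ
      (fun n => ⟨n + a.1.natAbs + a.2.natAbs, fun x hx => by
        rw [mem_box] at hx ⊢
        simp only [Prod.fst_add, Prod.snd_add]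
        omega⟩) x y
  refine le_antisymm ?_ (h x y a)
  simpa using h (x + a) (y + a) (-a)

theorem twoPointInf_swap {β : ℝ} (hβ : 0 ≤ β) (x y : ℤ × ℤ) :
    twoPointInf β x.swap y.swap = twoPointInf β x y := by
  have h : ∀ x y : ℤ × ℤ, twoPointInf β x y ≤ twoPointInf β x.swap y.swap := fun x y =>
    IsDistPreserving.twoPointInf_le (ι := Prod.swap) (fun x y => by
        simp only [Prod.fst_swap, Prod.snd_swap]; ring) hβ
      (fun n => ⟨n, fun x hx => by
        rw [mem_box] at hx ⊢
        exact hx.symm⟩) x y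
  refine le_antisymm ?_ (h x y)
  simpa using h x.swap y.swap

/-- The two-point function along an axis. -/
def axisCorr (β : ℝ) (k : ℕ) : ℝ := twoPointInf β (0, 0) ((k : ℤ), 0)

theorem twoPointInf_vertical {β : ℝ} (hβ : 0 ≤ β) (a i : ℤ) (k : ℕ) :
    twoPointInf β (a, i) (a, i + k) = axisCorr β k := by
  have := twoPointInf_add hβ (0, 0) (0, (k : ℤ)) (a, i)
  simp only [Prod.mk_add_mk, zero_add] at this
  rw [add_comm i, this, ← twoPointInf_swap hβ]
  rfl

theorem axisCorr_mul_le {β : ℝ} (hβ : 0 ≤ β) (k l : ℕ) :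
    axisCorr β k * axisCorr β l ≤ axisCorr β (k + l) := by
  have h := twoPointInf_mul_le hβ (0, 0) ((k : ℤ), 0) (((k + l : ℕ) : ℤ), 0)
  have h' := twoPointInf_add hβ (0, 0) ((l : ℤ), 0) ((k : ℤ), 0)
  simp only [Prod.mk_add_mk, zero_add, add_zero] at h'
  rw [Nat.cast_add, add_comm (k : ℤ), h'] at h
  unfold axisCorr
  rwa [Nat.cast_add, add_comm (k : ℤ)]

theorem axisCorr_one_pos {β : ℝ} (hβ : 0 < β) : 0 < axisCorr β 1 := by
  refine lt_of_lt_of_le ?_ (twoPoint_le_twoPointInf hβ.le 1 _ _)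
  let d : DirEdge 1 := ⟨(⟨(0, 0), by simp [mem_box]⟩, ⟨(1, 0), by simp [mem_box]⟩), by
    simp [boxGraph]⟩
  rw [Nat.cast_one, twoPoint_eq_boxCorr β d.fst d.snd]
  exact corr_pos (s := fun d : DirEdge 1 => d.fst) (t := fun d => d.snd)
    (fun _ => by positivity) (by positivity) d.fst_ne_snd

theorem axisCorr_zero {β : ℝ} (hβ : 0 ≤ β) : axisCorr β 0 = 1 := by
  refine le_antisymm (twoPointInf_le_one hβ _ _) ((Eq.ge ?_).trans
    (twoPoint_le_twoPointInf hβ 0 _ _))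
  rw [Nat.cast_zero, twoPoint_eq_boxCorr β ⟨(0, 0), by simp [mem_box]⟩ ⟨(0, 0), by simp [mem_box]⟩]
  exact corr_self _

theorem axisCorr_pos {β : ℝ} (hβ : 0 < β) (k : ℕ) : 0 < axisCorr β k := by
  induction k with
  | zero => rw [axisCorr_zero hβ.le]; exact one_pos
  | succ k ih => exact (mul_pos ih (axisCorr_one_pos hβ)).trans_le (axisCorr_mul_le hβ.le k 1)

theorem axisCorr_of_zero {k : ℕ} (hk : k ≠ 0) : axisCorr 0 k = 0 := by
  refine tendsto_nhds_unique (tendsto_twoPoint le_rfl _ _) ?_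
  refine tendsto_const_nhds.congr fun n => ?_
  by_cases h : ((0, 0) : ℤ × ℤ) ∈ box n ∧ ((k : ℤ), (0 : ℤ)) ∈ box n
  · rw [twoPoint_eq_boxCorr 0 ⟨_, h.1⟩ ⟨_, h.2⟩, boxCorr]
    simp only [zero_div]
    exact (corr_zero (by simpa using fun h : (0 : ℤ) = k => hk (by exact_mod_cast h.symm))).symm
  · rw [twoPoint_of_not_mem h]

/-! ### The mass of the XY model -/

theorem subadditive_neg_log_axisCorr {β : ℝ} (hβ : 0 < β) :
    Subadditive fun k => -Real.log (axisCorr β k) := by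
  intro k l
  have := Real.log_le_log (mul_pos (axisCorr_pos hβ k) (axisCorr_pos hβ l))
    (axisCorr_mul_le hβ.le k l)
  rw [Real.log_mul (axisCorr_pos hβ k).ne' (axisCorr_pos hβ l).ne'] at this
  linarith

theorem bddBelow_neg_log_axisCorr {β : ℝ} (hβ : 0 < β) :
    BddBelow (Set.range fun k : ℕ => -Real.log (axisCorr β k) / k) :=
  ⟨0, by
    rintro _ ⟨k, rfl⟩
    exact div_nonneg (neg_nonneg.2 (Real.log_nonpos (axisCorr_pos hβ k).le
      (twoPointInf_le_one hβ.le _ _))) (Nat.cast_nonneg k)⟩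

theorem xyDecayRate_eq {β : ℝ} (hβ : 0 < β) (k : ℕ) :
    xyDecayRate β k = ((-Real.log (axisCorr β k) / k : ℝ) : EReal) := by
  have : ENNReal.log (ENNReal.ofReal (axisCorr β k)) = ((Real.log (axisCorr β k) : ℝ) : EReal) := by
    rw [ENNReal.log_ofReal_of_pos (axisCorr_pos hβ k)]
  unfold xyDecayRate
  rw [← axisCorr, this, EReal.coe_div, EReal.coe_neg]

theorem tendsto_xyDecayRate_of_pos {β : ℝ} (hβ : 0 < β) :
    Tendsto (xyDecayRate β) atTop (𝓝 ((subadditive_neg_log_axisCorr hβ).lim : EReal)) := by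
  rw [funext (xyDecayRate_eq hβ)]
  exact (continuous_coe_real_ereal.tendsto _).comp
    ((subadditive_neg_log_axisCorr hβ).tendsto_lim (bddBelow_neg_log_axisCorr hβ))

theorem tendsto_xyDecayRate_of_zero : Tendsto (xyDecayRate 0) atTop (𝓝 ⊤) := by
  refine tendsto_const_nhds.congr' ?_
  filter_upwards [eventually_gt_atTop 0] with k hk
  unfold xyDecayRate
  rw [← axisCorr, axisCorr_of_zero hk.ne', ENNReal.ofReal_zero, ENNReal.log_zero, EReal.neg_bot,
    EReal.top_div_of_pos_ne_top (by exact_mod_cast hk) (EReal.coe_ne_top _)]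

theorem tendsto_xyDecayRate {β : ℝ} (hβ : 0 ≤ β) :
    Tendsto (xyDecayRate β) atTop (𝓝 (massXY β)) := by
  refine tendsto_nhds_limUnder ?_
  rcases hβ.eq_or_lt with rfl | hβ
  · exact ⟨_, tendsto_xyDecayRate_of_zero⟩
  · exact ⟨_, tendsto_xyDecayRate_of_pos hβ⟩

/-- In Fekete's lemma the limit is also the infimum, so the bound holds at every distance and
without a constant. -/
theorem axisCorr_le_exp {β : ℝ} (hβ : 0 ≤ β) {r : ℝ} (hr : (r : EReal) < massXY β) (k : ℕ) :
    axisCorr β k ≤ Real.exp (-(r * k)) := by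
  rcases Nat.eq_zero_or_pos k with rfl | hk
  · simp [axisCorr_zero hβ]
  rcases hβ.eq_or_lt with rfl | hβ
  · rw [axisCorr_of_zero hk.ne']; positivity
  · rw [tendsto_nhds_unique (tendsto_xyDecayRate hβ.le) (tendsto_xyDecayRate_of_pos hβ),
      EReal.coe_lt_coe_iff] at hr
    have h := (subadditive_neg_log_axisCorr hβ).lim_le_div (bddBelow_neg_log_axisCorr hβ) hk.ne'
    rw [le_div_iff₀ (by exact_mod_cast hk)] at h
    rw [← Real.log_le_iff_le_exp (axisCorr_pos hβ k)]
    have : r * k ≤ (subadditive_neg_log_axisCorr hβ).lim * k := by gcongr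
    linarith

end XYHeight

end

noncomputable section

set_option linter.unusedSectionVars false

namespace XYHeight

open scoped Classical

/-! ### The current expansion -/

variable {n : ℕ}

/-- Summation by parts. It serves with values in the circle, for the characters of the torus, and
with real values, for the change of gauge in `tailSum_zero_offset`. -/
theorem sum_smul_sub_eq_sum_source {A : Type*} [AddCommGroup A] (c : Current n) (a : box n → A) :
    ∑ d, c d • (a d.fst - a d.snd) = ∑ v, source c v • a v := by
  have h : ∑ d : DirEdge n, c d • a d.snd = ∑ d : DirEdge n, c d.symm • a d.fst :=
    (Equiv.sum_comp (Function.Involutive.toPerm _ SimpleGraph.Dart.symm_involutive)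
      fun d : DirEdge n => c d • a d.snd).symm
  simp_rw [smul_sub, Finset.sum_sub_distrib, h, ← Finset.sum_sub_distrib]
  rw [← Finset.sum_fiberwise (s := Finset.univ) (g := fun d : DirEdge n => d.fst)]
  refine Finset.sum_congr rfl fun v _ => ?_
  unfold source
  rw [Finset.sum_smul]
  refine Finset.sum_congr ?_ fun d hd => ?_
  · ext d; simp
  · rw [(Finset.mem_filter.1 hd).2, sub_smul, natCast_zsmul, natCast_zsmul]

theorem toCircle_sum {ι : Type*} (s : Finset ι) (u : ι → UnitAddCircle) :
    (AddCircle.toCircle (∑ i ∈ s, u i) : ℂ) = ∏ i ∈ s, (AddCircle.toCircle (u i) : ℂ) := by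
  induction s using Finset.induction_on with
  | empty => simp
  | insert i s hi ih => rw [Finset.sum_insert hi, Finset.prod_insert hi, AddCircle.toCircle_add,
      Circle.coe_mul, ih]

theorem exists_zsmul_half_turn {m : ℤ} (hm : m ≠ 0) :
    ∃ h : UnitAddCircle, (AddCircle.toCircle (m • h) : ℂ) = -1 := by
  refine ⟨((1 / (2 * m) : ℝ) : UnitAddCircle), ?_⟩
  have : m • ((1 / (2 * m) : ℝ) : UnitAddCircle) = ((1 / 2 : ℝ) : UnitAddCircle) := by
    rw [← AddCircle.coe_zsmul, zsmul_eq_mul]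
    congr 1
    have : (m : ℝ) ≠ 0 := by exact_mod_cast hm
    field_simp
  rw [this]
  simp only [AddCircle.toCircle_apply_mk, Circle.coe_exp]
  rw [show (((2 * Real.pi / 1 * (1 / 2) : ℝ) : ℂ)) * Complex.I = Real.pi * Complex.I by
    push_cast; ring]
  exact Complex.exp_pi_mul_I

/-- The characters of the torus are orthogonal to the constants. -/
theorem integral_character {V : Type*} [Fintype V] (m : V → ℤ) :
    ∫ θ, (AddCircle.toCircle (∑ v, m v • θ v) : ℂ) ∂torusHaar V = if m = 0 then 1 else 0 := by
  split_ifs with hm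
  · simp [hm]
  · obtain ⟨v, hv⟩ := Function.ne_iff.1 hm
    obtain ⟨h, hh⟩ := exists_zsmul_half_turn hv
    have h1 : ∀ θ : Torus V, (AddCircle.toCircle (∑ u, m u • (θ + Pi.single v h : Torus V) u) : ℂ)
        = -(AddCircle.toCircle (∑ u, m u • θ u) : ℂ) := by
      intro θ
      simp_rw [Pi.add_apply, smul_add, Finset.sum_add_distrib]
      rw [AddCircle.toCircle_add, Circle.coe_mul,
        Finset.sum_eq_single (s := Finset.univ) (f := fun u => m u • (Pi.single v h : Torus V) u) v,
        Pi.single_eq_same, hh]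
      · ring
      · intro u _ hu; simp [hu]
      · simp
    have h2 : ∫ θ, (AddCircle.toCircle (∑ u, m u • θ u) : ℂ) ∂torusHaar V
        = ∫ θ, (AddCircle.toCircle (∑ u, m u • (θ + Pi.single v h : Torus V) u) : ℂ)
          ∂torusHaar V :=
      (integral_add_right_eq_self (fun θ : Torus V => (AddCircle.toCircle (∑ u, m u • θ u) : ℂ))
        _).symm
    simp_rw [h1, integral_neg] at h2
    exact self_eq_neg.1 h2

theorem continuous_toCircle_sum {V : Type*} [Fintype V] (m : V → ℤ) :
    Continuous fun θ : Torus V => (AddCircle.toCircle (∑ v, m v • θ v) : ℂ) :=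
  continuous_subtype_val.comp (AddCircle.continuous_toCircle.comp (by fun_prop))

theorem prod_pow_eq_toCircle (c : Current n) (θ : Torus (box n)) :
    ∏ d : DirEdge n, (spins θ d.fst * (starRingEnd ℂ) (spins θ d.snd)) ^ c d
      = (AddCircle.toCircle (∑ v, source c v • θ v) : ℂ) := by
  rw [← sum_smul_sub_eq_sum_source, toCircle_sum]
  refine Finset.prod_congr rfl fun d _ => ?_
  rw [AddCircle.toCircle_nsmul, Circle.coe_pow, sub_eq_add_neg, AddCircle.toCircle_add,
    AddCircle.toCircle_neg, Circle.coe_mul, Circle.coe_inv_eq_conj]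
  rfl

/-- Expanding the exponential gives, for each current, its weight times the character of its source
function; integration against the character of `-m` selects the source `m`. Symmetry of `J` makes
the energy real. -/
theorem tsum_source_eq {J : DirEdge n → ℝ} (hJ : ∀ d, J d.symm = J d) (m : box n → ℤ) :
    HasSum (fun c : Current n => if source c = m then ∏ d, J d ^ c d / (c d)! else 0)
      (∫ θ, cosC (∑ v, m v • θ v) * Real.exp (ham (fun d : DirEdge n => d.fst) (fun d => d.snd) J θ)
        ∂torusHaar (box n)) := by
  set F : Current n → Torus (box n) → ℂ := fun c θ =>
    (∏ d, ((J d : ℂ) * (spins θ d.fst * (starRingEnd ℂ) (spins θ d.snd))) ^ c d / (c d)!)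
      * (AddCircle.toCircle (∑ v, -m v • θ v) : ℂ) with hF
  have hF' : ∀ c θ, F c θ = (∏ d, (J d : ℂ) ^ c d / (c d)!)
      * (AddCircle.toCircle (∑ v, (source c v - m v) • θ v) : ℂ) := by
    intro c θ
    simp_rw [hF, sub_smul, Finset.sum_sub_distrib, sub_eq_add_neg, ← Finset.sum_neg_distrib,
      AddCircle.toCircle_add, Circle.coe_mul, ← prod_pow_eq_toCircle, mul_pow, mul_div_right_comm,
      Finset.prod_mul_distrib, neg_smul]
    ring
  have hsum := hasSum_integral_of_dominated_convergence (μ := torusHaar (box n)) (F := F)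
    (f := fun θ => (AddCircle.toCircle (∑ v, -m v • θ v) : ℂ)
      * Real.exp (ham (fun d : DirEdge n => d.fst) (fun d => d.snd) J θ))
    (fun c _ => ∏ d, |J d| ^ c d / (c d)!)
    (fun c => by
      refine Continuous.aestronglyMeasurable ?_
      rw [funext (hF' c)]
      exact continuous_const.mul (continuous_toCircle_sum _))
    (fun c => .of_forall fun θ => by
      rw [hF', norm_mul, Circle.norm_coe, mul_one, norm_prod]
      refine (Finset.prod_congr rfl fun d _ => ?_).le
      simp)
    (.of_forall fun θ => by
      simpa using summable_prod_pow_div_factorial (𝕜 := ℝ) fun d => |J d|)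
    (integrable_const _)
    (.of_forall fun θ => by
      have h1 := (summable_prod_pow_div_factorial (𝕜 := ℂ) fun d : DirEdge n =>
        (J d : ℂ) * (spins θ d.fst * (starRingEnd ℂ) (spins θ d.snd))).hasSum
      rw [tsum_prod_pow_div_factorial, sum_mul_spins_eq_ham hJ] at h1
      have h2 := h1.mul_right (AddCircle.toCircle (∑ v, -m v • θ v) : ℂ)
      rw [mul_comm, Complex.ofReal_exp]
      exact h2)
  have hre := Complex.hasSum_re hsum
  have hint : Integrable (fun θ : Torus (box n) => (AddCircle.toCircle (∑ v, -m v • θ v) : ℂ)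
      * Real.exp (ham (fun d : DirEdge n => d.fst) (fun d => d.snd) J θ)) (torusHaar (box n)) :=
    integrable_of_continuous ((continuous_toCircle_sum _).mul (by fun_prop))
  have hR := Complex.reCLM.integral_comp_comm hint
  simp only [Complex.reCLM_apply] at hR
  rw [← hR] at hre
  convert hre using 1
  · funext c
    simp_rw [hF']
    rw [integral_const_mul]
    have := integral_character fun v => source c v - m v
    rw [this]
    by_cases h : source c = m
    · have h0 : (fun v => source c v - m v) = 0 := by funext v; simp [h]
      rw [if_pos h, if_pos h0, mul_one]
      norm_cast
    · have h0 : (fun v => source c v - m v) ≠ 0 := fun h' => h (by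
        funext v; have := congrFun h' v; simpa [sub_eq_zero] using this)
      rw [if_neg h, if_neg h0]
      simp
  · refine integral_congr_ae (.of_forall fun θ => ?_)
    simp only [Complex.re_mul_ofReal]
    congr 1
    simp_rw [neg_smul, Finset.sum_neg_distrib]
    exact (cosC_neg _).symm

/-- The source function of `c` is `m`. -/
def HasSource (c : Current n) (m : box n → ℤ) : Prop := source c = m

/-- The sum of the weights of the currents with source function `m`. -/
def currentSum (n : ℕ) (J : DirEdge n → ℝ) (m : box n → ℤ) : ℝ≥0∞ :=
  ∑' c : Current n, if HasSource c m then ENNReal.ofReal (∏ d, J d ^ c d / (c d)!) else 0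

/-- The source function `δ_x - δ_y`. -/
def dipole {V : Type*} (x y : V) : V → ℤ := Pi.single x 1 - Pi.single y 1

theorem currentSum_eq {J : DirEdge n → ℝ} (hJ : ∀ d, J d.symm = J d) (h0 : ∀ d, 0 ≤ J d)
    (m : box n → ℤ) :
    currentSum n J m = ENNReal.ofReal (∫ θ, cosC (∑ v, m v • θ v)
      * Real.exp (ham (fun d : DirEdge n => d.fst) (fun d => d.snd) J θ) ∂torusHaar (box n)) := by
  have h := tsum_source_eq hJ m
  rw [← h.tsum_eq, ENNReal.ofReal_tsum_of_nonneg (fun c => ?_) h.summable]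
  · refine tsum_congr fun c => ?_
    unfold HasSource
    split_ifs <;> simp
  · split_ifs
    · exact Finset.prod_nonneg fun d _ => by have := h0 d; positivity
    · exact le_rfl

theorem currentSum_zero {J : DirEdge n → ℝ} (hJ : ∀ d, J d.symm = J d) (h0 : ∀ d, 0 ≤ J d) :
    currentSum n J 0 = ENNReal.ofReal (pf (fun d : DirEdge n => d.fst) (fun d => d.snd) J) := by
  rw [currentSum_eq hJ h0]
  simp [pf]

theorem currentSum_dipole {J : DirEdge n → ℝ} (hJ : ∀ d, J d.symm = J d) (h0 : ∀ d, 0 ≤ J d)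
    (x y : box n) :
    currentSum n J (dipole x y)
      = ENNReal.ofReal (corr (fun d : DirEdge n => d.fst) (fun d => d.snd) J x y)
        * currentSum n J 0 := by
  rw [currentSum_zero hJ h0, ← ENNReal.ofReal_mul (corr_nonneg h0 _ _), currentSum_eq hJ h0]
  unfold corr
  rw [div_mul_cancel₀ _ (pf_pos _ _ _).ne']
  unfold num
  congr 2
  funext θ
  congr 2
  simp_rw [dipole, Pi.sub_apply, sub_smul, Finset.sum_sub_distrib]
  congr 1
  · rw [Finset.sum_eq_single x] <;> simp +contextual
  · rw [Finset.sum_eq_single y] <;> simp +contextual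

end XYHeight

end

noncomputable section

set_option linter.unusedSectionVars false

namespace XYHeight

open scoped Classical

/-! ### Exploring a configuration whose edges out of two vertices are merged -/

variable {n : ℕ}

/-- The class map that identifies `y` with `x`. -/
def merge (x y v : box n) : box n := if v = y then x else v

theorem merge_left (x y : box n) : merge x y x = x := by
  unfold merge; split_ifs <;> rfl

theorem merge_right (x y : box n) : merge x y y = x := if_pos rfl

theorem merge_eq_left_iff {x y v : box n} : merge x y v = x ↔ v = x ∨ v = y := by
  unfold merge; split_ifs with h <;> simp [h]

theorem merge_of_ne {x y u : box n} (hx : u ≠ x) (hy : u ≠ y) {v : box n} :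
    merge x y v = merge x y u ↔ v = u := by
  unfold merge
  rw [if_neg hy]
  split_ifs with h
  · exact ⟨fun h => (hx h.symm).elim, fun h' => (hy (h'.symm.trans h)).elim⟩
  · rfl

/-- The exploration that starts with the state `(o, u)` and follows the first edge of the remaining
word `r` out of the class of `u`, until it comes from `o = x` to `u = y`. -/
def crosses (κ : box n → box n) (x y : box n) : ℕ → box n → box n → Word n → Prop
  | 0, _, _, _ => False
  | k + 1, o, u, r =>
    if u = o ∨ (u ≠ x ∧ u ≠ y) then
      ∃ d l, r (κ u) = d :: l ∧
        crosses κ x y k (if u = o then d.fst else o) d.snd (Function.update r (κ u) l)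
    else o = x ∧ u = y

/-- The number of steps is only fuel for the recursion; after the exploration has stopped, more of
it changes nothing. -/
theorem crosses_mono (κ : box n → box n) (x y : box n) {k l : ℕ} (h : k ≤ l) {o u : box n}
    {r : Word n} (hk : crosses κ x y k o u r) : crosses κ x y l o u r := by
  induction k generalizing l o u r with
  | zero => exact hk.elim
  | succ k ih =>
    obtain ⟨l, rfl⟩ : ∃ l', l = l' + 1 := ⟨l - 1, by omega⟩
    rw [crosses] at hk ⊢
    by_cases hu : u = o ∨ (u ≠ x ∧ u ≠ y)
    · rw [if_pos hu] at hk ⊢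
      obtain ⟨d, s, hd, hs⟩ := hk
      exact ⟨d, s, hd, ih (by omega) hs⟩
    · rwa [if_neg hu] at hk ⊢

/-- A cycle of the decomposition lies at the bottom of a balanced set of edges that contains all
later edges out of the same vertices. -/
theorem Pops.exists_upper {P z : Finset (PEdge n)} (hP : Slotted P) (h : Pops P z) :
    ∃ U, z ⊆ U ∧ U ⊆ P ∧ Balanced U ∧
      (∀ p ∈ U, ∀ q ∈ P, q.1.fst = p.1.fst → p.2 ≤ q.2 → q ∈ U) ∧
      ∀ p ∈ z, ∀ q ∈ U, q.1.fst = p.1.fst → p.2 ≤ q.2 := by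
  have top : ∀ {P e : Finset (PEdge n)}, Slotted P → e ∈ topCycles P →
      ∀ p ∈ e, ∀ q ∈ P, q.1.fst = p.1.fst → p.2 ≤ q.2 → q ∈ e := by
    intro P e hP he p hp q hq hpq hle
    have := mem_topEdges.1 ((mem_topCycles.1 he).1 hp)
    rwa [hP q hq p this.1 hpq (le_antisymm (this.2 q hq hpq) hle)]
  induction h with
  | @top P z hz =>
    have hc := (mem_topCycles.1 hz).2
    refine ⟨z, subset_rfl, subset_of_mem_topCycles hz, hc.balanced, top hP hz, ?_⟩
    intro p hp q hq hpq
    rw [hc.fst_inj hq hp hpq]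
  | @pop P e z he h ih =>
    obtain ⟨U, hzU, hUP, hb, hup, hlow⟩ := ih (hP.mono Finset.sdiff_subset)
    -- The cycles popped before `z` are put on top: edges of a top cycle are later than the edges
    -- that remain at the same vertices.
    refine ⟨e ∪ U, hzU.trans Finset.subset_union_right, Finset.union_subset
      (subset_of_mem_topCycles he) (hUP.trans Finset.sdiff_subset), (mem_topCycles.1 he).2.balanced.union hb
        (Finset.disjoint_of_subset_right hUP Finset.disjoint_sdiff), ?_, ?_⟩
    · intro p hp q hq hpq hle
      rw [Finset.mem_union] at hp ⊢
      rcases hp with hp | hp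
      · exact Or.inl (top hP he p hp q hq hpq hle)
      · by_cases hqe : q ∈ e
        · exact Or.inl hqe
        · exact Or.inr (hup p hp q (Finset.mem_sdiff.2 ⟨hq, hqe⟩) hpq hle)
    · intro p hp q hq hpq
      rcases Finset.mem_union.1 hq with hq | hq
      · exact (mem_topEdges.1 ((mem_topCycles.1 he).1 hq)).2 p
          (Finset.mem_sdiff.1 (h.subset hp)).1 hpq.symm
      · exact hlow p hp q hq hpq

/-- The Poisson edges of the first `a v` letters in each class `v`. -/
def explored (κ : box n → box n) (w : Word n) (a : box n → ℕ) : Finset (PEdge n) :=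
  (stdEdges w).filter fun p => -p.2 < a (κ p.1.fst)

/-- The word without its first `a v` letters in each class `v`. -/
def remaining (w : Word n) (a : box n → ℕ) : Word n := fun v => (w v).drop (a v)

/-- Reads one more letter. The unread edge `q` only ensures that there is one; the letter found is
the latest unread edge of its class. -/
theorem explored_step {κ : box n → box n} {w : Word n} (hw : Valid κ w) (a : box n → ℕ)
    {q : PEdge n} (hq : q ∈ stdEdges w) (hqa : q ∉ explored κ w a) {v : box n}
    (hv : κ q.1.fst = v) :
    ∃ p ∈ stdEdges w, p ∉ explored κ w a ∧ κ p.1.fst = v ∧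
      (∀ q ∈ stdEdges w, q ∉ explored κ w a → κ q.1.fst = v → q.2 ≤ p.2) ∧
      ∃ l, remaining w a v = p.1 :: l ∧
        explored κ w (Function.update a v (a v + 1)) = insert p (explored κ w a) ∧
        remaining w (Function.update a v (a v + 1)) = Function.update (remaining w a) v l := by
  have hle : ∀ q ∈ stdEdges w, q ∉ explored κ w a → κ q.1.fst = v →
      ∃ j, a v ≤ j ∧ j < (w v).length ∧ q.2 = -(j : ℝ) := by
    intro q hq hqa hv
    obtain ⟨v', j, hj, rfl⟩ := mem_stdEdges_iff.1 hq
    obtain rfl : v' = v := (hw.class_letter ⟨v', ⟨j, hj⟩⟩).symm.trans hv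
    refine ⟨j, ?_, hj, rfl⟩
    by_contra hlt
    refine hqa (Finset.mem_filter.2 ⟨hq, ?_⟩)
    rw [hv]
    simpa using hlt
  obtain ⟨j, hja, hj, -⟩ := hle q hq hqa hv
  have hlt : a v < (w v).length := hja.trans_lt hj
  have hcls : κ ((w v)[a v]).fst = v := hw.class_letter ⟨v, ⟨a v, hlt⟩⟩
  refine ⟨((w v)[a v], -(a v : ℝ)), mem_stdEdges_iff.2 ⟨v, a v, hlt, rfl⟩, ?_, hcls, ?_,
    (w v).drop (a v + 1), List.drop_eq_getElem_cons hlt, ?_, ?_⟩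
  · intro h
    have := (Finset.mem_filter.1 h).2
    rw [hcls] at this
    simp at this
  · intro q hq hqa hv
    obtain ⟨j, hja, -, hj⟩ := hle q hq hqa hv
    rw [hj]
    simpa using hja
  · ext q
    simp only [explored, Finset.mem_filter, Finset.mem_insert]
    constructor
    · rintro ⟨hq, hlt'⟩
      obtain ⟨u, i, hi, rfl⟩ := mem_stdEdges_iff.1 hq
      have hu : κ ((w u)[i]).fst = u := hw.class_letter ⟨u, ⟨i, hi⟩⟩
      simp only [hu, neg_neg, Nat.cast_lt] at hlt' ⊢
      by_cases huv : u = v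
      · subst huv
        rw [Function.update_self] at hlt'
        rcases (Nat.lt_succ_iff.1 hlt').eq_or_lt with h | h
        · left; simp only [h]
        · exact Or.inr ⟨hq, h⟩
      · rw [Function.update_of_ne huv] at hlt'
        exact Or.inr ⟨hq, hlt'⟩
    · rintro (rfl | ⟨hq, h⟩)
      · refine ⟨mem_stdEdges_iff.2 ⟨v, a v, hlt, rfl⟩, ?_⟩
        rw [hcls, Function.update_self]
        simp
      · refine ⟨hq, h.trans_le ?_⟩
        by_cases huv : κ q.1.fst = v
        · rw [huv, Function.update_self]; simp
        · rw [Function.update_of_ne huv]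
  · funext u
    by_cases huv : u = v
    · subst huv; simp [remaining]
    · simp [remaining, Function.update_of_ne huv]

theorem dipole_apply {V : Type*} (x y v : V) :
    dipole x y v = (if v = x then 1 else 0) - if v = y then 1 else 0 := by
  simp [dipole, Pi.single_apply]

theorem source_edgeCount_insert {X : Finset (PEdge n)} {p : PEdge n} (hp : p ∉ X) :
    source (edgeCount (insert p X)) = source (edgeCount X) + dipole p.1.fst p.1.snd := by
  funext v
  rw [Pi.add_apply, source_edgeCount, source_edgeCount, Finset.filter_insert, Finset.filter_insert,
    dipole_apply]
  simp only [eq_comm (a := v)]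
  split_ifs <;> simp [Finset.card_insert_of_notMem, hp] <;> ring

/-- In a balanced initial piece of `U`, the edges of the cycle `z` at the bottom of `U` are either
all present or all absent. -/
theorem subset_of_bottom_cycle {P U z X : Finset (PEdge n)} (hz : IsCycle z) (hzU : z ⊆ U)
    (hUP : U ⊆ P) (hU : Balanced U) (hlow : ∀ p ∈ z, ∀ q ∈ U, q.1.fst = p.1.fst → p.2 ≤ q.2)
    (hXU : X ⊆ U) (hX : Balanced X)
    (hup : ∀ p ∈ X, ∀ q ∈ P, q.1.fst = p.1.fst → p.2 ≤ q.2 → q ∈ X)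
    {p : PEdge n} (hp : p ∈ z) (hpX : p ∈ X) : z ⊆ X := by
  intro q hq
  obtain ⟨q', hq', hq'f, hq'X⟩ := hz.backward_induction (fun v => ∃ p ∈ z, p.1.fst = v ∧ p ∈ X)
    (fun e he => by
      rintro ⟨p', hp', hp'e, hp'X⟩
      refine ⟨e, he, rfl, ?_⟩
      -- The edge of `z` out of the end of `e` is the lowest one of `U` there, so `X` has all edges
      -- of `U` out of this vertex. Both sets being balanced, `X` also has all edges of `U` into it,
      -- in particular `e`.
      have h1 : U.filter (fun q => q.1.fst = e.1.snd) ⊆ X.filter fun q => q.1.fst = e.1.snd := by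
        intro q hq
        rw [Finset.mem_filter] at hq ⊢
        have hqp : q.1.fst = p'.1.fst := hq.2.trans hp'e.symm
        exact ⟨hup p' hp'X q (hUP hq.1) hqp (hlow p' hp' q hq.1 hqp), hq.2⟩
      have h2 : X.filter (fun q => q.1.snd = e.1.snd) = U.filter fun q => q.1.snd = e.1.snd := by
        refine Finset.eq_of_subset_of_card_le (Finset.filter_subset_filter _ hXU) ?_
        rw [← hU, ← hX]
        exact Finset.card_le_card h1
      have h3 : e ∈ U.filter fun q => q.1.snd = e.1.snd := Finset.mem_filter.2 ⟨hzU he, rfl⟩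
      rw [← h2] at h3
      exact (Finset.mem_filter.1 h3).1)
    (fst_mem_vertices hp) (fst_mem_vertices hq) ⟨p, hp, rfl, hpX⟩
  rwa [hz.fst_inj hq hq' hq'f.symm]

/-- The exploration never leaves `U` and cannot get stuck while one of the edges of `z` out of `x`
and `y` is unread. It reads a new edge in every step, so it must stop, and it stops only at a
crossing. -/
theorem exists_crosses_of_invariant {x y : box n} (hxy : x ≠ y) {w : Word n}
    (hw : Valid (merge x y) w) {U z : Finset (PEdge n)} (hz : IsCycle z) (hzU : z ⊆ U)
    (hUP : U ⊆ stdEdges w) (hU : Balanced U)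
    (hup : ∀ p ∈ U, ∀ q ∈ stdEdges w, q.1.fst = p.1.fst → p.2 ≤ q.2 → q ∈ U)
    (hlow : ∀ p ∈ z, ∀ q ∈ U, q.1.fst = p.1.fst → p.2 ≤ q.2)
    {zx zy : PEdge n} (hzx : zx ∈ z) (hzy : zy ∈ z) (hx : zx.1.fst = x) (hy : zy.1.fst = y)
    (N : ℕ) (a : box n → ℕ) (o u : box n) (hN : (stdEdges w \ explored (merge x y) w a).card ≤ N)
    (hXU : explored (merge x y) w a ⊆ U)
    (hsrc : source (edgeCount (explored (merge x y) w a)) = dipole o u) (ho : o = x ∨ o = y)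
    (hboth : ¬(zx ∈ explored (merge x y) w a ∧ zy ∈ explored (merge x y) w a)) :
    ∃ k, crosses (merge x y) x y k o u (remaining w a) ∨
      crosses (merge x y) y x k o u (remaining w a) := by
  induction N generalizing a o u with
  | zero =>
    rw [Nat.le_zero, Finset.card_eq_zero, Finset.sdiff_eq_empty_iff_subset] at hN
    exact (hboth ⟨hN (hUP (hzU hzx)), hN (hUP (hzU hzy))⟩).elim
  | succ N ih =>
    set κ := merge x y with hκ
    set X := explored κ w a with hX
    by_cases hend : u = o ∨ (u ≠ x ∧ u ≠ y)
    swap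
    · refine ⟨1, ?_⟩
      have hend' : ¬(u = o ∨ (u ≠ y ∧ u ≠ x)) := fun h => hend (h.imp_right And.symm)
      simp only [crosses, if_neg hend, if_neg hend']
      push Not at hend
      rcases ho with rfl | rfl
      · exact Or.inl ⟨rfl, hend.2 hend.1⟩
      · refine Or.inr ⟨rfl, ?_⟩
        by_contra hux
        exact hend.1 (hend.2 hux)
    have hXup : ∀ p ∈ X, ∀ q ∈ stdEdges w, q.1.fst = p.1.fst → p.2 ≤ q.2 → q ∈ X := by
      intro p hp q hq hpq hle
      refine Finset.mem_filter.2 ⟨hq, ?_⟩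
      rw [hpq]
      exact (neg_le_neg hle).trans_lt (Finset.mem_filter.1 hp).2
    have key : ∃ p ∈ U, p ∉ X ∧ κ p.1.fst = κ u ∧ (u ≠ o → p.1.fst = u) ∧
        ¬(zx ∈ insert p X ∧ zy ∈ insert p X) ∧ ∃ l, remaining w a (κ u) = p.1 :: l ∧
        explored κ w (Function.update a (κ u) (a (κ u) + 1)) = insert p X ∧
        remaining w (Function.update a (κ u) (a (κ u) + 1))
          = Function.update (remaining w a) (κ u) l := by
      by_cases huo : u = o
      · subst huo
        -- No path is pending, so the read part is balanced. It lacks an edge of `z`, hence contains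
        -- none of them; the next letter therefore lies above an unread edge of `z` with the same
        -- origin and belongs to `U`.
        have hXb : Balanced X := by
          rw [balanced_iff_sourceless]
          intro v
          rw [hsrc]; simp [dipole]
        have hno : ∀ p ∈ z, p ∉ X := fun p hp hpX => hboth
          ⟨subset_of_bottom_cycle hz hzU hUP hU hlow hXU hXb hXup hp hpX hzx,
            subset_of_bottom_cycle hz hzU hUP hU hlow hXU hXb hXup hp hpX hzy⟩
        have hku : κ u = x := merge_eq_left_iff.2 ho
        obtain ⟨p, hp, hpX, hpv, hle, hl⟩ := explored_step hw a (hUP (hzU hzx)) (hno zx hzx)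
          (v := κ u) (by rw [hx, hku, hκ, merge_left])
        obtain ⟨q, hq, hqp⟩ : ∃ q ∈ z, q.1.fst = p.1.fst := by
          rcases merge_eq_left_iff.1 (hpv.trans hku) with h | h
          · exact ⟨zx, hzx, hx.trans h.symm⟩
          · exact ⟨zy, hzy, hy.trans h.symm⟩
        refine ⟨p, hup q (hzU hq) p hp hqp.symm (hle q (hUP (hzU hq)) (hno q hq)
          (by rw [hqp, hpv])), hpX, hpv, fun h => (h rfl).elim, ?_, hl⟩
        rintro ⟨h1, h2⟩
        rw [Finset.mem_insert] at h1 h2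
        have e1 := h1.resolve_right (hno zx hzx)
        have e2 := h2.resolve_right (hno zy hzy)
        exact hxy (by rw [← hx, ← hy, e1, e2])
      · obtain ⟨hux, huy⟩ := hend.resolve_left huo
        -- The read part enters `u` once more than it leaves it, while `U` is balanced, so `U` has
        -- an unread edge out of `u`.
        have hcard : (X.filter fun p => p.1.fst = u).card < (U.filter fun p => p.1.fst = u).card := by
          have h1 := source_edgeCount X u
          rw [hsrc, dipole_apply, if_neg huo, if_pos rfl] at h1
          have h2 : (X.filter fun p => p.1.snd = u).card ≤ (U.filter fun p => p.1.snd = u).card :=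
            Finset.card_le_card (Finset.filter_subset_filter _ hXU)
          rw [← hU] at h2
          omega
        obtain ⟨q, hq, hqX⟩ : ∃ q ∈ U.filter fun p => p.1.fst = u, q ∉ X := by
          by_contra! h
          exact hcard.not_ge (Finset.card_le_card fun q hq =>
            Finset.mem_filter.2 ⟨h q hq, (Finset.mem_filter.1 hq).2⟩)
        rw [Finset.mem_filter] at hq
        obtain ⟨p, hp, hpX, hpv, hle, hl⟩ := explored_step hw a (hUP hq.1) hqX
          (v := κ u) (by rw [hq.2])
        have hpu : p.1.fst = u := (merge_of_ne hux huy).1 hpv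
        refine ⟨p, hup q hq.1 p hp (hpu.trans hq.2.symm) (hle q (hUP hq.1) hqX (by rw [hq.2])),
          hpX, hpv, fun _ => hpu, ?_, hl⟩
        rintro ⟨h1, h2⟩
        rw [Finset.mem_insert] at h1 h2
        refine hboth ⟨h1.resolve_left ?_, h2.resolve_left ?_⟩
        · rintro rfl; exact hux (hpu.symm.trans hx)
        · rintro rfl; exact huy (hpu.symm.trans hy)
    obtain ⟨p, hpU, hpX, hpu, hpu', hb, l, hl, hins, hrem⟩ := key
    have hpo : (if u = o then p.1.fst else o) = x ∨ (if u = o then p.1.fst else o) = y := by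
      split_ifs with h
      · subst h
        have hku : κ u = x := merge_eq_left_iff.2 ho
        exact merge_eq_left_iff.1 (hpu.trans hku)
      · exact ho
    obtain ⟨k, hk⟩ := ih (Function.update a (κ u) (a (κ u) + 1)) (if u = o then p.1.fst else o)
      p.1.snd (by
        rw [hins, Finset.sdiff_insert, Finset.card_erase_of_mem
          (Finset.mem_sdiff.2 ⟨hUP hpU, hpX⟩)]
        omega)
      (by rw [hins]; exact Finset.insert_subset hpU hXU)
      (by
        rw [hins, source_edgeCount_insert hpX, hsrc]
        split_ifs with h
        · subst h; simp [dipole]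
        · rw [hpu' h]; simp [dipole])
      hpo (by rwa [hins])
    rw [hrem] at hk
    refine ⟨k + 1, ?_⟩
    have hend' : u = o ∨ (u ≠ y ∧ u ≠ x) := hend.imp_right And.symm
    simp only [crosses, if_pos hend, if_pos hend']
    exact hk.imp (fun h => ⟨p.1, l, hl, h⟩) fun h => ⟨p.1, l, hl, h⟩

/-- If a cycle of the decomposition visits `x` and `y`, then the exploration crosses from one of
them to the other. -/
theorem exists_crosses {x y : box n} (hxy : x ≠ y) {w : Word n} (hw : Valid (merge x y) w)
    {z : Finset (PEdge n)} (hz : Pops (stdEdges w) z)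
    (hx : x ∈ vertices z) (hy : y ∈ vertices z) :
    ∃ k, crosses (merge x y) x y k x x w ∨ crosses (merge x y) y x k x x w := by
  obtain ⟨U, hzU, hUP, hU, hup, hlow⟩ := hz.exists_upper hw.slotted
  obtain ⟨zx, hzx, hx⟩ := hz.isCycle.exists_fst hx
  obtain ⟨zy, hzy, hy⟩ := hz.isCycle.exists_fst hy
  have h0 : explored (merge x y) w 0 = ∅ := by
    refine Finset.filter_eq_empty_iff.2 fun q hq => ?_
    obtain ⟨v, i, hi, rfl⟩ := mem_stdEdges_iff.1 hq
    simp
  have hr : remaining w 0 = w := by funext v; simp [remaining]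
  have := exists_crosses_of_invariant hxy hw hz.isCycle hzU hUP hU hup hlow hzx hzy hx hy
    _ 0 x x le_rfl (by simp [h0]) (by
      funext v
      rw [h0, source_edgeCount, dipole_apply]
      simp) (Or.inl rfl) (by simp [h0])
  rwa [hr] at this

end XYHeight

end

noncomputable section

set_option linter.unusedSectionVars false

namespace XYHeight

open scoped Classical

/-! ### Words with an offset -/

variable {n : ℕ}

/-- The weight of the rest `r` of a word after `a v` letters have been removed in each class. -/
def tailWeight (κ : box n → box n) (τ : box n → ℝ) (a : box n → ℕ) (r : Word n) : ℝ≥0∞ :=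
  if Valid κ r then ENNReal.ofReal (∏ v, τ v ^ (a v + (r v).length) / ((a v + (r v).length)!))
  else 0

theorem tailWeight_zero (κ : box n → box n) (τ : box n → ℝ) (r : Word n) :
    tailWeight κ τ 0 r = wordWeight κ τ r := by
  simp [tailWeight, wordWeight]

/-- The sum of the weights of the words with source function `m`. -/
def tailSum (κ : box n → box n) (τ : box n → ℝ) (a : box n → ℕ) (m : box n → ℤ) : ℝ≥0∞ :=
  ∑' r, if HasSource (wordCount r) m then tailWeight κ τ a r else 0

theorem lintegral_pow_div_factorial {t : ℝ} (ht : 0 ≤ t) (k : ℕ) :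
    ∫⁻ s in Set.Ioc 0 t, ENNReal.ofReal (s ^ k / k !)
      = ENNReal.ofReal (t ^ (k + 1) / (k + 1)!) := by
  rw [← ofReal_integral_eq_lintegral_ofReal]
  · rw [← intervalIntegral.integral_of_le ht, intervalIntegral.integral_div, integral_pow]
    congr 1
    rw [Nat.factorial_succ]
    push_cast
    field_simp
    simp
  · exact (Continuous.integrableOn_Icc (by fun_prop)).mono_set Set.Ioc_subset_Icc_self
  · filter_upwards [ae_restrict_mem measurableSet_Ioc] with s hs
    have := hs.1.le
    simp only [Pi.zero_apply]
    positivity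

theorem prod_update_succ {τ : box n → ℝ} (a : box n → ℕ) (v : box n) (r : Word n) :
    ∏ u, τ u ^ (Function.update a v (a v + 1) u + (r u).length)
        / ((Function.update a v (a v + 1) u + (r u).length)! : ℝ)
      = (∏ u ∈ Finset.univ.erase v, τ u ^ (a u + (r u).length) / ((a u + (r u).length)! : ℝ))
        * (τ v ^ (a v + (r v).length + 1) / ((a v + (r v).length + 1)! : ℝ)) := by
  rw [← Finset.prod_erase_mul _ _ (Finset.mem_univ v), Function.update_self,
    add_right_comm (a v) 1]
  congr 1
  refine Finset.prod_congr rfl fun u hu => ?_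
  rw [Function.update_of_ne (Finset.ne_of_mem_erase hu)]

theorem prod_update_time {τ : box n → ℝ} (a : box n → ℕ) (v : box n) (s : ℝ) (r : Word n) :
    ∏ u, Function.update τ v s u ^ (a u + (r u).length) / ((a u + (r u).length)! : ℝ)
      = (∏ u ∈ Finset.univ.erase v, τ u ^ (a u + (r u).length) / ((a u + (r u).length)! : ℝ))
        * (s ^ (a v + (r v).length) / ((a v + (r v).length)! : ℝ)) := by
  rw [← Finset.prod_erase_mul _ _ (Finset.mem_univ v), Function.update_self]
  congr 1
  refine Finset.prod_congr rfl fun u hu => ?_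
  rw [Function.update_of_ne (Finset.ne_of_mem_erase hu)]

theorem measurable_tailWeight_update (κ : box n → box n) (τ : box n → ℝ) (a : box n → ℕ)
    (v : box n) (r : Word n) : Measurable fun s => tailWeight κ (Function.update τ v s) a r := by
  unfold tailWeight
  split_ifs
  · simp_rw [prod_update_time]
    fun_prop
  · exact measurable_const

/-- The integration variable `s` is the time of a removed letter, and later letters of the class
have times below it. This trades an offset for a shorter time interval. -/
theorem tailWeight_succ (κ : box n → box n) {τ : box n → ℝ} (hτ : ∀ v, 0 ≤ τ v) (a : box n → ℕ)
    (v : box n) (r : Word n) :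
    tailWeight κ τ (Function.update a v (a v + 1)) r
      = ∫⁻ s in Set.Ioc 0 (τ v), tailWeight κ (Function.update τ v s) a r := by
  unfold tailWeight
  split_ifs
  · simp_rw [prod_update_time, prod_update_succ]
    have h0 : 0 ≤ ∏ u ∈ Finset.univ.erase v,
        τ u ^ (a u + (r u).length) / ((a u + (r u).length)! : ℝ) :=
      Finset.prod_nonneg fun u _ => by have := hτ u; positivity
    simp_rw [ENNReal.ofReal_mul h0]
    rw [lintegral_const_mul _ (by fun_prop), lintegral_pow_div_factorial (hτ v)]
  · simp

theorem tailSum_succ (κ : box n → box n) {τ : box n → ℝ} (hτ : ∀ v, 0 ≤ τ v) (a : box n → ℕ)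
    (v : box n) (m : box n → ℤ) :
    tailSum κ τ (Function.update a v (a v + 1)) m
      = ∫⁻ s in Set.Ioc 0 (τ v), tailSum κ (Function.update τ v s) a m := by
  unfold tailSum
  rw [lintegral_tsum fun r => by
    split_ifs
    · exact (measurable_tailWeight_update κ τ a v r).aemeasurable
    · exact aemeasurable_const]
  refine tsum_congr fun r => ?_
  split_ifs
  · exact tailWeight_succ κ hτ a v r
  · simp

/-- Sourceless currents and currents with sources in one class do not see whether the time
intervals depend on the origin of an edge or, symmetrically, on both ends. -/
theorem tailSum_zero_offset (κ : box n → box n) {τ : box n → ℝ} (hτ : ∀ v, 0 < τ v)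
    {m : box n → ℤ} (hm : ∀ f : box n → ℝ, ∑ v, m v * f (κ v) = 0) :
    tailSum κ τ 0 m = currentSum n (fun d => √(τ (κ d.fst)) * √(τ (κ d.snd))) m := by
  unfold tailSum currentSum
  simp_rw [tailWeight_zero]
  rw [tsum_wordWeight_count κ (fun v => (hτ v).le) fun c => HasSource c m]
  refine tsum_congr fun c => ?_
  split_ifs with hc
  swap
  · rfl
  rw [HasSource] at hc
  congr 1
  simp_rw [Finset.prod_div_distrib]
  congr 1
  obtain ⟨b, hb⟩ : ∃ b : box n → ℝ, ∀ v, √(τ v) = Real.exp (b v) :=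
    ⟨fun v => Real.log √(τ v), fun v => (Real.exp_log (Real.sqrt_pos.2 (hτ v))).symm⟩
  have hb' : ∀ v, τ v = Real.exp (b v) * Real.exp (b v) := fun v => by
    rw [← hb, Real.mul_self_sqrt (hτ v).le]
  simp_rw [hb, hb', ← Real.exp_add, ← Real.exp_nat_mul, ← Real.exp_sum]
  congr 1
  -- With `√(τ v) = exp (b v)`, the coupling given by the origin is the symmetric one times `exp
  -- (b(origin) - b(end))`. Over the whole current these factors multiply to the exponential of `∑
  -- source * b`, which is 1 by `hm`.
  have h := sum_smul_sub_eq_sum_source c fun v => b (κ v)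
  simp only [hc, nsmul_eq_mul, zsmul_eq_mul, hm b] at h
  rw [← sub_eq_zero, ← Finset.sum_sub_distrib, ← h]
  exact Finset.sum_congr rfl fun d _ => by ring

/-! ### The weight of the words whose exploration crosses. -/

section crossing

variable {κ : box n → box n} {x y : box n} {T : ℝ}

/-- The two-point function of the box with coupling constant `T`. -/
abbrev rho (T : ℝ) (x y : box n) : ℝ :=
  corr (fun d : DirEdge n => d.fst) (fun d => d.snd) (fun _ => T) x y

/-- Induction on the number of removed letters, each of which becomes an integral over a time that
shortens an interval. Without offset, both sides are current sums of an XY model with symmetric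
couplings at most `T`, and `corr_mono` compares the two-point functions. -/
theorem tailSum_dipole_le (hκ : κ x = κ y) {τ : box n → ℝ} (hτ : ∀ v, 0 < τ v)
    (hT : ∀ v, τ v ≤ T) (a : box n → ℕ) :
    tailSum κ τ a (dipole y x) ≤ ENNReal.ofReal (rho T x y) * tailSum κ τ a 0 := by
  obtain ⟨N, hN⟩ : ∃ N, ∑ v, a v = N := ⟨_, rfl⟩
  induction N generalizing a τ with
  | zero =>
    obtain rfl : a = 0 := by
      funext v
      exact Finset.sum_eq_zero_iff.1 hN v (Finset.mem_univ v)
    -- The reason for merging `x` and `y`: functions of the class do not see the dipole, so the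
    -- change of gauge costs nothing.
    have hd : ∀ f : box n → ℝ, ∑ v, ((dipole y x v : ℤ) : ℝ) * f (κ v) = 0 := by
      intro f
      simp [dipole_apply, sub_mul, Finset.sum_sub_distrib, hκ]
    rw [tailSum_zero_offset κ hτ hd, tailSum_zero_offset κ hτ (by simp), currentSum_dipole
      (fun d => mul_comm _ _) (fun d => by positivity)]
    gcongr
    rw [corr_comm]
    refine corr_mono (fun d => by positivity) (fun d => ?_) _ _
    have hT0 : 0 ≤ T := (hτ x).le.trans (hT x)
    calc √(τ (κ d.fst)) * √(τ (κ d.snd)) ≤ √T * √T := by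
          gcongr <;> exact hT _
      _ = T := Real.mul_self_sqrt hT0
  | succ N ih =>
    obtain ⟨v, -, hv⟩ : ∃ v ∈ Finset.univ, a v ≠ 0 := by
      by_contra! h
      rw [Finset.sum_eq_zero h] at hN
      omega
    set a' := Function.update a v (a v - 1) with ha'
    have hav : a = Function.update a' v (a' v + 1) := by
      rw [ha', Function.update_idem, Function.update_self, Nat.sub_add_cancel (by omega),
        Function.update_eq_self]
    have hsum : ∑ u, a' u = N := by
      have h1 := Finset.sum_update_of_mem (Finset.mem_univ v) a (a v - 1)
      have h2 := Finset.sum_update_of_mem (Finset.mem_univ v) a (a v)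
      rw [Function.update_eq_self] at h2
      rw [ha']
      omega
    rw [hav, tailSum_succ κ (fun v => (hτ v).le), tailSum_succ κ (fun v => (hτ v).le),
      ← lintegral_const_mul' _ _ ENNReal.ofReal_ne_top]
    refine setLIntegral_mono' measurableSet_Ioc fun s hs => ih ?_ ?_ a' hsum
    · intro u
      by_cases huv : u = v
      · subst huv; rw [Function.update_self]; exact hs.1
      · rw [Function.update_of_ne huv]; exact hτ u
    · intro u
      by_cases huv : u = v
      · subst huv; rw [Function.update_self]; exact hs.2.trans (hT u)
      · rw [Function.update_of_ne huv]; exact hT u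

/-- The word with the letter `d` put in front in the class `v`. -/
def consWord (v : box n) (p : DirEdge n × Word n) : Word n :=
  Function.update p.2 v (p.1 :: p.2 v)

theorem consWord_apply_self (v : box n) (p : DirEdge n × Word n) :
    consWord v p v = p.1 :: p.2 v := Function.update_self _ _ _

theorem consWord_apply_of_ne {u v : box n} (h : u ≠ v) (p : DirEdge n × Word n) :
    consWord v p u = p.2 u := Function.update_of_ne h _ _

theorem update_consWord (v : box n) (p : DirEdge n × Word n) :
    Function.update (consWord v p) v (p.2 v) = p.2 := by
  rw [consWord, Function.update_idem, Function.update_eq_self]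

theorem consWord_injective (v : box n) : Function.Injective (consWord v) := by
  rintro ⟨d, r⟩ ⟨d', r'⟩ h
  have h1 := congrFun h v
  rw [consWord_apply_self, consWord_apply_self, List.cons.injEq] at h1
  refine Prod.ext h1.1 ?_
  have h2 := update_consWord v (d, r)
  rw [h, show (d, r).2 v = (d', r').2 v from h1.2, update_consWord] at h2
  exact h2.symm

theorem tsum_consWord (v : box n) (Q : DirEdge n → Word n → Prop) (g : Word n → ℝ≥0∞) :
    ∑' r, (if ∃ d l, r v = d :: l ∧ Q d (Function.update r v l) then g r else 0)
      = ∑ d, ∑' r, if Q d r then g (consWord v (d, r)) else 0 := by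
  have h := (consWord_injective v).tsum_eq (f := fun r : Word n =>
    if ∃ d l, r v = d :: l ∧ Q d (Function.update r v l) then g r else 0) (by
      intro r hr
      rw [Function.mem_support] at hr
      split_ifs at hr with hr'
      · obtain ⟨d, l, hd, -⟩ := hr'
        refine ⟨(d, Function.update r v l), ?_⟩
        change Function.update (Function.update r v l) v (d :: Function.update r v l v) = r
        rw [Function.update_self, Function.update_idem, ← hd, Function.update_eq_self]
      · exact (hr rfl).elim)
  rw [← h, ENNReal.tsum_prod', tsum_fintype]
  refine Finset.sum_congr rfl fun d _ => tsum_congr fun r => ?_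
  congr 1
  rw [eq_iff_iff]
  constructor
  · rintro ⟨d', l, hd, hQ⟩
    rw [consWord_apply_self, List.cons.injEq] at hd
    obtain ⟨rfl, rfl⟩ := hd
    rwa [update_consWord v (d, r)] at hQ
  · intro hQ
    exact ⟨d, r v, consWord_apply_self v _, by rwa [update_consWord v (d, r)]⟩

theorem source_add (c c' : Current n) : source (c + c') = source c + source c' := by
  funext v
  simp only [source, Pi.add_apply, ← Finset.sum_add_distrib]
  exact Finset.sum_congr rfl fun d _ => by push_cast; ring

theorem wordCount_consWord (v : box n) (d : DirEdge n) (r : Word n) :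
    wordCount (consWord v (d, r)) = Pi.single d 1 + wordCount r := by
  funext e
  unfold wordCount
  rw [Pi.add_apply, ← Finset.add_sum_erase _ _ (Finset.mem_univ v),
    ← Finset.add_sum_erase (a := v) _ _ (Finset.mem_univ v), consWord_apply_self,
    List.count_cons, ← add_assoc]
  congr 1
  · rw [add_comm, Pi.single_apply]
    congr 1
    by_cases h : e = d
    · subst h; simp
    · simp [h, Ne.symm h]
  · refine Finset.sum_congr rfl fun u hu => ?_
    rw [consWord_apply_of_ne (Finset.ne_of_mem_erase hu)]

theorem source_single (d : DirEdge n) :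
    source (Pi.single d 1 : Current n) = dipole d.fst d.snd := by
  have h := source_edgeCount_insert (X := ∅) (p := ((d, 0) : PEdge n)) (by simp)
  have h0 : source (edgeCount (∅ : Finset (PEdge n))) = 0 := by
    funext v; rw [source_edgeCount]; simp
  have h1 : edgeCount (insert ((d, 0) : PEdge n) ∅) = Pi.single d 1 := by
    funext e
    rw [edgeCount_apply, Pi.single_apply]
    by_cases hde : e = d
    · subst hde; simp [Finset.filter_singleton]
    · simp [hde, Ne.symm hde]
  rw [h0, h1, zero_add] at h
  exact h

theorem source_consWord (v : box n) (d : DirEdge n) (r : Word n) :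
    source (wordCount (consWord v (d, r))) = dipole d.fst d.snd + source (wordCount r) := by
  rw [wordCount_consWord, source_add, source_single]

theorem valid_consWord {v : box n} {d : DirEdge n} {r : Word n} :
    Valid κ (consWord v (d, r)) ↔ κ d.fst = v ∧ Valid κ r := by
  constructor
  · intro h
    refine ⟨h v d (by rw [consWord_apply_self]; exact List.mem_cons_self), fun u e he => h u e ?_⟩
    by_cases hu : u = v
    · subst hu; rw [consWord_apply_self]; exact List.mem_cons_of_mem _ he
    · rwa [consWord_apply_of_ne hu]
  · rintro ⟨hd, h⟩ u e he
    by_cases hu : u = v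
    · subst hu
      rw [consWord_apply_self] at he
      rcases List.mem_cons.1 he with rfl | he
      · exact hd
      · exact h u e he
    · rw [consWord_apply_of_ne hu] at he
      exact h u e he

theorem tailWeight_consWord (τ : box n → ℝ) (a : box n → ℕ) (v : box n) (d : DirEdge n)
    (r : Word n) : tailWeight κ τ a (consWord v (d, r))
      = if κ d.fst = v then tailWeight κ τ (Function.update a v (a v + 1)) r else 0 := by
  unfold tailWeight
  simp only [valid_consWord, ite_and]
  split_ifs
  · congr 1
    refine Finset.prod_congr rfl fun u _ => ?_
    by_cases hu : u = v
    · subst hu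
      rw [consWord_apply_self, Function.update_self, List.length_cons, add_assoc, add_comm 1]
    · rw [consWord_apply_of_ne hu, Function.update_of_ne hu]
  all_goals rfl

/-- The sum of the weights of the words with source function `δ_u - δ_o + m` that cross from `x`
to `y` within `k` steps. -/
def crossSum (κ : box n → box n) (x y : box n) (T : ℝ) (m : box n → ℤ) (k : ℕ) (a : box n → ℕ)
    (o u : box n) : ℝ≥0∞ :=
  ∑' r, if crosses κ x y k o u r then
    (if HasSource (wordCount r) (dipole u o + m) then tailWeight κ (fun _ => T) a r else 0) else 0

theorem crosses_succ_of_continue (κ : box n → box n) {x y : box n} (k : ℕ) {o u : box n}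
    (hu : u = o ∨ (u ≠ x ∧ u ≠ y)) {r : Word n} :
    crosses κ x y (k + 1) o u r ↔ ∃ d l, r (κ u) = d :: l ∧
      crosses κ x y k (if u = o then d.fst else o) d.snd (Function.update r (κ u) l) := by
  rw [crosses, if_pos hu]

theorem crosses_succ_of_stop (κ : box n → box n) {x y : box n} (k : ℕ) {o u : box n}
    (hu : ¬(u = o ∨ (u ≠ x ∧ u ≠ y))) {r : Word n} :
    crosses κ x y (k + 1) o u r ↔ o = x ∧ u = y := by
  rw [crosses, if_neg hu]

/-- The letter read moves from the word into the offset, and the source term `δ_u - δ_o` follows the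
state of the exploration, so `m` stays the same. -/
theorem crossSum_step (hκ : ∀ u v, u ≠ x → u ≠ y → κ v = κ u → v = u) (m : box n → ℤ) (k : ℕ)
    (a : box n → ℕ) {o u : box n} (hu : u = o ∨ (u ≠ x ∧ u ≠ y)) :
    crossSum κ x y T m (k + 1) a o u = ∑ d : DirEdge n, if κ d.fst = κ u then
      crossSum κ x y T m k (Function.update a (κ u) (a (κ u) + 1)) (if u = o then d.fst else o)
        d.snd else 0 := by
  unfold crossSum
  refine (tsum_congr fun r => if_congr (crosses_succ_of_continue κ k hu) rfl rfl).trans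
    ((tsum_consWord (κ u) (fun d r => crosses κ x y k (if u = o then d.fst else o) d.snd r)
      _).trans ?_)
  refine Finset.sum_congr rfl fun d _ => ?_
  by_cases hd : κ d.fst = κ u
  swap
  · rw [if_neg hd, ENNReal.tsum_eq_zero]
    intro r
    rw [tailWeight_consWord, if_neg hd]
    simp
  rw [if_pos hd]
  have h0 : dipole d.fst d.snd + (dipole d.snd (if u = o then d.fst else o) + m)
      = dipole u o + m := by
    by_cases h : u = o
    · rw [if_pos h, h]; unfold dipole; abel
    · obtain ⟨h1, h2⟩ := hu.resolve_left h
      rw [if_neg h, hκ u d.fst h1 h2 hd]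
      unfold dipole; abel
  refine tsum_congr fun r => if_congr Iff.rfl ?_ rfl
  rw [tailWeight_consWord, if_pos hd]
  refine if_congr ?_ rfl rfl
  rw [HasSource, HasSource, source_consWord, ← h0, add_right_inj]

/-- Both sides satisfy the same recursion, so they need comparison only where the exploration stops
at `o = x`, `u = y`. There the unread word has source `δ_y - δ_x` on the left and no source on the
right. -/
theorem crossSum_le (hκ : ∀ u v, u ≠ x → u ≠ y → κ v = κ u → v = u) (hxy : κ x = κ y)
    (hT : 0 < T) (k : ℕ) (a : box n → ℕ) (o u : box n) :
    crossSum κ x y T 0 k a o u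
      ≤ ENNReal.ofReal (rho T x y) * crossSum κ x y T (dipole x y) k a o u := by
  induction k generalizing a o u with
  | zero => simp [crossSum, crosses]
  | succ k ih =>
    by_cases hu : u = o ∨ (u ≠ x ∧ u ≠ y)
    · rw [crossSum_step hκ _ _ _ hu, crossSum_step hκ _ _ _ hu, Finset.mul_sum]
      refine Finset.sum_le_sum fun d _ => ?_
      by_cases hd : κ d.fst = κ u
      · rw [if_pos hd, if_pos hd]; exact ih _ _ _
      · simp [hd]
    · have hc : ∀ m, crossSum κ x y T m (k + 1) a o u
          = if o = x ∧ u = y then tailSum κ (fun _ => T) a (dipole u o + m) else 0 := by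
        intro m
        unfold crossSum tailSum
        by_cases h : o = x ∧ u = y
        · rw [if_pos h]
          exact tsum_congr fun r => if_pos ((crosses_succ_of_stop κ k hu).2 h)
        · rw [if_neg h, ENNReal.tsum_eq_zero]
          exact fun r => if_neg fun h' => h ((crosses_succ_of_stop κ k hu).1 h')
      rw [hc, hc]
      by_cases h : o = x ∧ u = y
      · rw [if_pos h, if_pos h]
        obtain ⟨rfl, rfl⟩ := h
        have h0 : dipole u o + dipole o u = 0 := by simp [dipole]
        rw [h0, add_zero]
        exact tailSum_dipole_le hxy (fun _ => hT) (fun _ => le_rfl) a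
      · rw [if_neg h]; exact zero_le

theorem tailSum_const (hT : 0 ≤ T) (m : box n → ℤ) :
    tailSum κ (fun _ => T) 0 m = currentSum n (fun _ => T) m := by
  unfold tailSum currentSum
  simp_rw [tailWeight_zero]
  exact tsum_wordWeight_count κ (fun _ => hT) fun c => HasSource c m

/-- After the exchange of sources the crossing condition is dropped; the sum over all currents with
source `dipole x y` gives the second factor `rho`. -/
theorem crossSum_start_le (hκ : ∀ u v, u ≠ x → u ≠ y → κ v = κ u → v = u) (hxy : κ x = κ y)
    (hT : 0 < T) (k : ℕ) (o : box n) :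
    crossSum κ x y T 0 k 0 o o ≤ ENNReal.ofReal (rho T x y ^ 2) * currentSum n (fun _ => T) 0 := by
  refine (crossSum_le hκ hxy hT k 0 o o).trans ?_
  have h : crossSum κ x y T (dipole x y) k 0 o o ≤ currentSum n (fun _ => T) (dipole x y) := by
    rw [← tailSum_const (κ := κ) hT.le]
    refine ENNReal.tsum_le_tsum fun r => ?_
    have h0 : dipole o o + dipole x y = dipole x y := by simp [dipole]
    rw [h0]
    split_ifs <;> simp
  rw [currentSum_dipole (fun _ => rfl) (fun _ => hT.le)] at h
  rw [pow_two, ENNReal.ofReal_mul (corr_nonneg (fun _ => hT.le) _ _), mul_assoc]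
  gcongr

end crossing

/-- A finite partial sum needs only one `k` for all its terms, by monotonicity. -/
theorem tsum_exists_le {α : Type*} {C : ℕ → α → Prop} (hC : ∀ k l a, k ≤ l → C k a → C l a)
    (g : α → ℝ≥0∞) {B : ℝ≥0∞} (h : ∀ k, ∑' a, (if C k a then g a else 0) ≤ B) :
    ∑' a, (if ∃ k, C k a then g a else 0) ≤ B := by
  rw [ENNReal.tsum_eq_iSup_sum]
  refine iSup_le fun s => ?_
  choose! f hf using fun a (ha : ∃ k, C k a) => ha
  refine le_trans (Finset.sum_le_sum fun a ha => ?_)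
    ((ENNReal.sum_le_tsum s).trans (h (s.sup f)))
  split_ifs with h1 h2
  · exact le_rfl
  · exact (h2 (hC _ _ a (Finset.le_sup ha) (hf a h1))).elim
  all_goals simp

/-- The current passes through `x`. -/
def Visits (c : Current n) (x : box n) : Prop := ∃ d, 0 < c d ∧ (d.fst = x ∨ d.snd = x)

/-- The word with `x` and `y` merged still determines the order at each vertex, so the event can be
read off from it. A common cycle forces a first crossing from `x` to `y` or from `y` to `x`; each
direction contributes `rho ^ 2`. -/
theorem poissonMeasure_commonCycle_le {T : ℝ} (hT : 0 < T) {x y : box n} (hxy : x ≠ y) :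
    poissonMeasure n T {ω | Sourceless ω.1 ∧ ∃ z ∈ cycleDecomp (poissonEdges ω),
        Visits (edgeCount z) x ∧ Visits (edgeCount z) y}
      ≤ ENNReal.ofReal (2 * rho T x y ^ 2) * poissonMeasure n T {ω | Sourceless ω.1} := by
  set κ := merge x y with hκ
  have hcls : ∀ u v, u ≠ x → u ≠ y → κ v = κ u → v = u := fun u v h1 h2 h =>
    (merge_of_ne h1 h2).1 h
  have hκxy : κ x = κ y := by rw [hκ, merge_left, merge_right]
  have hZ : poissonMeasure n T {ω | Sourceless ω.1} = currentSum n (fun _ => T) 0 := by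
    rw [← tailSum_const (κ := κ) hT.le]
    unfold tailSum
    simp_rw [tailWeight_zero]
    refine timedMeasure_eq_tsum κ (fun _ => hT.le) fun ω w h => ?_
    rw [Set.mem_ofPred_eq, ← h.wordCount_eq]
    exact funext_iff.symm
  have hE : poissonMeasure n T {ω | Sourceless ω.1 ∧ ∃ z ∈ cycleDecomp (poissonEdges ω),
        Visits (edgeCount z) x ∧ Visits (edgeCount z) y}
      = ∑' w, if HasSource (wordCount w) 0 ∧ HasCycle (fun c => Visits c x ∧ Visits c y) w then
          wordWeight κ (fun _ => T) w else 0 := by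
    refine (timedMeasure_eq_tsum κ (fun _ => hT.le) (B := fun w => HasSource (wordCount w) 0 ∧
      HasCycle (fun c => Visits c x ∧ Visits c y) w) fun ω w h => ?_).trans
      (tsum_congr fun w => by congr)
    rw [Set.mem_ofPred_eq, h.wordCount_eq, show HasSource ω.1 0 ↔ Sourceless ω.1 from funext_iff]
    exact and_congr_right fun hc => h.hasCycle_iff hc fun c => Visits c x ∧ Visits c y
  set g : Word n → ℝ≥0∞ := fun w =>
    if HasSource (wordCount w) 0 then wordWeight κ (fun _ => T) w else 0 with hg
  have hcross : ∀ x' y' : box n, (∀ u v, u ≠ x' → u ≠ y' → κ v = κ u → v = u) → κ x' = κ y' →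
      ∑' w, (if ∃ k, crosses κ x' y' k x x w then g w else 0)
        ≤ ENNReal.ofReal (rho T x' y' ^ 2) * currentSum n (fun _ => T) 0 := by
    intro x' y' h1 h2
    refine tsum_exists_le (C := fun k w => crosses κ x' y' k x x w)
      (fun k l a hkl => crosses_mono κ x' y' hkl) g fun k => ?_
    refine Eq.trans_le ?_ (crossSum_start_le h1 h2 hT k x)
    have h0 : dipole x x + 0 = 0 := by simp [dipole]
    unfold crossSum
    simp_rw [h0, tailWeight_zero]
    exact tsum_congr fun w => if_congr Iff.rfl rfl rfl
  rw [hE, hZ]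
  calc _ ≤ ∑' w, ((if ∃ k, crosses κ x y k x x w then g w else 0)
        + if ∃ k, crosses κ y x k x x w then g w else 0) := by
        refine ENNReal.tsum_le_tsum fun w => ?_
        by_cases hv : Valid κ w
        swap
        · simp [wordWeight, hv]
        by_cases h1 : HasSource (wordCount w) 0 ∧ HasCycle (fun c => Visits c x ∧ Visits c y) w
        swap
        · rw [if_neg h1]; exact zero_le
        rw [if_pos h1]
        obtain ⟨hs, z, hz, hzx, hzy⟩ := h1
        have hgw : g w = wordWeight κ (fun _ => T) w := if_pos hs
        obtain ⟨k, hk | hk⟩ := exists_crosses hxy hv hz (mem_vertices_iff_edgeCount.2 hzx)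
          (mem_vertices_iff_edgeCount.2 hzy)
        · have h2 : ∃ k, crosses κ x y k x x w := ⟨k, hk⟩
          rw [if_pos h2, hgw]; exact le_self_add
        · have h2 : ∃ k, crosses κ y x k x x w := ⟨k, hk⟩
          rw [if_pos h2, hgw]; exact le_add_self
    _ ≤ _ := by
        rw [ENNReal.tsum_add]
        refine (add_le_add (hcross x y hcls hκxy)
          (hcross y x (fun u v h1 h2 => hcls u v h2 h1) hκxy.symm)).trans_eq ?_
        rw [rho, rho, corr_comm y x, ← two_mul, ← mul_assoc, ENNReal.ofReal_mul zero_le_two]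
        simp

/-- Treated apart because the change of gauge requires positive couplings. -/
theorem poissonLaw_zero_commonCycle (R : Current n → Prop) :
    poissonLaw n 0 {ω | ∃ z ∈ cycleDecomp (poissonEdges ω), R (edgeCount z)} = 0 := by
  rw [poissonLaw_hasCycle le_rfl, wordLaw_apply]
  refine mul_eq_zero_of_right _ ?_
  rw [wordMeasure_apply, ENNReal.tsum_eq_zero]
  intro w
  split_ifs with h
  swap
  · rfl
  obtain ⟨z, hz, -⟩ := h.2
  obtain ⟨q, hq⟩ := hz.isCycle.nonempty
  obtain ⟨v, i, hi, -⟩ := mem_stdEdges_iff.1 (hz.subset hq)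
  unfold wordWeight
  split_ifs
  swap
  · rfl
  rw [ENNReal.ofReal_eq_zero]
  refine (Finset.prod_eq_zero (Finset.mem_univ v) ?_).le
  rw [zero_pow (by omega), zero_div]

/-- The probability that a cycle of the decomposition visits both `x` and `y`. -/
theorem poissonLaw_commonCycle_le {β : ℝ} (hβ : 0 ≤ β) {x y : box n} (hxy : x ≠ y) :
    poissonLaw n (β / 2) {ω | ∃ z ∈ cycleDecomp (poissonEdges ω),
        Visits (edgeCount z) x ∧ Visits (edgeCount z) y}
      ≤ ENNReal.ofReal (2 * twoPoint n β x y ^ 2) := by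
  rcases hβ.eq_or_lt with rfl | hβ
  · rw [zero_div, poissonLaw_zero_commonCycle fun c => Visits c x ∧ Visits c y]
    exact zero_le
  have h := poissonMeasure_commonCycle_le (T := β / 2) (by positivity) hxy
  rw [poissonLaw, cond_apply (measurableSet_of_fst _), twoPoint_eq_boxCorr]
  refine (mul_le_mul_right h _).trans ?_
  rw [mul_left_comm]
  exact mul_le_of_le_one_right' (ENNReal.inv_mul_le_one _)

end XYHeight

end

noncomputable section

set_option linter.unusedSectionVars false

namespace XYHeight

open scoped Classical

/-! ### Heights and signs -/

variable {n : ℕ}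

/-- The net flow along an edge, as an additive function of the current. -/
def flowHom (n : ℕ) (x y : ℤ × ℤ) : Current n →+ ℤ where
  toFun c := flow c x y
  map_zero' := by simp [flow]
  map_add' c c' := by
    simp only [flow, Pi.add_apply, ← Finset.sum_add_distrib]
    exact Finset.sum_congr rfl fun d _ => by push_cast; ring

theorem oddUnderReversal_flowHom (x y : ℤ × ℤ) : OddUnderReversal (flowHom n x y) := by
  intro c
  change flow _ x y = -flow c x y
  simp only [flow, SimpleGraph.Dart.symm_symm, ← Finset.sum_neg_distrib, neg_sub]

/-- The height of a face, as an additive function of the current. -/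
def heightHom (n : ℕ) (a : ℤ × ℤ) : Current n →+ ℤ :=
  ∑ i ∈ Finset.Icc (-(n : ℤ)) a.1, flowHom n (i, a.2) (i, a.2 + 1)

theorem heightHom_apply (a : ℤ × ℤ) (c : Current n) : heightHom n a c = height c a := by
  simp [heightHom, height, flowHom]

theorem oddUnderReversal_heightHom (a : ℤ × ℤ) : OddUnderReversal (heightHom n a) := by
  intro c
  simp only [heightHom, AddMonoidHom.finsetSum_apply, ← Finset.sum_neg_distrib]
  exact Finset.sum_congr rfl fun i _ => oddUnderReversal_flowHom _ _ c

theorem poissonLaw_surroundEvent {T : ℝ} (hT : 0 ≤ T) (a b : ℤ × ℤ) :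
    poissonLaw n T (surroundEvent n a b)
      = wordLaw n T {w | HasCycle (fun c => heightHom n a c ≠ 0 ∧ heightHom n b c ≠ 0) w} := by
  simp_rw [heightHom_apply]
  exact poissonLaw_hasCycle hT fun c => height c a ≠ 0 ∧ height c b ≠ 0

theorem abs_sign_le_one (k : ℤ) : |((k.sign : ℤ) : ℝ)| ≤ 1 := by
  rcases lt_trichotomy k 0 with h | rfl | h
  · simp [Int.sign_eq_neg_one_of_neg h]
  · simp
  · simp [Int.sign_eq_one_of_pos h]

/-- The sign is odd, so only the event of a common surrounding cycle contributes, and there the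
integrand is at most 1. -/
theorem signCov_le {β : ℝ} (hβ : 0 ≤ β) (a b : ℤ × ℤ) :
    signCov n β a b ≤ (poissonLaw n (β / 2)).real (surroundEvent n a b) := by
  have hT : 0 ≤ β / 2 := by positivity
  set E : Set (Word n) :=
    {w | HasCycle (fun c => heightHom n a c ≠ 0 ∧ heightHom n b c ≠ 0) w} with hE
  set u : Word n → ℝ := fun w => ((heightHom n a (wordCount w)).sign : ℝ)
    * ((heightHom n b (wordCount w)).sign : ℝ) with hu
  have hub : ∀ w, |u w| ≤ 1 := fun w => by
    rw [hu]
    simp only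
    rw [abs_mul]
    exact mul_le_one₀ (abs_sign_le_one _) (abs_nonneg _) (abs_sign_le_one _)
  have hui : Integrable u (wordLaw n (β / 2)) :=
    Integrable.of_bound (.of_discrete) 1 (.of_forall hub)
  have h1 : signCov n β a b = ∫ w, u w ∂wordLaw n (β / 2) := by
    unfold signCov
    rw [← map_wordCount_wordLaw hT, integral_map .of_discrete .of_discrete]
    simp_rw [hu, heightHom_apply]
  have h2 := integral_noCommonCycle (T := β / 2) (oddUnderReversal_heightHom (n := n) a)
    (oddUnderReversal_heightHom b) (fun k => (k.sign : ℝ)) (fun k => (k.sign : ℝ))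
    (fun k => by rw [Int.sign_neg]; push_cast; ring)
  rw [h1, ← integral_add_compl (s := E) .of_discrete hui, h2, add_zero, Measure.real,
    poissonLaw_surroundEvent hT]
  calc ∫ w in E, u w ∂wordLaw n (β / 2) ≤ ∫ _ in E, 1 ∂wordLaw n (β / 2) :=
        integral_mono hui.integrableOn (integrable_const _) fun w => (abs_le.1 (hub w)).2
    _ = _ := by simp only [integral_const, MeasurableSet.univ, measureReal_restrict_apply,
      Set.univ_inter, smul_eq_mul, mul_one]; rfl

/-! ### Cycles that surround two faces -/

theorem height_below {c : Current n} (hc : Sourceless c) :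
    height c (0, 0) = -∑ k ∈ Finset.range (n + 1), flow c (0, -(k : ℤ)) (1, -(k : ℤ)) := by
  have hh := height_isHeight hc
  have key : ∀ N : ℕ, height c (0, 0) = height c (0, -(N : ℤ))
      - ∑ k ∈ Finset.range N, flow c (0, -(k : ℤ)) (1, -(k : ℤ)) := by
    intro N
    induction N with
    | zero => simp
    | succ N ih =>
      have := hh.horizontal 0 (-(N : ℤ))
      rw [zero_add] at this
      rw [Finset.sum_range_succ, ih, ← this]
      push_cast
      rw [show -(N : ℤ) - 1 = -((N : ℤ) + 1) by ring]
      abel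
  -- The face at height `-n` is still bounded, so `n + 1` steps are needed to leave the box.
  rw [key (n + 1), hh.outside _ _ (by push_cast; omega), zero_sub]

theorem height_above {c : Current n} (hc : Sourceless c) (m : ℕ) :
    height c (0, (m : ℤ)) = ∑ k ∈ Finset.range (n + 1),
      flow c (0, (m : ℤ) + (k + 1 : ℕ)) (1, (m : ℤ) + (k + 1 : ℕ)) := by
  have hh := height_isHeight hc
  have key : ∀ N : ℕ, height c (0, (m : ℤ)) = height c (0, (m : ℤ) + N)
      + ∑ k ∈ Finset.range N, flow c (0, (m : ℤ) + (k + 1 : ℕ)) (1, (m : ℤ) + (k + 1 : ℕ)) := by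
    intro N
    induction N with
    | zero => simp
    | succ N ih =>
      have := hh.horizontal 0 ((m : ℤ) + (N + 1 : ℕ))
      rw [zero_add, show (m : ℤ) + (N + 1 : ℕ) - 1 = (m : ℤ) + N by push_cast; ring] at this
      rw [Finset.sum_range_succ, ih, ← this]
      ring
  rw [key (n + 1), hh.outside _ _ (by push_cast; omega), zero_add]

theorem exists_visits_of_flow_ne_zero {c : Current n} {x y : ℤ × ℤ} (h : flow c x y ≠ 0) :
    ∃ hx : x ∈ box n, Visits c ⟨x, hx⟩ := by
  obtain ⟨d, hd, hne⟩ := Finset.exists_ne_zero_of_sum_ne_zero h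
  obtain ⟨h1, -⟩ := (Finset.mem_filter.1 hd).2
  refine ⟨h1 ▸ d.fst.2, ?_⟩
  have h1' : d.fst = ⟨x, h1 ▸ d.fst.2⟩ := Subtype.ext h1
  by_cases hc : c d = 0
  · refine ⟨d.symm, Nat.pos_of_ne_zero fun h0 => hne ?_, Or.inr h1'⟩
    rw [hc, h0]; simp
  · exact ⟨d, Nat.pos_of_ne_zero hc, Or.inl h1'⟩

theorem HasCycle.mono {R S : Current n → Prop} {w : Word n} (h : ∀ c, Sourceless c → R c → S c)
    (hw : HasCycle R w) : HasCycle S w := by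
  obtain ⟨z, hz, hR⟩ := hw
  exact ⟨z, hz, h _ ((balanced_iff_sourceless z).1 hz.isCycle.balanced) hR⟩

theorem wordLaw_commonCycle_le {β : ℝ} (hβ : 0 ≤ β) {x y : ℤ × ℤ} (hxy : x ≠ y) :
    wordLaw n (β / 2) {w | HasCycle (fun c => (∃ hx, Visits c ⟨x, hx⟩) ∧ ∃ hy, Visits c ⟨y, hy⟩) w}
      ≤ ENNReal.ofReal (2 * twoPoint n β x y ^ 2) := by
  by_cases h : x ∈ box n ∧ y ∈ box n
  · refine le_trans (measure_mono ?_) ((poissonLaw_hasCycle (by positivity) fun c =>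
      Visits c ⟨x, h.1⟩ ∧ Visits c ⟨y, h.2⟩).symm.trans_le
      (poissonLaw_commonCycle_le hβ fun h => hxy (congrArg Subtype.val h)))
    rintro w ⟨z, hz, ⟨_, hx⟩, ⟨_, hy⟩⟩
    exact ⟨z, hz, hx, hy⟩
  · refine (measure_mono_null ?_ measure_empty).trans_le zero_le
    rintro w ⟨z, hz, ⟨hx, _⟩, ⟨hy, _⟩⟩
    exact h ⟨hx, hy⟩

/-- A cycle around both faces has non-zero flow across an edge at height at most `0` and across one
at height above `m`; a union bound over the left ends of these edges does the rest. The strict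
inequality keeps the two vertices distinct even for `m = 0`. -/
theorem poissonLaw_surroundEvent_le {β : ℝ} (hβ : 0 ≤ β) (m : ℕ) :
    poissonLaw n (β / 2) (surroundEvent n (0, 0) (0, (m : ℤ)))
      ≤ ∑ x ∈ (box n).filter (fun x => x.1 = 0 ∧ x.2 ≤ 0),
          ∑ y ∈ (box n).filter (fun y => y.1 = 0 ∧ (m : ℤ) < y.2),
            ENNReal.ofReal (2 * twoPoint n β x y ^ 2) := by
  rw [poissonLaw_surroundEvent (by positivity)]
  refine (measure_mono (t := ⋃ x ∈ (box n).filter (fun x => x.1 = 0 ∧ x.2 ≤ 0),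
    ⋃ y ∈ (box n).filter (fun y => y.1 = 0 ∧ (m : ℤ) < y.2), {w | HasCycle (fun c =>
      (∃ hx, Visits c ⟨x, hx⟩) ∧ ∃ hy, Visits c ⟨y, hy⟩) w}) ?_).trans ?_
  · rintro w ⟨z, hz, h1, h2⟩
    have hc := (balanced_iff_sourceless z).1 hz.isCycle.balanced
    rw [heightHom_apply, height_below hc, neg_ne_zero] at h1
    rw [heightHom_apply, height_above hc] at h2
    obtain ⟨i, -, hi⟩ := Finset.exists_ne_zero_of_sum_ne_zero h1
    obtain ⟨j, -, hj⟩ := Finset.exists_ne_zero_of_sum_ne_zero h2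
    obtain ⟨hx, hx'⟩ := exists_visits_of_flow_ne_zero hi
    obtain ⟨hy, hy'⟩ := exists_visits_of_flow_ne_zero hj
    refine Set.mem_biUnion (Finset.mem_coe.2 (Finset.mem_filter.2 ⟨hx, rfl, by simp⟩))
      (Set.mem_biUnion (Finset.mem_coe.2 (Finset.mem_filter.2 ⟨hy, rfl, by simp⟩)) ?_)
    exact ⟨z, hz, ⟨hx, hx'⟩, ⟨hy, hy'⟩⟩
  · refine (measure_biUnion_finset_le _ _).trans (Finset.sum_le_sum fun x hx => ?_)
    refine (measure_biUnion_finset_le _ _).trans (Finset.sum_le_sum fun y hy => ?_)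
    refine wordLaw_commonCycle_le hβ ?_
    rintro rfl
    have h1 := (Finset.mem_filter.1 hx).2.2
    have h2 := (Finset.mem_filter.1 hy).2.2
    omega

theorem real_surroundEvent_le {β : ℝ} (hβ : 0 ≤ β) (n m : ℕ) :
    (poissonLaw n (β / 2)).real (surroundEvent n (0, 0) (0, (m : ℤ))) ≤
      2 * ∑ x ∈ (box n).filter (fun x => x.1 = 0 ∧ x.2 ≤ 0),
        ∑ y ∈ (box n).filter (fun y => y.1 = 0 ∧ (m : ℤ) ≤ y.2), twoPoint n β x y ^ 2 := by
  refine ENNReal.toReal_le_of_le_ofReal (by positivity) ((poissonLaw_surroundEvent_le hβ m).trans ?_)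
  rw [Finset.mul_sum, ENNReal.ofReal_sum_of_nonneg fun x _ => by positivity]
  refine Finset.sum_le_sum fun x _ => ?_
  rw [Finset.mul_sum, ENNReal.ofReal_sum_of_nonneg fun x _ => by positivity]
  refine Finset.sum_le_sum_of_subset fun y hy => ?_
  rw [Finset.mem_filter] at hy ⊢
  exact ⟨hy.1, hy.2.1, hy.2.2.le⟩

theorem sum_le_tsum_subtype {α : Type*} (s : Finset α) {A : Set α} (h : ∀ a ∈ s, a ∈ A)
    (f : α → ℝ≥0∞) : ∑ a ∈ s, f a ≤ ∑' a : A, f a := by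
  rw [tsum_subtype A f]
  refine le_trans (Finset.sum_le_sum fun a ha => ?_) (ENNReal.sum_le_tsum s)
  rw [Set.indicator_of_mem (h a ha)]

theorem surroundEvent_le_tsum {β : ℝ} (hβ : 0 ≤ β) (n m : ℕ) :
    poissonLaw n (β / 2) (surroundEvent n (0, 0) (0, (m : ℤ))) ≤
      2 * ∑' (x : axisBelow) (y : axisAbove m), ENNReal.ofReal (twoPointInf β x.1 y.1 ^ 2) := by
  refine (poissonLaw_surroundEvent_le hβ m).trans ?_
  rw [← ENNReal.tsum_mul_left]
  simp_rw [← ENNReal.tsum_mul_left]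
  have h1 := sum_le_tsum_subtype ((box n).filter fun x => x.1 = 0 ∧ x.2 ≤ 0) (A := axisBelow)
    (fun x hx => by rw [Finset.mem_filter] at hx; exact hx.2)
    fun x => ∑' y : axisAbove m, 2 * ENNReal.ofReal (twoPointInf β x y.1 ^ 2)
  refine le_trans (Finset.sum_le_sum fun x _ => ?_) h1
  have h2 := sum_le_tsum_subtype ((box n).filter fun y => y.1 = 0 ∧ (m : ℤ) < y.2)
    (A := axisAbove m) (fun y hy => ⟨(Finset.mem_filter.1 hy).2.1, (Finset.mem_filter.1 hy).2.2.le⟩)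
    fun y => 2 * ENNReal.ofReal (twoPointInf β x y ^ 2)
  refine le_trans (Finset.sum_le_sum fun y _ => ?_) h2
  rw [ENNReal.ofReal_mul zero_le_two, ENNReal.ofReal_ofNat]
  gcongr
  · exact twoPoint_nonneg hβ _ _ _
  · exact twoPoint_le_twoPointInf hβ _ _ _

end XYHeight

end

noncomputable section

set_option linter.unusedSectionVars false

namespace XYHeight

open scoped Classical

/-! ### Exponential moments of the traffic through an edge -/

variable {n : ℕ}

theorem pf_le_exp_mul {V D : Type*} [Fintype V] [Fintype D] {s t : D → V} {J K : D → ℝ}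
    (h : ∀ d, J d ≤ K d) : pf s t K ≤ Real.exp (∑ d, (K d - J d)) * pf s t J := by
  unfold pf
  rw [← integral_const_mul]
  refine integral_mono (integrable_of_continuous (by fun_prop))
    (integrable_of_continuous (by fun_prop)) fun θ => ?_
  simp only
  rw [← Real.exp_add, Real.exp_le_exp]
  unfold ham
  rw [← Finset.sum_add_distrib]
  refine Finset.sum_le_sum fun d _ => ?_
  nlinarith [(abs_le.1 (abs_cosC_le (θ (s d) - θ (t d)))).2, h d]

/-- The number of directed edges among `xy` and `yx` that `d` is equal to. -/
def edgeWeight (x y : ℤ × ℤ) (d : DirEdge n) : ℕ :=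
  (if d.fst.1 = x ∧ d.snd.1 = y then 1 else 0) + if d.fst.1 = y ∧ d.snd.1 = x then 1 else 0

/-- The traffic `𝐧_{xy} + 𝐧_{yx}`. -/
def traffic (x y : ℤ × ℤ) (c : Current n) : ℕ := ∑ d, edgeWeight x y d * c d

theorem edgeWeight_symm (x y : ℤ × ℤ) (d : DirEdge n) :
    edgeWeight x y d.symm = edgeWeight x y d := by
  unfold edgeWeight
  simp only [Prod.fst_swap, Prod.snd_swap, SimpleGraph.Dart.symm]
  rw [add_comm]
  congr 1 <;> simp only [and_comm]

theorem sum_edgeWeight_le (x y : ℤ × ℤ) : ∑ d : DirEdge n, edgeWeight x y d ≤ 2 := by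
  have h : ∀ a b : ℤ × ℤ, ∑ d : DirEdge n, (if d.fst.1 = a ∧ d.snd.1 = b then 1 else 0) ≤ 1 := by
    intro a b
    rw [← Finset.card_filter, Finset.card_le_one]
    intro d hd e he
    simp only [Finset.mem_filter, Finset.mem_univ, true_and] at hd he
    exact SimpleGraph.Dart.ext _ _ (Prod.ext (Subtype.ext (hd.1.trans he.1.symm))
      (Subtype.ext (hd.2.trans he.2.symm)))
  unfold edgeWeight
  rw [Finset.sum_add_distrib]
  exact add_le_add (h x y) (h y x)

theorem abs_flow_le_traffic (x y : ℤ × ℤ) (c : Current n) : |flow c x y| ≤ traffic x y c := by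
  have h1 : ∑ d : DirEdge n with d.fst.1 = x ∧ d.snd.1 = y, (c d.symm : ℤ)
      = ∑ d : DirEdge n with d.fst.1 = y ∧ d.snd.1 = x, (c d : ℤ) := by
    refine Finset.sum_nbij' (fun d => d.symm) (fun d => d.symm) ?_ ?_ ?_ ?_ ?_
    · intro d hd; simpa [and_comm] using hd
    · intro d hd; simpa [and_comm] using hd
    · intro d _; simp
    · intro d _; simp
    · intro d _; simp
  have h2 : (traffic x y c : ℤ) = ∑ d : DirEdge n with d.fst.1 = x ∧ d.snd.1 = y, (c d : ℤ)
      + ∑ d : DirEdge n with d.fst.1 = y ∧ d.snd.1 = x, (c d : ℤ) := by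
    unfold traffic edgeWeight
    push_cast
    simp_rw [add_mul, Finset.sum_add_distrib, ite_mul, one_mul, zero_mul, Finset.sum_filter]
  have h3 : flow c x y = ∑ d : DirEdge n with d.fst.1 = x ∧ d.snd.1 = y, (c d : ℤ)
      - ∑ d : DirEdge n with d.fst.1 = y ∧ d.snd.1 = x, (c d : ℤ) := by
    rw [← h1, ← Finset.sum_sub_distrib]; rfl
  have h4 : ∀ a b, 0 ≤ ∑ d : DirEdge n with d.fst.1 = a ∧ d.snd.1 = b, (c d : ℤ) :=
    fun a b => Finset.sum_nonneg fun d _ => Nat.cast_nonneg _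
  rw [h2, h3, abs_le]
  have := h4 x y
  have := h4 y x
  constructor <;> linarith

theorem currentMeasure_sourceless (T : ℝ) :
    currentMeasure n T {c | Sourceless c} = currentSum n (fun _ => T) 0 := by
  rw [currentMeasure_apply, currentSum]
  refine tsum_congr fun c => ?_
  congr 1
  exact propext funext_iff.symm

theorem lintegral_currentLaw (T : ℝ) (g : Current n → ℝ≥0∞) :
    ∫⁻ c, g c ∂currentLaw n T = (currentSum n (fun _ => T) 0)⁻¹ * ∑' c,
      if HasSource c 0 then ENNReal.ofReal (∏ d, T ^ c d / (c d)!) * g c else 0 := by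
  rw [currentLaw, ProbabilityTheory.cond, lintegral_smul_measure, currentMeasure_sourceless,
    ← lintegral_indicator .of_discrete, currentMeasure, lintegral_sum_measure, smul_eq_mul]
  congr 1
  refine tsum_congr fun c => ?_
  rw [lintegral_smul_measure, lintegral_dirac, smul_eq_mul, Set.indicator_apply]
  have : c ∈ {c : Current n | Sourceless c} ↔ HasSource c 0 := funext_iff.symm
  by_cases h : HasSource c 0
  · rw [if_pos h, if_pos (this.2 h)]
  · rw [if_neg h, if_neg fun h' => h (this.1 h'), mul_zero]

theorem pow_le_one_add_mul {A : ℝ} (hA : 1 ≤ A) {e : ℕ} (he : e ≤ 2) :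
    A ^ e - 1 ≤ e * (A ^ 2 - 1) := by
  interval_cases e
  · simp
  · norm_num; nlinarith
  · norm_num; nlinarith

/-- The exponential moments of the traffic through an edge are bounded uniformly in the box. -/
theorem lintegral_pow_traffic_le {T : ℝ} (hT : 0 ≤ T) {A : ℝ} (hA : 1 ≤ A) (x y : ℤ × ℤ) :
    ∫⁻ c, ENNReal.ofReal (A ^ traffic x y c) ∂currentLaw n T
      ≤ ENNReal.ofReal (Real.exp (2 * T * (A ^ 2 - 1))) := by
  set J : DirEdge n → ℝ := fun d => T * A ^ edgeWeight x y d with hJ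
  -- The factor `A ^ traffic` multiplies the couplings of the two orientations of one edge, so the
  -- moment is a ratio of partition functions.
  have h1 : ∑' c : Current n, (if HasSource c 0 then ENNReal.ofReal (∏ d, T ^ c d / (c d)!)
      * ENNReal.ofReal (A ^ traffic x y c) else 0) = currentSum n J 0 := by
    refine tsum_congr fun c => ?_
    congr 1
    rw [← ENNReal.ofReal_mul (Finset.prod_nonneg fun d _ => by positivity)]
    congr 1
    unfold traffic
    rw [← Finset.prod_pow_eq_pow_sum, ← Finset.prod_mul_distrib]
    refine Finset.prod_congr rfl fun d _ => ?_
    rw [hJ, mul_pow, pow_mul]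
    ring
  have hJ0 : ∀ d, T ≤ J d := fun d => le_mul_of_one_le_right hT (one_le_pow₀ hA)
  rw [lintegral_currentLaw, h1, currentSum_zero (fun d => by rw [hJ]; simp only [edgeWeight_symm])
    (fun d => hT.trans (hJ0 d)), currentSum_zero (fun _ => rfl) (fun _ => hT),
    ← ENNReal.ofReal_inv_of_pos (pf_pos _ _ _), ← ENNReal.ofReal_mul (by
      have := pf_pos (fun d : DirEdge n => d.fst) (fun d => d.snd) fun _ => T
      positivity)]
  refine ENNReal.ofReal_le_ofReal ?_
  rw [inv_mul_le_iff₀ (pf_pos _ _ _), mul_comm]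
  refine (pf_le_exp_mul hJ0).trans ?_
  have := (pf_pos (fun d : DirEdge n => d.fst) (fun d => d.snd) fun _ => T).le
  gcongr
  have hA2 : 0 ≤ A ^ 2 - 1 := by nlinarith
  calc ∑ d, (J d - T) ≤ ∑ d : DirEdge n, T * (edgeWeight x y d * (A ^ 2 - 1)) := by
        refine Finset.sum_le_sum fun d _ => ?_
        have := pow_le_one_add_mul hA (e := edgeWeight x y d) (by
          refine le_trans ?_ (sum_edgeWeight_le (n := n) x y)
          exact Finset.single_le_sum (f := fun d => edgeWeight x y d) (fun d _ => Nat.zero_le _)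
            (Finset.mem_univ d))
        calc J d - T = T * (A ^ edgeWeight x y d - 1) := by rw [hJ]; ring
          _ ≤ _ := by gcongr
    _ = T * (A ^ 2 - 1) * ((∑ d : DirEdge n, edgeWeight x y d : ℕ) : ℝ) := by
        push_cast
        rw [Finset.mul_sum]
        exact Finset.sum_congr rfl fun d _ => by ring
    _ ≤ T * (A ^ 2 - 1) * 2 := by
        gcongr
        exact_mod_cast sum_edgeWeight_le x y
    _ = 2 * T * (A ^ 2 - 1) := by ring

theorem integrable_pow_traffic {T : ℝ} (hT : 0 ≤ T) {A : ℝ} (hA : 1 ≤ A) (x y : ℤ × ℤ) :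
    Integrable (fun c => A ^ traffic x y c) (currentLaw n T) := by
  refine ⟨.of_discrete, ?_⟩
  rw [hasFiniteIntegral_iff_ofReal (.of_forall fun c => by positivity)]
  exact (lintegral_pow_traffic_le hT hA x y).trans_lt ENNReal.ofReal_lt_top

theorem integral_pow_traffic_le {T : ℝ} (hT : 0 ≤ T) {A : ℝ} (hA : 1 ≤ A) (x y : ℤ × ℤ) :
    ∫ c, A ^ traffic x y c ∂currentLaw n T ≤ Real.exp (2 * T * (A ^ 2 - 1)) := by
  rw [integral_eq_lintegral_of_nonneg_ae (.of_forall fun c => by positivity) .of_discrete]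
  exact ENNReal.toReal_le_of_le_ofReal (Real.exp_pos _).le (lintegral_pow_traffic_le hT hA x y)

theorem sq_le_two_mul_two_pow (k : ℕ) : k ^ 2 ≤ 2 * 2 ^ k := by
  induction k with
  | zero => norm_num
  | succ k ih =>
    have := Nat.lt_two_pow_self (n := k)
    rw [pow_succ 2 k]
    nlinarith

/-- Up to `M` the first term suffices. Beyond `M`, the square is at most `2 * 2 ^ k`, and the spare
factor `B ^ (k - M)` is at least 1. -/
theorem sq_le_truncation {B : ℝ} (hB : 1 ≤ B) (k M : ℕ) :
    (k : ℝ) ^ 2 ≤ M ^ 2 + 2 * ((2 * B) ^ k / B ^ M) := by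
  have hB0 : 0 < B := zero_lt_one.trans_le hB
  rcases le_total k M with h | h
  · have : (k : ℝ) ^ 2 ≤ (M : ℝ) ^ 2 := by gcongr
    have : 0 ≤ 2 * ((2 * B) ^ k / B ^ M) := by positivity
    linarith
  · have h1 : (k : ℝ) ^ 2 ≤ 2 * 2 ^ k := by exact_mod_cast sq_le_two_mul_two_pow k
    have h2 : (2 * B) ^ k / B ^ M = 2 ^ k * B ^ (k - M) := by
      rw [mul_pow, mul_div_assoc, pow_sub₀ B hB0.ne' h]
      rfl
    have h3 : (2 : ℝ) ^ k ≤ 2 ^ k * B ^ (k - M) := le_mul_of_one_le_right (by positivity)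
      (one_le_pow₀ hB)
    have : (0 : ℝ) ≤ (M : ℝ) ^ 2 := by positivity
    rw [h2]
    linarith

theorem abs_flow_mul_flow_le {B : ℝ} (hB : 1 ≤ B) (M : ℕ) (x x' y y' : ℤ × ℤ) (c : Current n) :
    |(flow c x x' : ℝ) * flow c y y'| ≤ (M : ℝ) ^ 2
      + ((2 * B) ^ traffic x x' c + (2 * B) ^ traffic y y' c) / B ^ M := by
  have h1 : |(flow c x x' : ℝ)| ≤ traffic x x' c := by exact_mod_cast abs_flow_le_traffic x x' c
  have h2 : |(flow c y y' : ℝ)| ≤ traffic y y' c := by exact_mod_cast abs_flow_le_traffic y y' c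
  have h3 := sq_le_truncation hB (traffic x x' c) M
  have h4 := sq_le_truncation hB (traffic y y' c) M
  rw [abs_mul, add_div]
  have h5 : |(flow c x x' : ℝ)| * |(flow c y y' : ℝ)| ≤ traffic x x' c * traffic y y' c := by
    gcongr
  nlinarith [sq_nonneg ((traffic x x' c : ℝ) - traffic y y' c)]

theorem isProbabilityMeasure_currentLaw (T : ℝ) : IsProbabilityMeasure (currentLaw n T) :=
  ProbabilityTheory.cond_isProbabilityMeasure_of_finite (currentMeasure_sourceless_pos T)
    (currentMeasure_ne_top T _)

theorem integrable_flow_mul_flow {T : ℝ} (hT : 0 ≤ T) (x x' y y' : ℤ × ℤ) :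
    Integrable (fun c => (flow c x x' : ℝ) * flow c y y') (currentLaw n T) := by
  have := isProbabilityMeasure_currentLaw (n := n) T
  have hi := fun x y => integrable_pow_traffic (n := n) hT (A := 2 * 1) (by norm_num) x y
  refine Integrable.mono' ((integrable_const _).add (((hi x x').add (hi y y')).div_const _))
    .of_discrete (.of_forall fun c => abs_flow_mul_flow_le le_rfl 0 x x' y y' c)

/-- Non-zero flow through an edge means a visit to its origin, so only configurations with a cycle
through both `x` and `y` contribute. On this event the product is truncated at `M`, and the excess
is paid for by the exponential moments. -/
theorem abs_integral_flow_mul_flow_le {β : ℝ} (hβ : 0 ≤ β) {x y : ℤ × ℤ} (hxy : x ≠ y)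
    (x' y' : ℤ × ℤ) {B : ℝ} (hB : 1 ≤ B) (M : ℕ) :
    |∫ c, (flow c x x' : ℝ) * flow c y y' ∂currentLaw n (β / 2)|
      ≤ (M : ℝ) ^ 2 * (2 * twoPoint n β x y ^ 2)
        + 2 * Real.exp (β * ((2 * B) ^ 2 - 1)) / B ^ M := by
  have hT : 0 ≤ β / 2 := by positivity
  have hB0 : 0 < B := zero_lt_one.trans_le hB
  set F := flowHom n x x'
  set G := flowHom n y y'
  set E : Set (Word n) := {w | HasCycle (fun c => F c ≠ 0 ∧ G c ≠ 0) w} with hE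
  set μ := wordLaw n (β / 2) with hμ
  set u : Word n → ℝ := fun w => (F (wordCount w) : ℝ) * (G (wordCount w) : ℝ) with hu
  set b : Current n → ℝ := fun c =>
    ((2 * B) ^ traffic x x' c + (2 * B) ^ traffic y y' c) / B ^ M with hb
  have hb0 : ∀ c, 0 ≤ b c := fun c => by positivity
  have hmap := map_wordCount_wordLaw (n := n) hT
  have hui : Integrable u μ := by
    have h := integrable_flow_mul_flow (n := n) hT x x' y y'
    rw [← hmap, integrable_map_measure .of_discrete .of_discrete] at h
    exact h
  have hbi' : Integrable b (currentLaw n (β / 2)) :=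
    ((integrable_pow_traffic hT (by linarith) x x').add
      (integrable_pow_traffic hT (by linarith) y y')).div_const _
  have hbi : Integrable (fun w => b (wordCount w)) μ := by
    have h := hbi'
    rw [← hmap, integrable_map_measure .of_discrete .of_discrete] at h
    exact h
  have h1 : ∫ c, (flow c x x' : ℝ) * flow c y y' ∂currentLaw n (β / 2) = ∫ w, u w ∂μ := by
    rw [← hmap, integral_map .of_discrete .of_discrete]
    rfl
  have h2 : ∫ w in Eᶜ, u w ∂μ = 0 := integral_noCommonCycle (oddUnderReversal_flowHom x x')
    (oddUnderReversal_flowHom y y') (fun k => (k : ℝ)) (fun k => (k : ℝ))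
    (fun k => by push_cast; ring)
  have hPE : μ.real E ≤ 2 * twoPoint n β x y ^ 2 := by
    refine ENNReal.toReal_le_of_le_ofReal (by positivity) (le_trans (measure_mono ?_)
      (wordLaw_commonCycle_le hβ hxy))
    intro w hw
    exact HasCycle.mono (R := fun c => F c ≠ 0 ∧ G c ≠ 0)
      (S := fun c => (∃ hx, Visits c ⟨x, hx⟩) ∧ ∃ hy, Visits c ⟨y, hy⟩) (fun c _ hc => ⟨exists_visits_of_flow_ne_zero hc.1,
      exists_visits_of_flow_ne_zero hc.2⟩) hw
  rw [h1, ← integral_add_compl (s := E) .of_discrete hui, h2, add_zero]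
  calc |∫ w in E, u w ∂μ| ≤ ∫ w in E, |u w| ∂μ := abs_integral_le_integral_abs
    _ ≤ ∫ w in E, ((M : ℝ) ^ 2 + b (wordCount w)) ∂μ := by
        refine integral_mono hui.abs.integrableOn
          ((integrable_const _).add hbi).integrableOn fun w => ?_
        exact abs_flow_mul_flow_le hB M x x' y y' _
    _ = (M : ℝ) ^ 2 * μ.real E + ∫ w in E, b (wordCount w) ∂μ := by
        rw [integral_add (integrable_const _) hbi.integrableOn]
        simp [Measure.real, mul_comm]
    _ ≤ (M : ℝ) ^ 2 * (2 * twoPoint n β x y ^ 2) + ∫ w, b (wordCount w) ∂μ := by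
        gcongr
        · exact .of_forall fun w => hb0 _
        · exact Measure.restrict_le_self
    _ ≤ _ := by
        gcongr
        have h3 : ∫ w, b (wordCount w) ∂μ = ∫ c, b c ∂currentLaw n (β / 2) := by
          rw [← hmap, integral_map .of_discrete .of_discrete]
        rw [h3, hb, integral_div, integral_add (integrable_pow_traffic hT (by linarith) x x')
          (integrable_pow_traffic hT (by linarith) y y')]
        gcongr
        have h4 := integral_pow_traffic_le (n := n) hT (A := 2 * B) (by linarith) x x'
        have h5 := integral_pow_traffic_le (n := n) hT (A := 2 * B) (by linarith) y y'
        rw [mul_div_cancel₀ β two_ne_zero] at h4 h5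
        linarith

end XYHeight

end

noncomputable section

set_option linter.unusedSectionVars false

namespace XYHeight

open scoped Classical


/-! ### The inequality between the masses -/

variable {n : ℕ} {β : ℝ}

theorem sq_mul_exp_le {δ : ℝ} (hδ : 0 < δ) (ℓ : ℕ) :
    (ℓ : ℝ) ^ 2 ≤ 2 / δ ^ 2 * Real.exp (δ * ℓ) := by
  have h := Real.pow_div_factorial_le_exp (δ * ℓ) (by positivity) 2
  rw [Nat.factorial_two, mul_pow, Nat.cast_two] at h
  rw [div_mul_eq_mul_div, le_div_iff₀ (by positivity)]
  linarith

theorem exists_abs_integral_flow_mul_flow_le (hβ : 0 ≤ β) {r r' : ℝ} (hr0 : 0 < r) (hr' : r' < r)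
    (hr : (r : EReal) < massXY β) : ∃ C : ℝ, 0 ≤ C ∧ ∀ (n i ℓ : ℕ) (x' y' : ℤ × ℤ), 0 < ℓ →
      |∫ c, (flow c (0, -(i : ℤ)) x' : ℝ) * flow c (0, -(i : ℤ) + ℓ) y' ∂currentLaw n (β / 2)|
        ≤ C * Real.exp (-(2 * r')) ^ ℓ := by
  set K := 2 * Real.exp (β * ((2 * Real.exp (2 * r)) ^ 2 - 1)) with hK
  have hδ : 0 < 2 * (r - r') := by linarith
  refine ⟨2 * (2 / (2 * (r - r')) ^ 2) + K, by positivity, fun n i ℓ x' y' hℓ => ?_⟩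
  have hxy : ((0 : ℤ), -(i : ℤ)) ≠ (0, -(i : ℤ) + ℓ) := by
    intro h
    have := congrArg Prod.snd h
    simp only at this
    omega
  -- Truncation at `M = ℓ` with `B = exp (2 * r)`: the error decays like `exp (-2rℓ)`, as fast as
  -- the bound on the squared two-point function. The factor `ℓ ^ 2` of the main term is absorbed in
  -- the gap between `r'` and `r`.
  have h1 := abs_integral_flow_mul_flow_le (n := n) hβ hxy x' y'
    (Real.one_le_exp (by linarith : 0 ≤ 2 * r)) ℓ
  have h2 : twoPoint n β (0, -(i : ℤ)) (0, -(i : ℤ) + ℓ) ≤ Real.exp (-(r * ℓ)) :=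
    (twoPoint_le_twoPointInf hβ n _ _).trans
      ((twoPointInf_vertical hβ 0 _ ℓ).trans_le (axisCorr_le_exp hβ hr ℓ))
  have h3 : twoPoint n β (0, -(i : ℤ)) (0, -(i : ℤ) + ℓ) ^ 2 ≤ Real.exp (-(2 * r * ℓ)) := by
    refine (pow_le_pow_left₀ (twoPoint_nonneg hβ n _ _) h2 2).trans_eq ?_
    rw [← Real.exp_nat_mul]
    congr 1
    push_cast
    ring
  have h4 : Real.exp (2 * (r - r') * ℓ) * Real.exp (-(2 * r * ℓ)) = Real.exp (-(2 * r')) ^ ℓ := by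
    rw [← Real.exp_add, ← Real.exp_nat_mul]
    congr 1
    ring
  have h5 : K / Real.exp (2 * r) ^ ℓ = K * Real.exp (-(2 * r * ℓ)) := by
    rw [div_eq_mul_inv, ← Real.exp_nat_mul, ← Real.exp_neg]
    congr 3
    ring
  have h6 : 1 ≤ Real.exp (2 * (r - r') * ℓ) := Real.one_le_exp (by positivity)
  have h7 := sq_mul_exp_le hδ ℓ
  have hK0 : 0 ≤ K := by positivity
  calc _ ≤ _ := h1
    _ ≤ (ℓ : ℝ) ^ 2 * (2 * Real.exp (-(2 * r * ℓ))) + K * Real.exp (-(2 * r * ℓ)) := by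
        rw [← h5]
        gcongr
    _ = (2 * (ℓ : ℝ) ^ 2 + K * 1) * Real.exp (-(2 * r * ℓ)) := by ring
    _ ≤ (2 * (2 / (2 * (r - r')) ^ 2 * Real.exp (2 * (r - r') * ℓ))
        + K * Real.exp (2 * (r - r') * ℓ)) * Real.exp (-(2 * r * ℓ)) := by gcongr
    _ = _ := by rw [← h4]; ring

/-- The dual paths from the two faces leave the box in opposite directions, which accounts for the
minus sign. -/
theorem heightCov_eq_sum (hβ : 0 ≤ β) (n k : ℕ) :
    heightCov n β (0, 0) (0, (k : ℤ)) = ∑ i ∈ Finset.range (n + 1), ∑ j ∈ Finset.range (n + 1),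
      -∫ c, (flow c (0, -(i : ℤ)) (1, -(i : ℤ)) : ℝ)
        * flow c (0, (k : ℤ) + (j + 1 : ℕ)) (1, (k : ℤ) + (j + 1 : ℕ)) ∂currentLaw n (β / 2) := by
  have hT : 0 ≤ β / 2 := by positivity
  have hae : ∀ᵐ c ∂currentLaw n (β / 2), Sourceless c :=
    ProbabilityTheory.ae_cond_mem .of_discrete
  have hi := fun i j : ℕ => (integrable_flow_mul_flow (n := n) hT (0, -(i : ℤ)) (1, -(i : ℤ))
    (0, (k : ℤ) + (j + 1 : ℕ)) (1, (k : ℤ) + (j + 1 : ℕ))).fun_neg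
  unfold heightCov
  simp_rw [← integral_neg]
  rw [integral_congr_ae (g := fun c => ∑ i ∈ Finset.range (n + 1), ∑ j ∈ Finset.range (n + 1),
    -((flow c (0, -(i : ℤ)) (1, -(i : ℤ)) : ℝ)
      * flow c (0, (k : ℤ) + (j + 1 : ℕ)) (1, (k : ℤ) + (j + 1 : ℕ)))),
    integral_finsetSum _ fun i _ => integrable_finsetSum _ fun j _ => hi i j]
  · exact Finset.sum_congr rfl fun i _ => integral_finsetSum _ fun j _ => hi i j
  · filter_upwards [hae] with c hc
    rw [height_below hc, height_above hc]
    push_cast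
    simp only [neg_mul, Finset.sum_mul_sum, Finset.sum_neg_distrib]

theorem geom_sum_range_le {q : ℝ} (h0 : 0 ≤ q) (h1 : q < 1) (N : ℕ) :
    ∑ i ∈ Finset.range N, q ^ i ≤ (1 - q)⁻¹ :=
  (tsum_geometric_of_lt_one h0 h1) ▸
    (summable_geometric_of_lt_one h0 h1).sum_le_tsum _ fun i _ => by positivity

/-- The origins of the two edges are at distance `k + 1 + i + j`, so the double sum is geometric in
`i` and in `j`. -/
theorem exists_heightCov_le (hβ : 0 ≤ β) {r r' : ℝ} (hr0 : 0 < r') (hr' : r' < r)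
    (hr : (r : EReal) < massXY β) : ∃ C : ℝ, 0 ≤ C ∧ ∀ n k : ℕ,
      heightCov n β (0, 0) (0, (k : ℤ)) ≤ C * Real.exp (-(2 * r')) ^ k := by
  obtain ⟨C, hC, h⟩ := exists_abs_integral_flow_mul_flow_le hβ (hr0.trans hr') hr' hr
  set q := Real.exp (-(2 * r')) with hq
  have hq0 : 0 ≤ q := (Real.exp_pos _).le
  have hq1 : q < 1 := (by rw [← Real.exp_zero, Real.exp_lt_exp]; linarith)
  have hS : 0 ≤ (1 - q)⁻¹ := inv_nonneg.2 (by linarith)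
  refine ⟨C * q * ((1 - q)⁻¹ * (1 - q)⁻¹), by positivity, fun n k => ?_⟩
  rw [heightCov_eq_sum hβ]
  calc _ ≤ ∑ i ∈ Finset.range (n + 1), ∑ j ∈ Finset.range (n + 1), C * q ^ (k + 1 + i + j) := by
        refine Finset.sum_le_sum fun i _ => Finset.sum_le_sum fun j _ => ?_
        have hij := h n i (k + 1 + i + j) (1, -(i : ℤ)) (1, (k : ℤ) + (j + 1 : ℕ)) (by omega)
        rw [show -(i : ℤ) + ((k + 1 + i + j : ℕ) : ℤ) = (k : ℤ) + (j + 1 : ℕ) by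
          push_cast; ring] at hij
        exact (neg_le_abs _).trans hij
    _ = C * q * ((∑ i ∈ Finset.range (n + 1), q ^ i) * ∑ j ∈ Finset.range (n + 1), q ^ j)
        * q ^ k := by
        rw [Finset.sum_mul_sum, Finset.mul_sum, Finset.sum_mul]
        refine Finset.sum_congr rfl fun i _ => ?_
        rw [Finset.mul_sum, Finset.sum_mul]
        exact Finset.sum_congr rfl fun j _ => by ring
    _ ≤ _ := by
        have h1 := geom_sum_range_le hq0 hq1 (n + 1)
        have h2 : 0 ≤ ∑ i ∈ Finset.range (n + 1), q ^ i :=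
          Finset.sum_nonneg fun i _ => by positivity
        gcongr

theorem massHeight_nonneg (β : ℝ) : 0 ≤ massHeight β := by
  refine le_liminf_of_le (by isBoundedDefault) (.of_forall fun k => ?_)
  exact EReal.div_nonneg (EReal.neg_nonneg.2 (ENNReal.log_le_zero_iff.2 (min_le_right _ _)))
    (by exact_mod_cast k.cast_nonneg)

/-- The bound is uniform in `n` and passes to the upper limit; the gap between `z` and `r'` absorbs
the constant `C` for large `k`. -/
theorem le_massHeight (hβ : 0 ≤ β) {r r' z : ℝ} (hz : z < r') (hr0 : 0 < r') (hr' : r' < r)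
    (hr : (r : EReal) < massXY β) : ((2 * z : ℝ) : EReal) ≤ massHeight β := by
  obtain ⟨C, hC, h⟩ := exists_heightCov_le hβ hr0 hr' hr
  have hlim : Tendsto (fun k : ℕ => C * Real.exp (-(2 * (r' - z))) ^ k) atTop (𝓝 0) := by
    simpa using (tendsto_pow_atTop_nhds_zero_of_lt_one (Real.exp_pos _).le
      (by rw [← Real.exp_zero, Real.exp_lt_exp]; linarith)).const_mul C
  refine le_liminf_of_le (by isBoundedDefault) ?_
  filter_upwards [hlim.eventually_le_const zero_lt_one, eventually_gt_atTop 0] with k hk hk0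
  have hk0' : (0 : ℝ) < k := by exact_mod_cast hk0
  have h1 : heightCovInf β (0, 0) (0, (k : ℤ)) ≤ ENNReal.ofReal (Real.exp (-(2 * z * k))) := by
    refine limsup_le_of_le (by isBoundedDefault) (.of_forall fun n => ?_)
    refine ENNReal.ofReal_le_ofReal ((h n k).trans ?_)
    have : Real.exp (-(2 * r')) ^ k
        = Real.exp (-(2 * (r' - z))) ^ k * Real.exp (-(2 * z * k)) := by
      rw [← Real.exp_nat_mul, ← Real.exp_nat_mul, ← Real.exp_add]
      congr 1
      ring
    rw [this, ← mul_assoc]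
    exact mul_le_of_le_one_left (Real.exp_pos _).le hk
  rw [EReal.le_div_iff_mul_le (by exact_mod_cast hk0') (EReal.coe_ne_top _), EReal.le_neg]
  refine (ENNReal.log_monotone ((min_le_left _ _).trans h1)).trans_eq ?_
  rw [ENNReal.log_ofReal_of_pos (Real.exp_pos _), Real.log_exp]
  norm_cast

/-- Tested on reals `z` below the XY mass. Two further reals `z < r' < r` below it give room for the
constant and for the polynomial factor; for `z ≤ 0` non-negativity of the height mass suffices. -/
theorem massXY_le (hβ : 0 ≤ β) : massXY β ≤ massHeight β / 2 := by
  refine EReal.ge_of_forall_gt_iff_ge.1 fun z hz => ?_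
  rw [EReal.le_div_iff_mul_le (by norm_num) (by decide)]
  rcases le_or_gt z 0 with h0 | h0
  · refine le_trans ?_ (massHeight_nonneg β)
    exact EReal.mul_nonpos_iff.2 (.inr ⟨by exact_mod_cast h0, by norm_num⟩)
  · obtain ⟨r', h1, h2⟩ := EReal.lt_iff_exists_real_btwn.1 hz
    obtain ⟨r, h3, h4⟩ := EReal.lt_iff_exists_real_btwn.1 h2
    have h1 := EReal.coe_lt_coe_iff.1 h1
    refine le_trans (le_of_eq ?_) (le_massHeight hβ h1 (h0.trans h1) (EReal.coe_lt_coe_iff.1 h3) h4)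
    rw [mul_comm]
    norm_cast

end XYHeight

end

/-! ### The lemma. -/

theorem mainTheorem3 (β : ℝ) (hβ : 0 ≤ β) :
    -- the full-plane two-point function and the XY mass are genuine limits
    (∀ x y : ℤ × ℤ, Tendsto (fun n : ℕ => twoPoint n β x y) atTop (𝓝 (twoPointInf β x y))) ∧
    Tendsto (xyDecayRate β) atTop (𝓝 (massXY β)) ∧
    -- the inequality between the masses
    massXY β ≤ massHeight β / 2 ∧
    -- the sign covariance is at most the probability that some cycle surrounds both faces
    (∀ (n : ℕ) (a b : ℤ × ℤ),
      signCov n β a b ≤ (poissonLaw n (β / 2)).real (surroundEvent n a b)) ∧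
    -- which is bounded through the two-point function, in the box and in the full plane
    (∀ n m : ℕ,
      (poissonLaw n (β / 2)).real (surroundEvent n (0, 0) (0, (m : ℤ))) ≤
        2 * ∑ x ∈ (box n).filter (fun x => x.1 = 0 ∧ x.2 ≤ 0),
          ∑ y ∈ (box n).filter (fun y => y.1 = 0 ∧ (m : ℤ) ≤ y.2), twoPoint n β x y ^ 2) ∧
    (∀ n m : ℕ,
      poissonLaw n (β / 2) (surroundEvent n (0, 0) (0, (m : ℤ))) ≤
        2 * ∑' (x : axisBelow) (y : axisAbove m),
          ENNReal.ofReal (twoPointInf β x.1 y.1 ^ 2)) := by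
  exact ⟨tendsto_twoPoint hβ, tendsto_xyDecayRate hβ, massXY_le hβ,
    fun n a b => signCov_le hβ a b, fun n m => real_surroundEvent_le hβ n m,
    fun n m => surroundEvent_le_tsum hβ n m⟩
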